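/- Modules are right modules. For a ring $R$, let $\mathbf K(\mathrm{Mod}\,R)$ be the homotopy category of (unbounded) complexes of $R$-modules, and let $\mathbf K(\mathrm{Inj}\,R)$ and $\mathbf K(\mathrm{Proj}\,R)$ be its full subcategories of complexes with injective, respectively projective, terms. Let $\lambda$ denote a left adjoint of the inclusion $\mathbf K(\mathrm{Inj}\,R)\hookrightarrow\mathbf K(\mathrm{Mod}\,R)$, and let $\rho$ denote a right adjoint of the inclusion $\mathbf K(\mathrm{Proj}\,R)\hookrightarrow\mathbf K(\mathrm{Mod}\,R)$. For a complex $X$ choose epimorphisms $P_{X^i}\to X^i$ from projective modules and let $P_X$ be the contractible complex with terms $P_{X^i}\oplus P_{X^{i-1}}$ and differential $\left(\begin{smallmatrix}0&0\\1&0\end{smallmatrix}\right)$; let $\Omega X$ be the kernel of the induced epimorphism $P_X\to X$. Dually, embed $X$ in a contractible complex $I_X$ of injectives, with terms $I_{X^{i+1}}\oplus I_{X^{i}}$ for chosen embeddings $X^i\to I_{X^i}$ into injective modules, and let $\mho X$ be the cokernel of $X\to I_X$. These define endofunctors $\Omega,\mho$ of $\mathbf K(\mathrm{Mod}\,R)$;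 put $\widetilde\Omega=\Omega\circ[1]$ and $\widetilde\mho=\mho\circ[-1]$. Let $f\colon\Lambda\to\Gamma$ be a morphism of rings, and let $\mathrm{res}$ be restriction of modules along $f$. (1) Suppose that the left $\Lambda$-module ${}_\Lambda\Gamma$ has finite projective dimension, and let $d\ge 0$ be an integer with $\operatorname{pd}{}_\Lambda\Gamma\le d$ (for instance $d=\operatorname{pd}{}_\Lambda\Gamma$). Then the adjoints $\lambda$ exist for $\Lambda$ and $\Gamma$, the functor $\operatorname{Hom}_\Lambda(\Gamma,-)$ sends complexes of injectives to complexes of injectives, and there is an adjoint triple $$\lambda(\widetilde\Omega^{d}-\otimes_\Lambda\Gamma)\ \dashv\ \lambda\,\mathrm{res}\ \dashv\ \operatorname{Hom}_\Lambda(\Gamma,-)$$ whose outer functors go from $\mathbf K(\mathrm{Inj}\,\Lambda)$ to $\mathbf K(\mathrm{Inj}\,\Gamma)$ and whose middle functor goes back. (2) Suppose that the right $\Lambda$-module $\Gamma_\Lambda$ has finite projective dimension, and let $d'\ge 0$ be an integer with $\operatorname{pd}\Gamma_\Lambda\le d'$ (for instance $d'=\operatorname{pd}\Gamma_\Lambda$).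 Then the adjoints $\rho$ exist for $\Lambda$ and $\Gamma$, the functor $-\otimes_\Lambda\Gamma$ sends complexes of projectives to complexes of projectives, and there is an adjoint triple $$-\otimes_\Lambda\Gamma\ \dashv\ \rho\,\mathrm{res}\ \dashv\ \rho\operatorname{Hom}_\Lambda(\Gamma,\widetilde\mho^{d'}-)$$ whose outer functors go from $\mathbf K(\mathrm{Proj}\,\Lambda)$ to $\mathbf K(\mathrm{Proj}\,\Gamma)$ and whose middle functor goes back. -/

import Mathlib

open CategoryTheory CategoryTheory.Limits

universe v u

noncomputable section

namespace HomotopyAdj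

section Complexes

variable {C : Type u} [Category.{v} C] [Abelian C]

/-- The direct sum of the complexes `⋯ → 0 → A i = A i → 0 → ⋯` (in degrees `i` and `i + 1`):
the term in degree `n` is `A n ⊞ A (n - 1)` and the differential is the matrix `(0 0; 1 0)`. -/
abbrev discs (A : ℤ → C) : CochainComplex C ℤ where
  X n := A n ⊞ A (n - 1)
  d i j := if h : i + 1 = j then
      biprod.fst ≫ eqToHom (congrArg A (show i = j - 1 by omega)) ≫ biprod.inr
    else 0
  shape i j h := dif_neg h
  d_comp_d' i j k hij hjk := by
    have hij' : i + 1 = j := hij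
    have hjk' : j + 1 = k := hjk
    simp [dif_pos hij', dif_pos hjk']

lemma discs_d (A : ℤ → C) (i j : ℤ) (h : i + 1 = j) :
    (discs A).d i j =
      (biprod.fst : A i ⊞ A (i - 1) ⟶ A i) ≫
        eqToHom (congrArg A (show i = j - 1 by omega)) ≫
          (biprod.inr : A (j - 1) ⟶ A j ⊞ A (j - 1)) :=
  dif_pos h

/-- The morphism out of `discs A` given by a family of morphisms `A n ⟶ Z.X n`. -/
abbrev discsDesc (A : ℤ → C) (Z : CochainComplex C ℤ) (φ : ∀ n, A n ⟶ Z.X n) : discs A ⟶ Z where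
  f n := biprod.desc (φ n) (φ (n - 1) ≫ Z.d (n - 1) n)
  comm' i j hij := by
    have hij' : i + 1 = j := hij
    obtain rfl : i = j - 1 := by omega
    rw [discs_d A _ _ hij']
    apply biprod.hom_ext' <;> simp

/-- The morphism into `discs A` given by a family of morphisms `Z.X (n + 1) ⟶ A n`. -/
abbrev discsLift (A : ℤ → C) (Z : CochainComplex C ℤ) (ψ : ∀ n, Z.X (n + 1) ⟶ A n) :
    Z ⟶ discs A where
  f n := biprod.lift (Z.d n (n + 1) ≫ ψ n)
    ((Z.XIsoOfEq (show n = n - 1 + 1 by omega)).hom ≫ ψ (n - 1))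
  comm' i j hij := by
    have hij' : i + 1 = j := hij
    obtain rfl : i = j - 1 := by omega
    rw [discs_d A _ _ hij']
    apply biprod.hom_ext <;> simp

lemma discs_hom_ext_to {A : ℤ → C} {Z : CochainComplex C ℤ} {f g : Z ⟶ discs A}
    (h : ∀ n, f.f n ≫ (biprod.snd : A n ⊞ A (n - 1) ⟶ _) = g.f n ≫ biprod.snd) : f = g := by
  ext n
  · have e : ∀ k : Z ⟶ discs A, k.f n ≫ (biprod.fst : A n ⊞ A (n - 1) ⟶ _) =
        Z.d n (n + 1) ≫ (k.f (n + 1) ≫ (biprod.snd : A (n + 1) ⊞ A (n + 1 - 1) ⟶ _)) ≫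
          eqToHom (congrArg A (show n + 1 - 1 = n by omega)) := by
      intro k
      have := k.comm n (n + 1)
      rw [← Category.assoc, ← Category.assoc, ← this, discs_d A n (n + 1) rfl]
      simp
    rw [e f, e g, h]
  · exact h n

lemma discs_hom_ext_from {A : ℤ → C} {Z : CochainComplex C ℤ} {f g : discs A ⟶ Z}
    (h : ∀ n, (biprod.inl : _ ⟶ A n ⊞ A (n - 1)) ≫ f.f n = biprod.inl ≫ g.f n) : f = g := by
  ext n
  · exact h n
  · have e : ∀ k : discs A ⟶ Z, (biprod.inr : _ ⟶ A n ⊞ A (n - 1)) ≫ k.f n =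
        ((biprod.inl : _ ⟶ A (n - 1) ⊞ A (n - 1 - 1)) ≫ k.f (n - 1)) ≫ Z.d (n - 1) n := by
      intro k
      have := k.comm (n - 1) n
      rw [Category.assoc, this, discs_d A (n - 1) n (by omega)]
      simp
    rw [e f, e g, h]

instance discs_projective (A : ℤ → C) [∀ n, Projective (A n)] : Projective (discs A) where
  factors {E X} f e _ := by
    refine ⟨discsDesc A E fun n => Projective.factorThru
      ((biprod.inl : _ ⟶ A n ⊞ A (n - 1)) ≫ f.f n) (e.f n), ?_⟩
    apply discs_hom_ext_from
    intro n
    simp [discsDesc]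

instance discs_injective (A : ℤ → C) [∀ n, Injective (A n)] : Injective (discs A) where
  factors {X Y} g j _ := by
    refine ⟨discsLift A Y fun n => Injective.factorThru
      (g.f (n + 1) ≫ (biprod.snd : A (n + 1) ⊞ A (n + 1 - 1) ⟶ _) ≫
        eqToHom (congrArg A (show n + 1 - 1 = n by omega))) (j.f (n + 1)), ?_⟩
    apply discs_hom_ext_to
    intro n
    have key : ∀ m (hm : n = m + 1), j.f n ≫ (Y.XIsoOfEq hm).hom ≫
        Injective.factorThru (g.f (m + 1) ≫ (biprod.snd : A (m + 1) ⊞ A (m + 1 - 1) ⟶ _) ≫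
        eqToHom (congrArg A (show m + 1 - 1 = m by omega))) (j.f (m + 1)) =
        g.f n ≫ (biprod.snd : A n ⊞ A (n - 1) ⟶ _) ≫
          eqToHom (congrArg A (show n - 1 = m by omega)) := by
      rintro m rfl
      simp
    simpa [discsLift] using key (n - 1) (by omega)

/-- `discs A` is contractible. -/
def discsContraction (A : ℤ → C) : Homotopy (𝟙 (discs A)) 0 where
  hom i j := if h : j + 1 = i then
      (biprod.snd : A i ⊞ A (i - 1) ⟶ A (i - 1)) ≫
        eqToHom (congrArg A (show i - 1 = j by omega)) ≫
          (biprod.inl : A j ⟶ A j ⊞ A (j - 1))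
    else 0
  zero i j h := dif_neg h
  comm i := by
    rw [dNext_eq _ (show (ComplexShape.up ℤ).Rel i (i + 1) from rfl),
      prevD_eq _ (show (ComplexShape.up ℤ).Rel (i - 1) i from by simp),
      dif_pos rfl, dif_pos (by omega), discs_d A _ _ rfl, discs_d A (i - 1) i (by omega)]
    simp only [HomologicalComplex.id_f, HomologicalComplex.zero_f, add_zero]
    apply biprod.hom_ext' <;> simp

/-- The epimorphism `P_X ⟶ X` from a contractible complex of projectives, where
`P_X` has terms `P_{X^n} ⊞ P_{X^{n-1}}`. -/
def projCover [EnoughProjectives C] (X : CochainComplex C ℤ) :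
    discs (fun n => Projective.over (X.X n)) ⟶ X :=
  discsDesc _ X fun n => Projective.π (X.X n)

instance [EnoughProjectives C] (X : CochainComplex C ℤ) (n : ℤ) : Epi ((projCover X).f n) := by
  have h : (biprod.inl : _ ⟶ Projective.over (X.X n) ⊞ Projective.over (X.X (n - 1))) ≫
      (projCover X).f n = Projective.π (X.X n) := by simp [projCover]
  exact epi_of_epi_fac h

instance [EnoughProjectives C] (X : CochainComplex C ℤ) : Epi (projCover X) :=
  HomologicalComplex.epi_of_epi_f _ inferInstance

/-- The monomorphism `X ⟶ I_X` into a contractible complex of injectives, where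
`I_X` has terms `I_{X^{n+1}} ⊞ I_{X^n}`. -/
def injHull [EnoughInjectives C] (X : CochainComplex C ℤ) :
    X ⟶ discs (fun n => Injective.under (X.X (n + 1))) :=
  discsLift _ X fun n => Injective.ι (X.X (n + 1))

instance [EnoughInjectives C] (X : CochainComplex C ℤ) (n : ℤ) : Mono ((injHull X).f n) := by
  have h : (injHull X).f n ≫ (biprod.snd :
      Injective.under (X.X (n + 1)) ⊞ Injective.under (X.X (n - 1 + 1)) ⟶ _) =
        (X.XIsoOfEq (show n = n - 1 + 1 by omega)).hom ≫ Injective.ι _ := by simp [injHull]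
  have : Mono ((X.XIsoOfEq (show n = n - 1 + 1 by omega)).hom ≫
    Injective.ι (X.X (n - 1 + 1))) := mono_comp _ _
  exact mono_of_mono_fac h

instance [EnoughInjectives C] (X : CochainComplex C ℤ) : Mono (injHull X) :=
  HomologicalComplex.mono_of_mono_f _ inferInstance

lemma nullHomotopicMap_null {X Y : CochainComplex C ℤ} (h : ∀ i j, X.X i ⟶ Y.X j) :
    Nonempty (Homotopy (Homotopy.nullHomotopicMap h) 0) :=
  ⟨{ hom := fun i j => if j + 1 = i then h i j else 0
     zero := fun i j hij => if_neg hij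
     comm := fun i => by
      have r1 : (ComplexShape.up ℤ).Rel i (i + 1) := rfl
      have r2 : (ComplexShape.up ℤ).Rel (i - 1) i := by simp
      simp only [Homotopy.nullHomotopicMap, HomologicalComplex.zero_f, add_zero]
      rw [dNext_eq _ r1, prevD_eq _ r2, dNext_eq _ r1, prevD_eq _ r2, if_pos rfl,
        if_pos (by omega)] }⟩

section Syzygy

variable [EnoughProjectives C]

/-- The syzygy `Ω X`, the kernel of `P_X ⟶ X`. -/
abbrev syz (X : CochainComplex C ℤ) : CochainComplex C ℤ := kernel (projCover X)

/-- A lift `P_X ⟶ P_Y` of a chain map `X ⟶ Y`. -/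
def projCoverMap {X Y : CochainComplex C ℤ} (f : X ⟶ Y) :
    discs (fun n => Projective.over (X.X n)) ⟶ discs (fun n => Projective.over (Y.X n)) :=
  Projective.factorThru (projCover X ≫ f) (projCover Y)

/-- The map `Ω X ⟶ Ω Y` induced by a lift `P_X ⟶ P_Y` of a chain map `X ⟶ Y`. -/
def syzMap {X Y : CochainComplex C ℤ} (f : X ⟶ Y) : syz X ⟶ syz Y :=
  kernel.map (projCover X) (projCover Y) (projCoverMap f) f (Projective.factorThru_comp _ _).symm

lemma syzMap_ι {X Y : CochainComplex C ℤ} (f : X ⟶ Y) :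
    syzMap f ≫ kernel.ι (projCover Y) = kernel.ι (projCover X) ≫ projCoverMap f :=
  kernel.lift_ι _ _ _

lemma projCoverMap_comp {X Y : CochainComplex C ℤ} (f : X ⟶ Y) :
    projCoverMap f ≫ projCover Y = projCover X ≫ f :=
  Projective.factorThru_comp _ _

lemma syz_lift {Y : CochainComplex C ℤ} {n : ℤ} {T : C}
    (k : T ⟶ (discs (fun n => Projective.over (Y.X n))).X n)
    (hk : k ≫ (projCover Y).f n = 0) :
    ∃ l : T ⟶ (syz Y).X n, l ≫ (kernel.ι (projCover Y)).f n = k := by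
  let S : ShortComplex (CochainComplex C ℤ) :=
    ShortComplex.mk (kernel.ι (projCover Y)) (projCover Y) (kernel.condition _)
  have hS : S.Exact := ShortComplex.exact_of_f_is_kernel _ (kernelIsKernel _)
  have hS' := hS.map (HomologicalComplex.eval C (ComplexShape.up ℤ) n)
  have : Mono (S.map (HomologicalComplex.eval C (ComplexShape.up ℤ) n)).f :=
    inferInstanceAs (Mono ((HomologicalComplex.eval C (ComplexShape.up ℤ) n).map
      (kernel.ι (projCover Y))))
  exact hS'.lift' k hk

/-- Up to homotopy, the map induced on syzygies depends only on the homotopy class of the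
chain map and not on the chosen lift. -/
lemma syz_null {X Y : CochainComplex C ℤ} (f : X ⟶ Y) (hf : Homotopy f 0)
    (Φ : discs (fun n => Projective.over (X.X n)) ⟶ discs (fun n => Projective.over (Y.X n)))
    (hΦ : Φ ≫ projCover Y = projCover X ≫ f) (φ : syz X ⟶ syz Y)
    (hφ : φ ≫ kernel.ι (projCover Y) = kernel.ι (projCover X) ≫ Φ) :
    Nonempty (Homotopy φ 0) := by
  have hpr : ∀ i, Projective ((discs (fun n => Projective.over (X.X n))).X i) := fun i =>
    inferInstanceAs (Projective (Projective.over (X.X i) ⊞ Projective.over (X.X (i - 1))))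
  let H : ∀ i j, (discs (fun n => Projective.over (X.X n))).X i ⟶
      (discs (fun n => Projective.over (Y.X n))).X j := fun i j =>
    Projective.factorThru ((projCover X).f i ≫ hf.hom i j) ((projCover Y).f j)
  have hH : ∀ i j, H i j ≫ (projCover Y).f j = (projCover X).f i ≫ hf.hom i j := fun i j =>
    Projective.factorThru_comp _ _
  choose h hh using fun i j => syz_lift (Y := Y) ((kernel.ι (projCover X)).f i ≫ H i j) (by
    rw [Category.assoc, hH, ← Category.assoc, ← HomologicalComplex.comp_f, kernel.condition]
    simp)
  have hf' : Homotopy.nullHomotopicMap hf.hom = f := by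
    ext n
    have := hf.comm n
    simp only [HomologicalComplex.zero_f, add_zero] at this
    exact this.symm
  have h1 : (Φ - Homotopy.nullHomotopicMap H) ≫ projCover Y = 0 := by
    rw [Preadditive.sub_comp, hΦ, Homotopy.nullHomotopicMap_comp]
    simp only [hH]
    rw [← Homotopy.comp_nullHomotopicMap, hf', sub_self]
  let e := kernel.lift (projCover Y) _ h1
  have he : e ≫ kernel.ι (projCover Y) = Φ - Homotopy.nullHomotopicMap H := kernel.lift_ι _ _ _
  have hφ' : φ = kernel.ι (projCover X) ≫ e + Homotopy.nullHomotopicMap h := by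
    rw [← cancel_mono (kernel.ι (projCover Y)), hφ, Preadditive.add_comp, Category.assoc, he,
      Homotopy.nullHomotopicMap_comp]
    simp only [hh]
    rw [← Homotopy.comp_nullHomotopicMap, Preadditive.comp_sub, sub_add_cancel]
  obtain ⟨k⟩ := nullHomotopicMap_null h
  have k' : Homotopy (kernel.ι (projCover X) ≫ e) 0 :=
    (Homotopy.ofEq (by simp)).trans ((((discsContraction _).compRight e).compLeft
      (kernel.ι (projCover X))).trans (Homotopy.ofEq (by simp)))
  exact ⟨(Homotopy.ofEq hφ').trans ((k'.add k).trans (Homotopy.ofEq (add_zero 0)))⟩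

/-- The syzygy functor on the homotopy category. -/
def Syz : HomotopyCategory C (ComplexShape.up ℤ) ⥤ HomotopyCategory C (ComplexShape.up ℤ) :=
  CategoryTheory.Quotient.lift _
    { obj := fun X => (HomotopyCategory.quotient C (ComplexShape.up ℤ)).obj (syz X)
      map := fun f => (HomotopyCategory.quotient C (ComplexShape.up ℤ)).map (syzMap f)
      map_id := fun X => by
        rw [← (HomotopyCategory.quotient C (ComplexShape.up ℤ)).map_id]
        obtain ⟨k⟩ := syz_null (0 : X ⟶ X) (Homotopy.refl 0) (projCoverMap (𝟙 X) - 𝟙 _)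
          (by simp [projCoverMap_comp]) (syzMap (𝟙 X) - 𝟙 _)
          (by simp only [Preadditive.sub_comp, Preadditive.comp_sub, syzMap_ι, Category.id_comp,
            Category.comp_id])
        exact HomotopyCategory.eq_of_homotopy _ _ (Homotopy.equivSubZero.symm k)
      map_comp := fun {X Y Z} f g => by
        rw [← (HomotopyCategory.quotient C (ComplexShape.up ℤ)).map_comp]
        obtain ⟨k⟩ := syz_null (0 : X ⟶ Z) (Homotopy.refl 0)
          (projCoverMap (f ≫ g) - projCoverMap f ≫ projCoverMap g)
          (by
            rw [Preadditive.sub_comp, projCoverMap_comp, Category.assoc, projCoverMap_comp,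
              ← Category.assoc (projCoverMap f), projCoverMap_comp]
            simp)
          (syzMap (f ≫ g) - syzMap f ≫ syzMap g)
          (by
            rw [Preadditive.sub_comp, syzMap_ι, Category.assoc, syzMap_ι, ← Category.assoc,
              syzMap_ι, Category.assoc, Preadditive.comp_sub])
        exact HomotopyCategory.eq_of_homotopy _ _ (Homotopy.equivSubZero.symm k) }
    (by
      rintro X Y f g ⟨h⟩
      obtain ⟨k⟩ := syz_null (f - g) (Homotopy.equivSubZero h)
        (projCoverMap f - projCoverMap g)
        (by rw [Preadditive.sub_comp, projCoverMap_comp, projCoverMap_comp, Preadditive.comp_sub])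
        (syzMap f - syzMap g)
        (by rw [Preadditive.sub_comp, syzMap_ι, syzMap_ι, Preadditive.comp_sub])
      exact HomotopyCategory.eq_of_homotopy _ _ (Homotopy.equivSubZero.symm k))

end Syzygy

section Cosyzygy

variable [EnoughInjectives C]

/-- The cosyzygy `℧ X`, the cokernel of `X ⟶ I_X`. -/
abbrev cosyz (X : CochainComplex C ℤ) : CochainComplex C ℤ := cokernel (injHull X)

/-- An extension `I_X ⟶ I_Y` of a chain map `X ⟶ Y`. -/
def injHullMap {X Y : CochainComplex C ℤ} (f : X ⟶ Y) :
    discs (fun n => Injective.under (X.X (n + 1))) ⟶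
      discs (fun n => Injective.under (Y.X (n + 1))) :=
  Injective.factorThru (f ≫ injHull Y) (injHull X)

lemma comp_injHullMap {X Y : CochainComplex C ℤ} (f : X ⟶ Y) :
    injHull X ≫ injHullMap f = f ≫ injHull Y :=
  Injective.comp_factorThru _ _

/-- The map `℧ X ⟶ ℧ Y` induced by an extension `I_X ⟶ I_Y` of a chain map `X ⟶ Y`. -/
def cosyzMap {X Y : CochainComplex C ℤ} (f : X ⟶ Y) : cosyz X ⟶ cosyz Y :=
  cokernel.map (injHull X) (injHull Y) f (injHullMap f) (comp_injHullMap f)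

lemma π_cosyzMap {X Y : CochainComplex C ℤ} (f : X ⟶ Y) :
    cokernel.π (injHull X) ≫ cosyzMap f = injHullMap f ≫ cokernel.π (injHull Y) :=
  cokernel.π_desc _ _ _

lemma cosyz_desc {X : CochainComplex C ℤ} {n : ℤ} {T : C}
    (k : (discs (fun n => Injective.under (X.X (n + 1)))).X n ⟶ T)
    (hk : (injHull X).f n ≫ k = 0) :
    ∃ l : (cosyz X).X n ⟶ T, (cokernel.π (injHull X)).f n ≫ l = k := by
  let S : ShortComplex (CochainComplex C ℤ) :=
    ShortComplex.mk (injHull X) (cokernel.π (injHull X)) (cokernel.condition _)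
  have hS : S.Exact := ShortComplex.exact_of_g_is_cokernel _ (cokernelIsCokernel _)
  have hS' := hS.map (HomologicalComplex.eval C (ComplexShape.up ℤ) n)
  have : Epi (S.map (HomologicalComplex.eval C (ComplexShape.up ℤ) n)).g :=
    inferInstanceAs (Epi ((HomologicalComplex.eval C (ComplexShape.up ℤ) n).map
      (cokernel.π (injHull X))))
  exact hS'.desc' k hk

/-- Up to homotopy, the map induced on cosyzygies depends only on the homotopy class of the
chain map and not on the chosen extension. -/
lemma cosyz_null {X Y : CochainComplex C ℤ} (f : X ⟶ Y) (hf : Homotopy f 0)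
    (Φ : discs (fun n => Injective.under (X.X (n + 1))) ⟶
      discs (fun n => Injective.under (Y.X (n + 1))))
    (hΦ : injHull X ≫ Φ = f ≫ injHull Y) (φ : cosyz X ⟶ cosyz Y)
    (hφ : cokernel.π (injHull X) ≫ φ = Φ ≫ cokernel.π (injHull Y)) :
    Nonempty (Homotopy φ 0) := by
  have hinj : ∀ i, Injective ((discs (fun n => Injective.under (Y.X (n + 1)))).X i) := fun i =>
    inferInstanceAs (Injective
      (Injective.under (Y.X (i + 1)) ⊞ Injective.under (Y.X (i - 1 + 1))))
  let H : ∀ i j, (discs (fun n => Injective.under (X.X (n + 1)))).X i ⟶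
      (discs (fun n => Injective.under (Y.X (n + 1)))).X j := fun i j =>
    Injective.factorThru (hf.hom i j ≫ (injHull Y).f j) ((injHull X).f i)
  have hH : ∀ i j, (injHull X).f i ≫ H i j = hf.hom i j ≫ (injHull Y).f j := fun i j =>
    Injective.comp_factorThru _ _
  choose h hh using fun i j => cosyz_desc (X := X) (H i j ≫ (cokernel.π (injHull Y)).f j) (by
    rw [← Category.assoc, hH, Category.assoc, ← HomologicalComplex.comp_f, cokernel.condition]
    simp)
  have hf' : Homotopy.nullHomotopicMap hf.hom = f := by
    ext n
    have := hf.comm n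
    simp only [HomologicalComplex.zero_f, add_zero] at this
    exact this.symm
  have h1 : injHull X ≫ (Φ - Homotopy.nullHomotopicMap H) = 0 := by
    rw [Preadditive.comp_sub, hΦ, Homotopy.comp_nullHomotopicMap]
    simp only [hH]
    rw [← Homotopy.nullHomotopicMap_comp, hf', sub_self]
  let e := cokernel.desc (injHull X) _ h1
  have he : cokernel.π (injHull X) ≫ e = Φ - Homotopy.nullHomotopicMap H :=
    cokernel.π_desc _ _ _
  have hφ' : φ = e ≫ cokernel.π (injHull Y) + Homotopy.nullHomotopicMap h := by
    rw [← cancel_epi (cokernel.π (injHull X)), hφ, Preadditive.comp_add, ← Category.assoc, he,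
      Homotopy.comp_nullHomotopicMap]
    simp only [hh]
    rw [← Homotopy.nullHomotopicMap_comp, Preadditive.sub_comp, sub_add_cancel]
  obtain ⟨k⟩ := nullHomotopicMap_null h
  have k' : Homotopy (e ≫ cokernel.π (injHull Y)) 0 :=
    (Homotopy.ofEq (by simp)).trans ((((discsContraction _).compLeft e).compRight
      (cokernel.π (injHull Y))).trans (Homotopy.ofEq (by simp)))
  exact ⟨(Homotopy.ofEq hφ').trans ((k'.add k).trans (Homotopy.ofEq (add_zero 0)))⟩

/-- The cosyzygy functor on the homotopy category. -/
def Cosyz : HomotopyCategory C (ComplexShape.up ℤ) ⥤ HomotopyCategory C (ComplexShape.up ℤ) :=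
  CategoryTheory.Quotient.lift _
    { obj := fun X => (HomotopyCategory.quotient C (ComplexShape.up ℤ)).obj (cosyz X)
      map := fun f => (HomotopyCategory.quotient C (ComplexShape.up ℤ)).map (cosyzMap f)
      map_id := fun X => by
        rw [← (HomotopyCategory.quotient C (ComplexShape.up ℤ)).map_id]
        obtain ⟨k⟩ := cosyz_null (0 : X ⟶ X) (Homotopy.refl 0) (injHullMap (𝟙 X) - 𝟙 _)
          (by simp [comp_injHullMap]) (cosyzMap (𝟙 X) - 𝟙 _)
          (by simp only [Preadditive.sub_comp, Preadditive.comp_sub, π_cosyzMap, Category.id_comp,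
            Category.comp_id])
        exact HomotopyCategory.eq_of_homotopy _ _ (Homotopy.equivSubZero.symm k)
      map_comp := fun {X Y Z} f g => by
        rw [← (HomotopyCategory.quotient C (ComplexShape.up ℤ)).map_comp]
        obtain ⟨k⟩ := cosyz_null (0 : X ⟶ Z) (Homotopy.refl 0)
          (injHullMap (f ≫ g) - injHullMap f ≫ injHullMap g)
          (by
            rw [Preadditive.comp_sub, comp_injHullMap, ← Category.assoc, comp_injHullMap,
              Category.assoc f (injHull Y), comp_injHullMap]
            simp)
          (cosyzMap (f ≫ g) - cosyzMap f ≫ cosyzMap g)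
          (by
            rw [Preadditive.comp_sub, π_cosyzMap, ← Category.assoc, π_cosyzMap, Category.assoc,
              π_cosyzMap, ← Category.assoc, Preadditive.sub_comp])
        exact HomotopyCategory.eq_of_homotopy _ _ (Homotopy.equivSubZero.symm k) }
    (by
      rintro X Y f g ⟨h⟩
      obtain ⟨k⟩ := cosyz_null (f - g) (Homotopy.equivSubZero h)
        (injHullMap f - injHullMap g)
        (by rw [Preadditive.comp_sub, comp_injHullMap, comp_injHullMap, Preadditive.sub_comp])
        (cosyzMap f - cosyzMap g)
        (by rw [Preadditive.comp_sub, π_cosyzMap, π_cosyzMap, Preadditive.sub_comp])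
      exact HomotopyCategory.eq_of_homotopy _ _ (Homotopy.equivSubZero.symm k))

end Cosyzygy

/-- The `d`-fold iterate of an endofunctor. -/
def iter {D : Type*} [Category* D] (F : D ⥤ D) : ℕ → (D ⥤ D)
  | 0 => 𝟭 D
  | d + 1 => iter F d ⋙ F

/-- `Ω̃ = Ω ∘ [1]`. -/
def SyzShift [EnoughProjectives C] :
    HomotopyCategory C (ComplexShape.up ℤ) ⥤ HomotopyCategory C (ComplexShape.up ℤ) :=
  shiftFunctor _ (1 : ℤ) ⋙ Syz

/-- `℧̃ = ℧ ∘ [-1]`. -/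
def CosyzShift [EnoughInjectives C] :
    HomotopyCategory C (ComplexShape.up ℤ) ⥤ HomotopyCategory C (ComplexShape.up ℤ) :=
  shiftFunctor _ (-1 : ℤ) ⋙ Cosyz

variable (C) in
/-- Complexes all of whose terms are injective. -/
def injTerms : ObjectProperty (HomotopyCategory C (ComplexShape.up ℤ)) :=
  fun X => ∀ n, Injective (X.as.X n)

variable (C) in
/-- Complexes all of whose terms are projective. -/
def projTerms : ObjectProperty (HomotopyCategory C (ComplexShape.up ℤ)) :=
  fun X => ∀ n, Projective (X.as.X n)

end Complexes

section Rings

/-- The category of right modules over `R`, i.e. of modules over `Rᵐᵒᵖ`. -/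
abbrev ModR (R : Type u) [Ring R] := ModuleCat.{u} Rᵐᵒᵖ

/-- `K(Mod R)`. -/
abbrev KMod (R : Type u) [Ring R] := HomotopyCategory (ModR R) (ComplexShape.up ℤ)

/-- `K(Inj R)`, a full subcategory of `K(Mod R)`. -/
abbrev KInj (R : Type u) [Ring R] := (injTerms (ModR R)).FullSubcategory

/-- `K(Proj R)`, a full subcategory of `K(Mod R)`. -/
abbrev KProj (R : Type u) [Ring R] := (projTerms (ModR R)).FullSubcategory

/-- The inclusion of `K(Inj R)` into `K(Mod R)`. -/
abbrev inclInj (R : Type u) [Ring R] : KInj R ⥤ KMod R := (injTerms (ModR R)).ι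

/-- The inclusion of `K(Proj R)` into `K(Mod R)`. -/
abbrev inclProj (R : Type u) [Ring R] : KProj R ⥤ KMod R := (projTerms (ModR R)).ι

variable {Λ Γ : Type u} [Ring Λ] [Ring Γ] (f : Λ →+* Γ)

/-- Restriction of right modules along `f`. -/
abbrev res : ModR Γ ⥤ ModR Λ := ModuleCat.restrictScalars f.op

/-- `Hom_Λ(Γ, -)`, where `g` acts on `φ : Γ → M` by `(φ g) x = φ (g x)`. -/
abbrev homG : ModR Λ ⥤ ModR Γ := ModuleCat.coextendScalars f.op

instance : (homG f).Additive where
  map_add := by intros; ext; rfl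

open TensorProduct

/-- The relations `m l ⊗ g = m ⊗ f(l) g`. -/
def tensorRel (M : ModR Λ) : Submodule Γᵐᵒᵖ (Γ ⊗[ℤ] M) :=
  Submodule.span Γᵐᵒᵖ
    {t | ∃ (g : Γ) (l : Λ) (m : M), t = g ⊗ₜ[ℤ] (MulOpposite.op l • m) - (f l * g) ⊗ₜ[ℤ] m}

/-- The right `Γ`-module `M ⊗_Λ Γ`, as the quotient of `Γ ⊗_ℤ M` (with factors swapped, and
with `Γ` acting from the right on the factor `Γ`) by the relations `m l ⊗ g = m ⊗ f(l) g`. -/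
abbrev tensorObj (M : ModR Λ) : ModR Γ := ModuleCat.of Γᵐᵒᵖ ((Γ ⊗[ℤ] M) ⧸ tensorRel f M)

/-- The element `m ⊗ g` of `M ⊗_Λ Γ`. -/
def tmk (M : ModR Λ) (m : M) (g : Γ) : tensorObj f M := (tensorRel f M).mkQ (g ⊗ₜ[ℤ] m)

lemma tmk_add_left (M : ModR Λ) (m m' : M) (g : Γ) :
    tmk f M (m + m') g = tmk f M m g + tmk f M m' g := by
  simp [tmk, TensorProduct.tmul_add]

lemma tmk_smul (M : ModR Λ) (m : M) (g h : Γ) :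
    MulOpposite.op h • tmk f M m g = tmk f M m (g * h) := rfl

lemma tmk_balanced (M : ModR Λ) (m : M) (l : Λ) (g : Γ) :
    tmk f M (MulOpposite.op l • m) g = tmk f M m (f l * g) := by
  rw [← sub_eq_zero]
  simp only [tmk, ← map_sub]
  rw [Submodule.mkQ_apply, Submodule.Quotient.mk_eq_zero]
  exact Submodule.subset_span ⟨g, l, m, rfl⟩

variable {f} in
lemma tensor_ext {M : ModR Λ} {N : ModR Γ} {φ ψ : tensorObj f M ⟶ N}
    (h : ∀ m g, φ (tmk f M m g) = ψ (tmk f M m g)) : φ = ψ := by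
  apply ModuleCat.hom_ext
  apply LinearMap.ext
  intro x
  obtain ⟨t, rfl⟩ := Submodule.mkQ_surjective (tensorRel f M) x
  induction t using TensorProduct.induction_on with
  | zero => simp only [map_zero]
  | tmul g m => exact h m g
  | add a b ha hb => simp only [map_add, ha, hb]

variable {f} in
/-- A morphism of `Λ`-modules `M ⟶ res N` as an additive map. -/
def toAdd {M : ModR Λ} {N : ModR Γ} (b : M ⟶ (res f).obj N) : M →+ N := b.hom.toAddMonoidHom

variable {f} in
lemma toAdd_smul {M : ModR Λ} {N : ModR Γ} (b : M ⟶ (res f).obj N) (l : Λ) (m : M) :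
    toAdd b (MulOpposite.op l • m) = MulOpposite.op (f l) • toAdd b m :=
  b.hom.map_smul (MulOpposite.op l) m

variable {f} in
/-- The morphism `M ⊗_Λ Γ ⟶ N`, `m ⊗ g ↦ b(m) g`, for an `Λ`-linear map `b : M ⟶ N`. -/
def tensorDesc {M : ModR Λ} {N : ModR Γ} (b : M ⟶ (res f).obj N) : tensorObj f M ⟶ N :=
  ModuleCat.ofHom <| (tensorRel f M).liftQ
    (TensorProduct.AlgebraTensorModule.lift
      { toFun := fun g => (((DistribSMul.toAddMonoidHom N (MulOpposite.op g)).comp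
          (toAdd b)).toIntLinearMap : M →ₗ[ℤ] N)
        map_add' := fun g h => by ext m; simp [add_smul]
        map_smul' := fun r g => by ext m; simp [mul_smul] })
    (by
      rw [tensorRel, Submodule.span_le]
      rintro _ ⟨g, l, m, rfl⟩
      simp [toAdd_smul, mul_smul])

variable {f} in
lemma tensorDesc_tmk {M : ModR Λ} {N : ModR Γ} (b : M ⟶ (res f).obj N) (m : M) (g : Γ) :
    tensorDesc b (tmk f M m g) = MulOpposite.op g • toAdd b m := rfl

/-- The `Λ`-linear map `M ⟶ res (M ⊗_Λ Γ)`, `m ↦ m ⊗ 1`. -/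
def tensorUnit (M : ModR Λ) : M ⟶ (res f).obj (tensorObj f M) :=
  ModuleCat.ofHom (Y := (res f).obj (tensorObj f M))
    { toFun := fun m => tmk f M m 1
      map_add' := fun m m' => tmk_add_left f M m m' 1
      map_smul' := fun r m => by
        have := tmk_balanced f M m r.unop 1
        rw [mul_one] at this
        refine this.trans ?_
        have h2 := tmk_smul f M m 1 (f r.unop)
        rw [one_mul] at h2
        exact h2.symm }

/-- The functor `- ⊗_Λ Γ` from right `Λ`-modules to right `Γ`-modules. -/
def tensorG : ModR Λ ⥤ ModR Γ where
  obj M := tensorObj f M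
  map {M N} φ := tensorDesc (φ ≫ tensorUnit f N)
  map_id M := tensor_ext fun m g => by
    rw [tensorDesc_tmk]
    refine (tmk_smul f M m 1 g).trans ?_
    rw [one_mul]; rfl
  map_comp {M N P} φ ψ := tensor_ext fun m g => by
    rw [tensorDesc_tmk, ModuleCat.comp_apply, tensorDesc_tmk, map_smul]
    congr 1
    exact ((tensorDesc_tmk (ψ ≫ tensorUnit f P) (φ m) 1).trans (one_smul _ _)).symm

lemma tensorG_map_tmk {M N : ModR Λ} (φ : M ⟶ N) (m : M) (g : Γ) :
    (tensorG f).map φ (tmk f M m g) = tmk f N (φ m) g := by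
  refine (tensorDesc_tmk (φ ≫ tensorUnit f N) m g).trans ?_
  refine (tmk_smul f N (φ m) 1 g).trans ?_
  rw [one_mul]

/-- The adjunction between `- ⊗_Λ Γ` and restriction. -/
def tensorAdj : tensorG f ⊣ res f :=
  Adjunction.mkOfHomEquiv
    { homEquiv := fun M N =>
        { toFun := fun φ => tensorUnit f M ≫ (res f).map φ
          invFun := fun b => tensorDesc b
          left_inv := fun φ => tensor_ext fun m g => by
            rw [tensorDesc_tmk]
            refine (map_smul φ.hom (MulOpposite.op g) (tmk f M m 1)).symm.trans ?_
            rw [tmk_smul, one_mul]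
            rfl
          right_inv := fun b => by
            ext m
            exact (tensorDesc_tmk b m 1).trans (one_smul _ _) }
      homEquiv_naturality_left_symm := fun {M' M N} φ b => tensor_ext fun m g => by
        refine (tensorDesc_tmk _ m g).trans ?_
        refine Eq.trans ?_ (congrArg (tensorDesc b) (tensorG_map_tmk f φ m g)).symm
        exact (tensorDesc_tmk b (φ m) g).symm
      homEquiv_naturality_right := fun φ ψ => by
        ext m
        rfl }

instance : (tensorG f).Additive where
  map_add {M N φ ψ} := tensor_ext fun m g => by
    refine (tensorG_map_tmk f (φ + ψ) m g).trans ?_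
    refine (tmk_add_left f N (φ m) (ψ m) g).trans ?_
    exact congrArg₂ (· + ·) (tensorG_map_tmk f φ m g).symm (tensorG_map_tmk f ψ m g).symm

lemma homG_injective (M : ModR Λ) (hM : Injective M) : Injective ((homG f).obj M) :=
  Injective.injective_of_adjoint (ModuleCat.restrictCoextendScalarsAdj f.op) M

lemma tensorG_projective (M : ModR Λ) (hM : Projective M) : Projective ((tensorG f).obj M) :=
  (tensorAdj f).map_projective M hM

/-- Restriction `K(Mod Γ) ⥤ K(Mod Λ)`. -/
abbrev resK : KMod Γ ⥤ KMod Λ := (res f).mapHomotopyCategory _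

/-- `Hom_Λ(Γ, -) : K(Mod Λ) ⥤ K(Mod Γ)`. -/
abbrev homK : KMod Λ ⥤ KMod Γ := (homG f).mapHomotopyCategory _

/-- `- ⊗_Λ Γ : K(Mod Λ) ⥤ K(Mod Γ)`. -/
abbrev tensorK : KMod Λ ⥤ KMod Γ := (tensorG f).mapHomotopyCategory _

/-- `Hom_Λ(Γ, -) : K(Inj Λ) ⥤ K(Inj Γ)`. -/
def homInj : KInj Λ ⥤ KInj Γ :=
  (injTerms (ModR Γ)).lift (inclInj Λ ⋙ homK f)
    fun X n => homG_injective f (X.obj.as.X n) (X.property n)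

/-- `- ⊗_Λ Γ : K(Proj Λ) ⥤ K(Proj Γ)`. -/
def tensorProj : KProj Λ ⥤ KProj Γ :=
  (projTerms (ModR Γ)).lift (inclProj Λ ⋙ tensorK f)
    fun X n => tensorG_projective f (X.obj.as.X n) (X.property n)

/-- `Γ` as a left `Λ`-module. -/
abbrev leftMod : ModuleCat.{u} Λ := (ModuleCat.restrictScalars f).obj (ModuleCat.of Γ Γ)

/-- `Γ` as a right `Λ`-module. -/
abbrev rightMod : ModR Λ := (res f).obj (ModuleCat.of Γᵐᵒᵖ Γ)

end Rings

end HomotopyAdj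

end

open HomotopyAdj

/-!
The proof rests on two facts: a syzygy of `X` is invisible to morphisms into complexes of injectives,
and a reflection of a complex whose terms have finite injective dimension is invisible to morphisms
out of sufficiently high syzygies.

Syzygies and cosyzygies are treated uniformly as dimension shifts: degreewise short exact sequences
`0 → A → P → B[1] → 0` with `P` contractible (`DimShift`). Each has a connecting map `A ⟶ B`, and for
the chosen covers and hulls these give natural transformations `Ω̃ ⟶ 𝟭` and `𝟭 ⟶ ℧̃`
(`syzShiftCounit`, `cosyzShiftUnit`). The connecting map is inverted by `Hom(-, E)` if `E` has
injective terms and by `Hom(Q, -)` if `Q` has projective terms (`DimShift.bijective_precomp`,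
`DimShift.bijective_postcomp`). For two dimension shifts, with projective and with injective middle
terms, composition with one connecting map is bijective iff composition with the other is
(`DimShift.bijective_postcomp_iff`).

If all terms of `Z` have injective dimension at most `d`, then the composite
`Z ⟶ ℧̃ Z ⟶ ⋯ ⟶ ℧̃ᵈ Z` is a reflection of `Z` in the complexes of injectives, and by the previous
criterion and induction on `d` it is inverted by `Hom(Ω̃ᵈ X, -)` for every `X`
(`exists_reflection_of_hasInjectiveDimensionLE`). If `pd (_ΛΓ) ≤ d`, this applies to `Z = res Y` for
`Y` in `K(Inj Γ)`: an injective `Γ`-module is a summand of the character module of a free left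
`Γ`-module, and character modules turn projective resolutions into injective ones
(`hasInjectiveDimensionLE_res`). Hence, for `X` in `K(Inj Λ)`,
`Hom(λ(Ω̃ᵈ X ⊗ Γ), Y) ≃ Hom(Ω̃ᵈ X, res Y) ≃ Hom(Ω̃ᵈ X, λ res Y) ≃ Hom(X, λ res Y)`
(`adjunctionOfReflector`). The adjunction between `λ res` and `Hom_Λ(Γ, -)` is the restriction of the
one on `K(Mod)`. The statement on projectives is dual, with
`exists_coreflection_of_hasProjectiveDimensionLE` and `hasProjectiveDimensionLE_res`.

The adjoints `λ` and `ρ` exist by the small object argument, which applies to every set of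
monomorphisms of complexes, as these form a Grothendieck abelian category. For `λ`, the discs on the
subobjects of a generator are used (`exists_injective_reflection`). For `ρ`, the generating maps are
`0 ⟶ D^n(S)` and the embeddings `Y ⟶ C(Y)` into contractible complexes, where `Y` runs through the
complexes of finitely generated free modules. They yield a surjection onto a given complex from a
complex of projectives, whose kernel receives only null-homotopic morphisms from such `Y`
(`exists_projective_cover`). The same then holds for morphisms from any complex of free modules: every
basis element lies in a subcomplex spanned by finitely many basis elements in each degree, so
partial null-homotopies can be extended one such subcomplex at a time, and Zorn's lemma concludes
(`exists_extension_null_homotopy`, `nonempty_homotopy_zero_of_basis`). Complexes of projectives are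
retracts of complexes of free modules, so the surjection is a coreflection
(`isLeftAdjoint_ι_projTerms`).
-/

/-! ### Dimension shifts -/

namespace HomotopyAdj

open CochainComplex HomComplex

section DimShift

variable {C : Type u} [Category.{v} C] [Abelian C]

/-- Two chain maps agree in the homotopy category iff their difference is a coboundary in the
`Hom` complex. -/
lemma quotient_map_eq_iff {X Y : CochainComplex C ℤ} (f g : X ⟶ Y) :
    (HomotopyCategory.quotient C (ComplexShape.up ℤ)).map f =
      (HomotopyCategory.quotient C (ComplexShape.up ℤ)).map g ↔
    ∃ h : Cochain X Y (-1), Cochain.ofHom f = δ (-1) 0 h + Cochain.ofHom g := by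
  constructor
  · intro h
    exact ⟨_, (Cochain.equivHomotopy f g (HomotopyCategory.homotopyOfEq _ _ h)).2⟩
  · rintro ⟨h, hh⟩
    exact HomotopyCategory.eq_of_homotopy _ _ ((Cochain.equivHomotopy f g).symm ⟨h, hh⟩)

lemma quotient_map_eq_zero_iff_cochain {X Y : CochainComplex C ℤ} (f : X ⟶ Y) :
    (HomotopyCategory.quotient C (ComplexShape.up ℤ)).map f = 0 ↔
    ∃ h : Cochain X Y (-1), Cochain.ofHom f = δ (-1) 0 h := by
  rw [← Functor.map_zero, quotient_map_eq_iff]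
  simp

lemma exists_ofHom_eq {X Y : CochainComplex C ℤ} (z : Cochain X Y 0) (hz : δ 0 1 z = 0) :
    ∃ f : X ⟶ Y, Cochain.ofHom f = z :=
  ⟨Cocycle.homOf (Cocycle.mk z 1 (by simp) hz), by simp⟩

/-- A dimension shift from `A` to `B`: a degreewise short exact sequence `0 → A → P → B[1] → 0`
with `P` contractible. The map onto `B[1]` is encoded as a cocycle of degree `1`, which avoids
the signs in the differential of the shifted complex, and the contraction as a cochain of
degree `-1`. The sequence need not be degreewise split, so `A` and `B` need not be homotopy
equivalent. -/
structure DimShift (A B : CochainComplex C ℤ) where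
  /-- the contractible middle term -/
  P : CochainComplex C ℤ
  /-- the inclusion of `A` -/
  ι : A ⟶ P
  /-- the projection onto `B[1]` -/
  π : Cochain P B 1
  /-- the contraction of `P` -/
  s : Cochain P P (-1)
  δ_π : δ 1 2 π = 0
  δ_s : δ (-1) 0 s = Cochain.ofHom (𝟙 P)
  mono : ∀ n, Mono (ι.f n)
  epi : ∀ p q h, Epi (π.v p q h)
  w : ∀ p q h, ι.f p ≫ π.v p q h = 0
  exact : ∀ p q h, (ShortComplex.mk (ι.f p) (π.v p q h) (w p q h)).Exact

namespace DimShift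

variable {A B : CochainComplex C ℤ} (D : DimShift A B)

lemma ι_comp_π {n : ℤ} (h : 0 + 1 = n) : (Cochain.ofHom D.ι).comp D.π h = 0 := by
  obtain rfl : n = 1 := by omega
  ext p q hpq
  simp [D.w]

lemma exists_extension {E : CochainComplex C ℤ} (hE : ∀ n, Injective (E.X n)) {n : ℤ}
    (z : Cochain A E n) :
    ∃ z' : Cochain D.P E n, (Cochain.ofHom D.ι).comp z' (zero_add n) = z := by
  have := D.mono
  refine ⟨Cochain.mk fun p q h => Injective.factorThru (z.v p q h) (D.ι.f p), ?_⟩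
  ext p q h
  simp

lemma exists_desc {E : CochainComplex C ℤ} {n m : ℤ} (hm : 1 + m = n) (z : Cochain D.P E n)
    (hz : (Cochain.ofHom D.ι).comp z (zero_add n) = 0) :
    ∃ w : Cochain B E m, D.π.comp w hm = z := by
  have := D.epi
  have key : ∀ p q r (h : p + 1 = q) (h' : q + m = r),
      ∃ w : B.X q ⟶ E.X r, D.π.v p q h ≫ w = z.v p r (by omega) := fun p q r h h' => by
    have : Epi (ShortComplex.mk (D.ι.f p) (D.π.v p q h) (D.w p q h)).g := D.epi _ _ _
    refine (D.exact p q h).desc' (z.v p r (by omega)) ?_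
    have hpr : p + n = r := by omega
    have := Cochain.congr_v hz p r hpr
    rwa [Cochain.zero_cochain_comp_v, Cochain.ofHom_v] at this
  choose w hw using key
  refine ⟨Cochain.mk fun q r h => w (q - 1) q r (by omega) h, ?_⟩
  ext p r h
  rw [Cochain.comp_v D.π _ hm p (p + 1) r rfl (by omega)]
  obtain ⟨q, rfl⟩ : ∃ q, p = q - 1 := ⟨p + 1, by omega⟩
  have : ∀ q' (h1 : q - 1 + 1 = q') (h2 : q' + m = r),
      D.π.v (q - 1) q' h1 ≫ w (q' - 1) q' r (by omega) h2 = z.v (q - 1) r h := by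
    intro q' h1 h2
    obtain rfl : q = q' := by omega
    exact hw _ _ _ _ _
  exact this _ _ _

lemma π_comp_injective {E : CochainComplex C ℤ} {n m : ℤ} (hm : 1 + m = n)
    {w w' : Cochain B E m} (h : D.π.comp w hm = D.π.comp w' hm) : w = w' := by
  ext q r hqr
  have := Cochain.congr_v h (q - 1) r (by omega)
  rw [Cochain.comp_v D.π _ hm (q - 1) q r (by omega) (by omega),
    Cochain.comp_v D.π _ hm (q - 1) q r (by omega) (by omega)] at this
  have hq : q - 1 + 1 = q := by omega
  have := D.epi (q - 1) q hq
  rwa [← cancel_epi (D.π.v (q - 1) q hq)]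

lemma exists_lift {Q : CochainComplex C ℤ} (hQ : ∀ n, Projective (Q.X n)) {n m : ℤ}
    (hm : m + 1 = n) (z : Cochain Q B n) : ∃ w : Cochain Q D.P m, w.comp D.π hm = z := by
  have := D.epi
  refine ⟨Cochain.mk fun p q h =>
    Projective.factorThru (z.v p (q + 1) (by omega)) (D.π.v q (q + 1) rfl), ?_⟩
  ext p q h
  rw [Cochain.comp_v _ D.π hm p (q - 1) q (by omega) (by omega)]
  obtain ⟨q, rfl⟩ : ∃ r, q = r + 1 := ⟨q - 1, by omega⟩
  have : ∀ r (h1 : r + 1 = q + 1) (h2 : p + m = r), (Cochain.mk fun p q h =>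
    Projective.factorThru (z.v p (q + 1) (by omega)) (D.π.v q (q + 1) rfl) :
      Cochain Q D.P m).v p r h2 ≫ D.π.v r (q + 1) h1 = z.v p (q + 1) h := by
    intro r h1 h2
    obtain rfl : q = r := by omega
    simp
  exact this _ _ _

lemma exists_lift_of_comp_π_eq_zero {Q : CochainComplex C ℤ} {n m : ℤ} (hm : n + 1 = m)
    (z : Cochain Q D.P n) (hz : z.comp D.π hm = 0) :
    ∃ w : Cochain Q A n, w.comp (Cochain.ofHom D.ι) (add_zero n) = z := by
  have key : ∀ p q (h : p + n = q), ∃ w : Q.X p ⟶ A.X q, w ≫ D.ι.f q = z.v p q h := by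
    intro p q h
    have : Mono (ShortComplex.mk (D.ι.f q) (D.π.v q (q + 1) rfl) (D.w q _ rfl)).f := D.mono _
    refine (D.exact q (q + 1) rfl).lift' (z.v p q h) ?_
    have := Cochain.congr_v hz p (q + 1) (by omega)
    rwa [Cochain.comp_v _ D.π hm p q (q + 1) h rfl] at this
  choose w hw using key
  refine ⟨Cochain.mk w, ?_⟩
  ext p q h
  simp [hw]

lemma comp_ι_injective {Q : CochainComplex C ℤ} {n : ℤ} {w w' : Cochain Q A n}
    (h : w.comp (Cochain.ofHom D.ι) (add_zero n) = w'.comp (Cochain.ofHom D.ι) (add_zero n)) :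
    w = w' := by
  ext p q hpq
  have := D.mono q
  rw [← cancel_mono (D.ι.f q)]
  simpa using Cochain.congr_v h p q hpq

lemma δ_π_comp {E : CochainComplex C ℤ} {n m n' m' : ℤ} (w : Cochain B E n) (h : 1 + n = m)
    (hn : n + 1 = n') (hm : m + 1 = m') :
    δ m m' (D.π.comp w h) = D.π.comp (δ n n' w) (by omega) := by
  rw [δ_comp _ _ h 2 n' m' hm (by omega) hn, D.δ_π]
  simp

lemma δ_comp_π {Q : CochainComplex C ℤ} {n m n' m' : ℤ} (w : Cochain Q D.P n) (h : n + 1 = m)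
    (hn : n + 1 = n') (hm : m + 1 = m') :
    δ m m' (w.comp D.π h) = -(δ n n' w).comp D.π (by omega) := by
  rw [δ_comp _ _ h n' 2 m' hm hn (by omega), D.δ_π]
  simp

lemma δ_s_comp {E : CochainComplex C ℤ} {n m m' : ℤ} (w : Cochain D.P E n) (h : -1 + n = m)
    (hm : n + 1 = m') :
    δ m n (D.s.comp w h) = D.s.comp (δ n m' w) (by omega) + n.negOnePow • w := by
  rw [δ_comp _ _ h 0 m' n (by omega) (by omega) hm, D.δ_s]
  simp

lemma δ_comp_s {Q : CochainComplex C ℤ} {n m m' : ℤ} (w : Cochain Q D.P n) (h : n + (-1) = m)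
    (hm : n + 1 = m') :
    δ m n (w.comp D.s h) = w - (δ n m' w).comp D.s (by omega) := by
  rw [δ_comp _ _ h m' 0 n (by omega) hm (by omega), D.δ_s]
  simp [sub_eq_add_neg]

lemma δ_s_comp_π : δ 0 1 (D.s.comp D.π (neg_add_cancel 1)) = -D.π := by
  rw [D.δ_s_comp _ _ (show (1 : ℤ) + 1 = 2 by norm_num), D.δ_π]
  simp

lemma δ_ι_comp_s_comp_π : δ 0 1 ((Cochain.ofHom D.ι).comp
    (D.s.comp D.π (neg_add_cancel 1)) (zero_add 0)) = 0 := by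
  rw [δ_ofHom_comp, D.δ_s_comp_π]
  simp [D.ι_comp_π]

/-- The connecting chain map `A ⟶ B` of a dimension shift, that is, the composite of the
inclusion into `P`, the contraction and the projection. -/
noncomputable def e : A ⟶ B :=
  Cocycle.homOf (Cocycle.mk _ 1 (by simp) D.δ_ι_comp_s_comp_π)

lemma ofHom_e : Cochain.ofHom D.e =
    (Cochain.ofHom D.ι).comp (D.s.comp D.π (neg_add_cancel 1)) (zero_add 0) := by
  simp [e]

lemma ofHom_e_comp {E : CochainComplex C ℤ} {n m : ℤ} (θ : Cochain B E n) (h : 1 + n = m) :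
    (Cochain.ofHom D.e).comp θ (zero_add n) =
      (Cochain.ofHom D.ι).comp (D.s.comp (D.π.comp θ h) (by omega)) (zero_add n) := by
  rw [ofHom_e, Cochain.comp_assoc_of_first_is_zero_cochain,
    Cochain.comp_assoc _ _ _ (neg_add_cancel 1) h (by omega)]

lemma comp_ofHom_e {Q : CochainComplex C ℤ} {n m : ℤ} (φ : Cochain Q A n) (h : n + (-1) = m) :
    φ.comp (Cochain.ofHom D.e) (add_zero n) =
      ((φ.comp (Cochain.ofHom D.ι) (add_zero n)).comp D.s h).comp D.π (by omega) := by
  rw [ofHom_e, ← Cochain.comp_assoc_of_second_is_zero_cochain,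
    Cochain.comp_assoc _ _ _ h (neg_add_cancel 1) (by omega)]

local notation "quot" => HomotopyCategory.quotient C (ComplexShape.up ℤ)

/-- Morphisms into a complex with injective terms do not distinguish `A` from `B`: a chain map on
`A` extends to a cochain on `P`, whose differential vanishes on `A` and so descends to `B`. -/
lemma bijective_precomp {E : CochainComplex C ℤ} (hE : ∀ n, Injective (E.X n)) :
    Function.Bijective fun θ : (quot).obj B ⟶ (quot).obj E => (quot).map D.e ≫ θ := by
  constructor
  · have inj : ∀ θ : (quot).obj B ⟶ (quot).obj E, (quot).map D.e ≫ θ = 0 → θ = 0 := by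
      intro θ hθ
      obtain ⟨θ, rfl⟩ := (quot).map_surjective θ
      rw [← Functor.map_comp, quotient_map_eq_zero_iff_cochain] at hθ
      obtain ⟨h, hh⟩ := hθ
      rw [quotient_map_eq_zero_iff_cochain]
      obtain ⟨H, rfl⟩ := D.exists_extension hE h
      rw [δ_ofHom_comp, Cochain.ofHom_comp, D.ofHom_e_comp _ (add_zero 1)] at hh
      obtain ⟨χ, hχ⟩ := D.exists_desc (show 1 + (-1) = (0 : ℤ) by norm_num)
        (D.s.comp (D.π.comp (Cochain.ofHom θ) (add_zero 1)) (neg_add_cancel 1) - δ (-1) 0 H)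
        (by rw [Cochain.comp_sub, hh, sub_self])
      refine ⟨-χ, ?_⟩
      apply D.π_comp_injective (add_zero 1)
      have := congrArg (δ 0 1) hχ
      rw [D.δ_π_comp _ _ (neg_add_cancel 1) (zero_add 1), δ_sub, δ_δ, sub_zero,
        D.δ_s_comp _ _ (show (1 : ℤ) + 1 = 2 by norm_num),
        D.δ_π_comp _ _ (zero_add 1) (by norm_num)] at this
      simp at this
      simp [this]
    intro θ θ' h
    rw [← sub_eq_zero]
    exact inj _ (by rw [Preadditive.comp_sub, sub_eq_zero]; exact h)
  · intro φ
    obtain ⟨φ, rfl⟩ := (quot).map_surjective φ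
    obtain ⟨ψ, hψ⟩ := D.exists_extension hE (Cochain.ofHom φ)
    obtain ⟨θ, hθ⟩ := D.exists_desc (add_zero 1) (δ 0 1 ψ)
      (by rw [← δ_ofHom_comp, hψ]; simp)
    have hθ' : δ 0 1 θ = 0 := by
      apply D.π_comp_injective (show 1 + 1 = (2 : ℤ) by norm_num)
      rw [← D.δ_π_comp θ (add_zero 1) (zero_add 1) (by norm_num), hθ, δ_δ]
      simp
    obtain ⟨θ, rfl⟩ := exists_ofHom_eq _ hθ'
    refine ⟨-(quot).map θ, ?_⟩
    dsimp only
    rw [← Functor.map_neg, ← Functor.map_comp, quotient_map_eq_iff]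
    refine ⟨-(Cochain.ofHom D.ι).comp (D.s.comp ψ (add_zero _)) (zero_add _), ?_⟩
    rw [Cochain.ofHom_comp, D.ofHom_e_comp _ (add_zero 1), δ_neg, δ_ofHom_comp,
      D.δ_s_comp _ _ (zero_add 1), ← hθ, ← hψ]
    simp

/-- Morphisms out of a complex with projective terms do not distinguish `A` from `B`: a chain map
to `B` lifts to a cochain of degree `-1` with values in `P`, whose differential lands in `A`. -/
lemma bijective_postcomp {Q : CochainComplex C ℤ} (hQ : ∀ n, Projective (Q.X n)) :
    Function.Bijective fun φ : (quot).obj Q ⟶ (quot).obj A => φ ≫ (quot).map D.e := by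
  constructor
  · have inj : ∀ φ : (quot).obj Q ⟶ (quot).obj A, φ ≫ (quot).map D.e = 0 → φ = 0 := by
      intro φ hφ
      obtain ⟨φ, rfl⟩ := (quot).map_surjective φ
      rw [← Functor.map_comp, quotient_map_eq_zero_iff_cochain] at hφ
      obtain ⟨h, hh⟩ := hφ
      rw [quotient_map_eq_zero_iff_cochain]
      obtain ⟨H, rfl⟩ := D.exists_lift hQ (show -2 + 1 = (-1 : ℤ) by norm_num) h
      rw [D.δ_comp_π H _ (show -2 + 1 = (-1 : ℤ) by norm_num) (by norm_num), Cochain.ofHom_comp,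
        D.comp_ofHom_e _ (zero_add (-1))] at hh
      obtain ⟨χ, hχ⟩ := D.exists_lift_of_comp_π_eq_zero (neg_add_cancel 1)
        (((Cochain.ofHom φ).comp (Cochain.ofHom D.ι) (add_zero 0)).comp D.s (zero_add (-1))
          + δ (-2) (-1) H)
        (by rw [Cochain.add_comp, hh]; simp)
      refine ⟨χ, ?_⟩
      apply D.comp_ι_injective
      rw [← δ_comp_ofHom, hχ, δ_add, δ_δ, D.δ_comp_s _ _ (zero_add 1)]
      simp [← Cochain.ofHom_comp]
    intro θ θ' h
    rw [← sub_eq_zero]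
    exact inj _ (by rw [Preadditive.sub_comp, sub_eq_zero]; exact h)
  · intro θ
    obtain ⟨θ, rfl⟩ := (quot).map_surjective θ
    obtain ⟨ψ, hψ⟩ := D.exists_lift hQ (neg_add_cancel 1) (Cochain.ofHom θ)
    have h1 : (δ (-1) 0 ψ).comp D.π (zero_add 1) = 0 := by
      have := D.δ_comp_π ψ (neg_add_cancel 1) (neg_add_cancel 1) (zero_add 1)
      rw [hψ] at this
      simpa using this.symm
    obtain ⟨φ, hφ⟩ := D.exists_lift_of_comp_π_eq_zero (zero_add 1) (δ (-1) 0 ψ) h1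
    have hφ' : δ 0 1 φ = 0 := by
      apply D.comp_ι_injective
      rw [← δ_comp_ofHom, hφ, δ_δ]
      simp
    obtain ⟨φ, rfl⟩ := exists_ofHom_eq _ hφ'
    refine ⟨(quot).map φ, ?_⟩
    dsimp only
    rw [← Functor.map_comp, quotient_map_eq_iff]
    refine ⟨ψ.comp (D.s.comp D.π (neg_add_cancel 1)) (add_zero _), ?_⟩
    rw [Cochain.ofHom_comp, D.ofHom_e, δ_comp_zero_cochain _ _ _ (neg_add_cancel 1),
      D.δ_s_comp_π, ← hψ, ← hφ]
    simp

end DimShift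

end DimShift

end HomotopyAdj

/-! ### Morphisms of dimension shifts and the syzygy–cosyzygy correspondence -/

namespace HomotopyAdj

open CochainComplex HomComplex

namespace DimShift

variable {C : Type u} [Category.{v} C] [Abelian C]
variable {A B A' B' : CochainComplex C ℤ} (D : DimShift A B) (D' : DimShift A' B')

local notation "quot" => HomotopyCategory.quotient C (ComplexShape.up ℤ)

/-- A pair of chain maps is compatible with two dimension shifts if it is induced by a chain map
between the contractible middle terms. -/
def Compat (a : A ⟶ A') (b : B ⟶ B') : Prop :=
  ∃ Ψ : D.P ⟶ D'.P, D.ι ≫ Ψ = a ≫ D'.ι ∧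
    (Cochain.ofHom Ψ).comp D'.π (zero_add 1) = D.π.comp (Cochain.ofHom b) (add_zero 1)

variable {D D'}

namespace Compat

lemma sub {a₁ a₂ : A ⟶ A'} {b₁ b₂ : B ⟶ B'} (h₁ : Compat D D' a₁ b₁)
    (h₂ : Compat D D' a₂ b₂) : Compat D D' (a₁ - a₂) (b₁ - b₂) := by
  obtain ⟨Ψ₁, h₁, h₁'⟩ := h₁
  obtain ⟨Ψ₂, h₂, h₂'⟩ := h₂
  refine ⟨Ψ₁ - Ψ₂, by simp [h₁, h₂], ?_⟩
  rw [Cochain.ofHom_sub, Cochain.ofHom_sub, Cochain.sub_comp, Cochain.comp_sub, h₁', h₂']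

/-- Two contractions of `P` differ by a coboundary, hence the connecting maps of dimension shifts
are natural up to homotopy. -/
lemma quotient_map_comm {a : A ⟶ A'} {b : B ⟶ B'} (h : Compat D D' a b) :
    (quot).map D.e ≫ (quot).map b = (quot).map a ≫ (quot).map D'.e := by
  obtain ⟨Ψ, h₁, h₂⟩ := h
  rw [← Functor.map_comp, ← Functor.map_comp, quotient_map_eq_iff]
  have hδ : δ (-1) 0 (D.s.comp (Cochain.ofHom Ψ) (add_zero (-1)) -
      (Cochain.ofHom Ψ).comp D'.s (zero_add (-1))) = 0 := by
    rw [δ_sub, δ_comp_ofHom, δ_ofHom_comp, D.δ_s, D'.δ_s]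
    simp
  refine ⟨(Cochain.ofHom D.ι).comp ((D.s.comp (D.s.comp (Cochain.ofHom Ψ) (add_zero (-1)) -
      (Cochain.ofHom Ψ).comp D'.s (zero_add (-1))) (show -1 + (-1) = (-2 : ℤ) by norm_num)).comp
        D'.π (show -2 + 1 = (-1 : ℤ) by norm_num)) (zero_add _), ?_⟩
  rw [δ_ofHom_comp, D'.δ_comp_π _ _ (show -2 + 1 = (-1 : ℤ) by norm_num) (neg_add_cancel 1),
    D.δ_s_comp _ _ (neg_add_cancel 1), hδ, Cochain.ofHom_comp, Cochain.ofHom_comp,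
    D.ofHom_e_comp _ (add_zero 1), D'.comp_ofHom_e _ (zero_add (-1)), ← Cochain.ofHom_comp,
    ← h₁, ← h₂, Cochain.ofHom_comp, ← Cochain.comp_assoc_of_second_is_zero_cochain]
  simp

/-- If `P'` has injective terms and `a` is null-homotopic, then so is `b`. -/
lemma right_eq_zero (hP : ∀ n, Injective (D'.P.X n)) {a : A ⟶ A'} {b : B ⟶ B'}
    (h : Compat D D' a b) (ha : (quot).map a = 0) : (quot).map b = 0 := by
  obtain ⟨Ψ, h₁, h₂⟩ := h
  rw [quotient_map_eq_zero_iff_cochain] at ha ⊢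
  obtain ⟨h, hh⟩ := ha
  obtain ⟨H, hH⟩ := D.exists_extension hP (h.comp (Cochain.ofHom D'.ι) (add_zero (-1)))
  obtain ⟨χ, hχ⟩ := D.exists_desc (show 1 + (-1) = (0 : ℤ) by norm_num)
    (Cochain.ofHom Ψ - δ (-1) 0 H) (by
      rw [Cochain.comp_sub, ← δ_ofHom_comp, hH, δ_comp_ofHom, ← hh, ← Cochain.ofHom_comp,
        ← Cochain.ofHom_comp, h₁, sub_self])
  have hχ' : δ (-1) 0 χ = 0 := by
    apply D.π_comp_injective (show 1 + 0 = (1 : ℤ) by norm_num)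
    rw [← D.δ_π_comp _ (show 1 + (-1) = (0 : ℤ) by norm_num) (neg_add_cancel 1) (zero_add 1), hχ]
    simp [δ_δ]
  obtain ⟨k, hk⟩ := D.exists_desc (show 1 + (-1) = (0 : ℤ) by norm_num)
    (H.comp D'.π (neg_add_cancel 1)) (by
      rw [← Cochain.comp_assoc_of_first_is_zero_cochain, hH,
        Cochain.comp_assoc_of_second_is_zero_cochain, D'.ι_comp_π (zero_add 1)]
      simp)
  refine ⟨-(k + χ.comp (D'.s.comp D'.π (neg_add_cancel 1)) (add_zero _)), ?_⟩
  apply D.π_comp_injective (add_zero 1)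
  rw [δ_neg, δ_add, δ_comp_zero_cochain _ _ _ (neg_add_cancel 1), hχ', D'.δ_s_comp_π, ← h₂]
  have e1 : (D.π.comp (δ (-1) 0 k) (add_zero 1)) = -(δ (-1) 0 H).comp D'.π (zero_add 1) := by
    rw [← D'.δ_comp_π H (neg_add_cancel 1) (neg_add_cancel 1) (zero_add 1), ← hk,
      D.δ_π_comp _ _ (neg_add_cancel 1) (zero_add 1)]
  have e2 : (Cochain.ofHom Ψ) = D.π.comp χ (show 1 + (-1) = (0 : ℤ) by norm_num) + δ (-1) 0 H := by
    rw [hχ]; simp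
  rw [e2, Cochain.add_comp, Cochain.comp_neg, Cochain.comp_add, e1,
    Cochain.comp_assoc D.π χ D'.π _ (neg_add_cancel 1) (by norm_num)]
  simp

/-- If `P` has projective terms and `b` is null-homotopic, then so is `a`. -/
lemma left_eq_zero (hP : ∀ n, Projective (D.P.X n)) {a : A ⟶ A'} {b : B ⟶ B'}
    (h : Compat D D' a b) (hb : (quot).map b = 0) : (quot).map a = 0 := by
  obtain ⟨Ψ, h₁, h₂⟩ := h
  rw [quotient_map_eq_zero_iff_cochain] at hb ⊢
  obtain ⟨h, hh⟩ := hb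
  obtain ⟨H, hH⟩ := D'.exists_lift hP (neg_add_cancel 1)
    (D.π.comp h (show 1 + (-1) = (0 : ℤ) by norm_num))
  have hH' : (δ (-1) 0 H).comp D'.π (zero_add 1) = -(Cochain.ofHom Ψ).comp D'.π (zero_add 1) := by
    rw [h₂, hh, ← D.δ_π_comp h (show 1 + (-1) = (0 : ℤ) by norm_num) (neg_add_cancel 1)
      (zero_add 1), ← hH, D'.δ_comp_π H _ (neg_add_cancel 1) (zero_add 1), neg_neg]
  obtain ⟨χ, hχ⟩ := D'.exists_lift_of_comp_π_eq_zero (zero_add 1)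
    (Cochain.ofHom Ψ + δ (-1) 0 H) (by rw [Cochain.add_comp, hH']; simp)
  have hχ' : δ 0 1 χ = 0 := by
    apply D'.comp_ι_injective
    rw [← δ_comp_ofHom, hχ]
    simp [δ_δ]
  obtain ⟨k, hk⟩ := D'.exists_lift_of_comp_π_eq_zero (neg_add_cancel 1)
    ((Cochain.ofHom D.ι).comp H (zero_add _)) (by
      rw [Cochain.comp_assoc_of_first_is_zero_cochain, hH,
        ← Cochain.comp_assoc _ _ _ (zero_add 1) _ (by norm_num), D.ι_comp_π (zero_add 1)]
      simp)
  refine ⟨-k + ((Cochain.ofHom D.ι).comp D.s (zero_add _)).comp χ (add_zero _), ?_⟩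
  apply D'.comp_ι_injective
  rw [δ_add, δ_neg, Cochain.add_comp, Cochain.neg_comp, ← δ_comp_ofHom, hk, δ_ofHom_comp,
    δ_comp_zero_cochain _ _ _ (neg_add_cancel 1), hχ', δ_ofHom_comp, D.δ_s,
    ← Cochain.ofHom_comp, ← h₁, Cochain.ofHom_comp]
  have e2 : (Cochain.ofHom Ψ) =
      χ.comp (Cochain.ofHom D'.ι) (zero_add 0) - δ (-1) 0 H := by
    rw [hχ]; simp
  rw [e2]
  simp [sub_eq_add_neg, add_comm]

/-- If `P'` has injective terms, every chain map `A ⟶ A'` extends to a compatible pair. The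
extension to the middle terms is a coboundary, hence automatically a chain map. -/
lemma exists_right (hP : ∀ n, Injective (D'.P.X n)) (a : A ⟶ A') :
    ∃ b : B ⟶ B', Compat D D' a b := by
  obtain ⟨H, hH⟩ := D.exists_extension hP
    ((Cochain.ofHom (a ≫ D'.ι)).comp D'.s (zero_add (-1)))
  obtain ⟨Ψ, hΨ⟩ := exists_ofHom_eq (δ (-1) 0 H) (δ_δ _ _ _ _)
  have hΨ' : D.ι ≫ Ψ = a ≫ D'.ι := by
    apply Cochain.ofHom_injective
    rw [Cochain.ofHom_comp, hΨ, ← δ_ofHom_comp, hH, δ_ofHom_comp, D'.δ_s]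
    simp
  obtain ⟨b, hb⟩ := D.exists_desc (add_zero 1) ((Cochain.ofHom Ψ).comp D'.π (zero_add 1)) (by
    rw [← Cochain.comp_assoc_of_first_is_zero_cochain, ← Cochain.ofHom_comp, hΨ',
      Cochain.ofHom_comp, Cochain.comp_assoc_of_first_is_zero_cochain, D'.ι_comp_π (zero_add 1)]
    simp)
  have hb' : δ 0 1 b = 0 := by
    apply D.π_comp_injective (show 1 + 1 = (2 : ℤ) by norm_num)
    rw [← D.δ_π_comp _ (add_zero 1) (zero_add 1) (by norm_num), hb, δ_ofHom_comp, D'.δ_π]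
    simp
  obtain ⟨b, rfl⟩ := exists_ofHom_eq _ hb'
  exact ⟨b, Ψ, hΨ', hb.symm⟩

/-- If `P` has projective terms, every chain map `B ⟶ B'` lifts to a compatible pair. -/
lemma exists_left (hP : ∀ n, Projective (D.P.X n)) (b : B ⟶ B') :
    ∃ a : A ⟶ A', Compat D D' a b := by
  obtain ⟨H, hH⟩ := D'.exists_lift hP (neg_add_cancel 1)
    (D.s.comp (D.π.comp (Cochain.ofHom b) (add_zero 1)) (neg_add_cancel 1))
  obtain ⟨Ψ, hΨ⟩ := exists_ofHom_eq (δ (-1) 0 H) (δ_δ _ _ _ _)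
  have hΨ' : (Cochain.ofHom Ψ).comp D'.π (zero_add 1) =
      D.π.comp (Cochain.ofHom b) (add_zero 1) := by
    have := D'.δ_comp_π H (neg_add_cancel 1) (neg_add_cancel 1) (zero_add 1)
    rw [hH, D.δ_s_comp _ _ (show 1 + 1 = (2 : ℤ) by norm_num),
      D.δ_π_comp _ _ (zero_add 1) (by norm_num)] at this
    rw [hΨ]
    simpa using this.symm
  obtain ⟨a, ha⟩ := D'.exists_lift_of_comp_π_eq_zero (zero_add 1) (Cochain.ofHom (D.ι ≫ Ψ)) (by
    rw [Cochain.ofHom_comp, Cochain.comp_assoc_of_first_is_zero_cochain, hΨ',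
      ← Cochain.comp_assoc_of_third_is_zero_cochain, D.ι_comp_π (zero_add 1)]
    simp)
  have ha' : δ 0 1 a = 0 := by
    apply D'.comp_ι_injective
    rw [← δ_comp_ofHom, ha]
    simp
  obtain ⟨a, rfl⟩ := exists_ofHom_eq _ ha'
  exact ⟨a, Ψ, Cochain.ofHom_injective (by rw [← ha, Cochain.ofHom_comp]), hΨ'⟩

end Compat

variable (D D')

/-- The syzygy–cosyzygy correspondence `Hom(A, A') ≃ Hom(B, B')` transforms composition with the
connecting map of `D'` into composition with the connecting map of `D`. So one of these two maps
is bijective iff the other is. -/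
lemma bijective_postcomp_iff (hP : ∀ n, Projective (D.P.X n)) (hP' : ∀ n, Injective (D'.P.X n)) :
    (Function.Bijective fun φ : (quot).obj A ⟶ (quot).obj A' => φ ≫ (quot).map D'.e) ↔
    Function.Bijective fun Φ : (quot).obj B ⟶ (quot).obj B' => (quot).map D.e ≫ Φ := by
  choose r hr using fun a : A ⟶ A' => Compat.exists_right (D := D) (D' := D') hP' a
  choose l hl using fun b : B ⟶ B' => Compat.exists_left (D := D) (D' := D') hP b
  constructor
  · rintro ⟨h₁, h₂⟩
    constructor
    · intro Φ Φ' h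
      obtain ⟨Φ, rfl⟩ := (quot).map_surjective Φ
      obtain ⟨Φ', rfl⟩ := (quot).map_surjective Φ'
      dsimp only at h
      rw [(hl Φ).quotient_map_comm, (hl Φ').quotient_map_comm] at h
      have := ((hl Φ).sub (hl Φ')).right_eq_zero hP' (by
        rw [Functor.map_sub, sub_eq_zero]; exact h₁ h)
      rwa [Functor.map_sub, sub_eq_zero] at this
    · intro g
      obtain ⟨φ, rfl⟩ := h₂ g
      obtain ⟨φ, rfl⟩ := (quot).map_surjective φ
      exact ⟨(quot).map (r φ), (hr φ).quotient_map_comm⟩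
  · rintro ⟨h₁, h₂⟩
    constructor
    · intro φ φ' h
      obtain ⟨φ, rfl⟩ := (quot).map_surjective φ
      obtain ⟨φ', rfl⟩ := (quot).map_surjective φ'
      dsimp only at h
      rw [← (hr φ).quotient_map_comm, ← (hr φ').quotient_map_comm] at h
      have := ((hr φ).sub (hr φ')).left_eq_zero hP (by
        rw [Functor.map_sub, sub_eq_zero]; exact h₁ h)
      rwa [Functor.map_sub, sub_eq_zero] at this
    · intro g
      obtain ⟨Φ, rfl⟩ := h₂ g
      obtain ⟨Φ, rfl⟩ := (quot).map_surjective Φ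
      exact ⟨(quot).map (l Φ), (hl Φ).quotient_map_comm.symm⟩

end DimShift

end HomotopyAdj

/-! ### Syzygies and cosyzygies as dimension shifts -/

namespace HomotopyAdj

open CochainComplex HomComplex

variable {C : Type u} [Category.{v} C] [Abelian C]

local notation "quot" => HomotopyCategory.quotient C (ComplexShape.up ℤ)

lemma _root_.CategoryTheory.ShortComplex.ShortExact.map_eval
    {S : ShortComplex (CochainComplex C ℤ)} (hS : S.ShortExact) (n : ℤ) :
    (S.map (HomologicalComplex.eval C (ComplexShape.up ℤ) n)).ShortExact :=
  hS.map_of_exact _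

lemma shortComplex_exact_of_iso {X₁ X₂ X₃ Y₁ Y₂ Y₃ : C} {f : X₁ ⟶ X₂} {g : X₂ ⟶ X₃}
    {w : f ≫ g = 0} (h : (ShortComplex.mk f g w).Exact) (e₁ : X₁ ≅ Y₁) (e₂ : X₂ ≅ Y₂)
    (e₃ : X₃ ≅ Y₃) {f' : Y₁ ⟶ Y₂} {g' : Y₂ ⟶ Y₃} {w' : f' ≫ g' = 0}
    (h₁ : e₁.hom ≫ f' = f ≫ e₂.hom) (h₂ : e₂.hom ≫ g' = g ≫ e₃.hom) :
    (ShortComplex.mk f' g' w').Exact :=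
  (ShortComplex.exact_iff_of_iso (ShortComplex.isoMk e₁ e₂ e₃ h₁ h₂)).1 h

namespace DimShift

/-- A short exact sequence `0 → A → P → B[1] → 0` with `P` contractible is a dimension shift. -/
noncomputable def ofShortExact {A B P : CochainComplex C ℤ} (i : A ⟶ P) (p : P ⟶ B⟦(1 : ℤ)⟧)
    (w : i ≫ p = 0) (hS : (ShortComplex.mk i p w).ShortExact) (s : Homotopy (𝟙 P) 0) :
    DimShift A B where
  P := P
  ι := i
  π := (Cochain.ofHom p).rightUnshift 1 (zero_add 1)
  s := Cochain.ofHomotopy s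
  δ_π := by
    rw [Cochain.δ_rightUnshift _ _ _ _ 1 (by norm_num), δ_ofHom]
    simp
  δ_s := by
    rw [δ_ofHomotopy]
    simp
  mono n := (hS.map_eval n).mono_f
  epi m n h := by
    have : Epi (p.f m) := (hS.map_eval m).epi_g
    rw [Cochain.rightUnshift_v _ _ _ m n h m (by omega), Cochain.ofHom_v]
    infer_instance
  w m n h := by
    rw [Cochain.rightUnshift_v _ _ _ m n h m (by omega), Cochain.ofHom_v, ← Category.assoc,
      ← HomologicalComplex.comp_f, w]
    exact zero_comp
  exact m n h := by
    refine shortComplex_exact_of_iso (hS.map_eval m).exact (Iso.refl _) (Iso.refl _)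
      (B.shiftFunctorObjXIso 1 m n h.symm)
      ((Category.id_comp _).trans (Category.comp_id _).symm) ?_
    rw [Cochain.rightUnshift_v _ _ _ m n h m (add_zero m), Cochain.ofHom_v]
    exact Category.id_comp _

lemma compat_ofShortExact {A B P A' B' P' : CochainComplex C ℤ} {i : A ⟶ P} {p : P ⟶ B⟦(1 : ℤ)⟧}
    {w : i ≫ p = 0} {hS : (ShortComplex.mk i p w).ShortExact} {s : Homotopy (𝟙 P) 0}
    {i' : A' ⟶ P'} {p' : P' ⟶ B'⟦(1 : ℤ)⟧} {w' : i' ≫ p' = 0}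
    {hS' : (ShortComplex.mk i' p' w').ShortExact} {s' : Homotopy (𝟙 P') 0}
    {a : A ⟶ A'} {b : B ⟶ B'} (Ψ : P ⟶ P') (h₁ : i ≫ Ψ = a ≫ i') (h₂ : Ψ ≫ p' = p ≫ b⟦(1 : ℤ)⟧') :
    Compat (ofShortExact i p w hS s) (ofShortExact i' p' w' hS' s') a b := by
  refine ⟨Ψ, h₁, ?_⟩
  change (Cochain.ofHom Ψ).comp ((Cochain.ofHom p').rightUnshift 1 (zero_add 1)) (zero_add 1) =
    ((Cochain.ofHom p).rightUnshift 1 (zero_add 1)).comp (Cochain.ofHom b) (add_zero 1)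
  ext m n h
  have := HomologicalComplex.congr_hom h₂ m
  simp only [HomologicalComplex.comp_f] at this
  subst h
  have hv : ∀ {B P : CochainComplex C ℤ} (p : P ⟶ B⟦(1 : ℤ)⟧),
      ((Cochain.ofHom p).rightUnshift 1 (zero_add 1)).v m (m + 1) rfl = p.f m := fun p => by
    rw [Cochain.rightUnshift_v _ _ _ m _ rfl m (add_zero m), Cochain.ofHom_v]
    exact Category.comp_id _
  rw [Cochain.zero_cochain_comp_v, Cochain.comp_zero_cochain_v, Cochain.ofHom_v, Cochain.ofHom_v]
  exact (congrArg _ (hv p')).trans (this.trans (congrArg (· ≫ b.f (m + 1)) (hv p).symm))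

/-- A short exact sequence `0 → A[-1] → P → B → 0` with `P` contractible gives, after a shift,
a dimension shift from `A` to `B`. -/
noncomputable def ofShortExact' {A B P : CochainComplex C ℤ} (i : A⟦(-1 : ℤ)⟧ ⟶ P) (p : P ⟶ B)
    (w : i ≫ p = 0) (hS : (ShortComplex.mk i p w).ShortExact) (s : Homotopy (𝟙 P) 0) :
    DimShift A B where
  P := P⟦(1 : ℤ)⟧
  ι := (shiftFunctorCompIsoId (CochainComplex C ℤ) (-1) (1 : ℤ) (neg_add_cancel 1)).inv.app A ≫
    i⟦(1 : ℤ)⟧'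
  π := Cochain.mk fun m n h => p.f (m + 1) ≫ (B.XIsoOfEq h).hom
  s := Cochain.ofHomotopy (s.shift 1)
  δ_π := by
    ext m n h
    rw [δ_v 1 2 (by norm_num) _ m n h (m + 1) (m + 1) (by omega) rfl]
    obtain rfl : n = m + 1 + 1 := by omega
    rw [Cochain.mk_v, Cochain.mk_v]
    have h1 : (p.f (m + 1) ≫ (B.XIsoOfEq (rfl : m + 1 = m + 1)).hom) ≫ B.d (m + 1) (m + 1 + 1) =
        p.f (m + 1) ≫ B.d (m + 1) (m + 1 + 1) := by simp
    have h2 : (-P.d (m + 1) (m + 1 + 1)) ≫ p.f (m + 1 + 1) ≫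
        (B.XIsoOfEq (rfl : m + 1 + 1 = m + 1 + 1)).hom =
        - (p.f (m + 1) ≫ B.d (m + 1) (m + 1 + 1)) := by simp
    rw [Int.negOnePow_even 2 (by decide), one_smul, shiftFunctor_obj_d', Int.negOnePow_one,
      Units.neg_smul, one_smul]
    exact (congrArg₂ (· + ·) h1 h2).trans (add_neg_cancel _)
  δ_s := by
    refine (δ_ofHomotopy (s.shift 1)).trans ?_
    rw [Functor.map_zero, Cochain.ofHom_zero, sub_zero]
    exact congrArg _ (CategoryTheory.Functor.map_id _ _)
  mono n := by
    have : Mono ((i⟦(1 : ℤ)⟧').f n) := (hS.map_eval (n + 1)).mono_f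
    exact mono_comp (((shiftFunctorCompIsoId (CochainComplex C ℤ) (-1) (1 : ℤ)
      (neg_add_cancel 1)).inv.app A).f n) _
  epi m n h := by
    have : Epi (p.f (m + 1)) := (hS.map_eval (m + 1)).epi_g
    exact epi_comp (p.f (m + 1)) (B.XIsoOfEq h).hom
  w m n h := by
    have : (i⟦(1 : ℤ)⟧').f m ≫ p.f (m + 1) = 0 :=
      HomologicalComplex.congr_hom w (m + 1)
    rw [Cochain.mk_v, HomologicalComplex.comp_f, Category.assoc]
    refine (congrArg _ ((Category.assoc _ _ _).symm.trans
      ((congrArg (· ≫ (B.XIsoOfEq h).hom) this).trans zero_comp))).trans comp_zero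
  exact m n h := by
    have := HomologicalComplex.congr_hom ((shiftFunctorCompIsoId (CochainComplex C ℤ) (-1) (1 : ℤ)
      (neg_add_cancel 1)).hom_inv_id_app_assoc A (i⟦(1 : ℤ)⟧')) m
    exact shortComplex_exact_of_iso (hS.map_eval (m + 1)).exact
      ((HomologicalComplex.eval C (ComplexShape.up ℤ) m).mapIso
        ((shiftFunctorCompIsoId (CochainComplex C ℤ) (-1) (1 : ℤ) (neg_add_cancel 1)).app A))
      (Iso.refl _) (B.XIsoOfEq h) (this.trans (Category.comp_id _).symm) (Category.id_comp _)

lemma compat_ofShortExact' {A B P A' B' P' : CochainComplex C ℤ} {i : A⟦(-1 : ℤ)⟧ ⟶ P} {p : P ⟶ B}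
    {w : i ≫ p = 0} {hS : (ShortComplex.mk i p w).ShortExact} {s : Homotopy (𝟙 P) 0}
    {i' : A'⟦(-1 : ℤ)⟧ ⟶ P'} {p' : P' ⟶ B'} {w' : i' ≫ p' = 0}
    {hS' : (ShortComplex.mk i' p' w').ShortExact} {s' : Homotopy (𝟙 P') 0}
    {a : A ⟶ A'} {b : B ⟶ B'} (Ψ : P ⟶ P') (h₁ : i ≫ Ψ = a⟦(-1 : ℤ)⟧' ≫ i')
    (h₂ : Ψ ≫ p' = p ≫ b) :
    Compat (ofShortExact' i p w hS s) (ofShortExact' i' p' w' hS' s') a b := by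
  refine ⟨Ψ⟦(1 : ℤ)⟧', ?_, ?_⟩
  · have := (shiftFunctorCompIsoId (CochainComplex C ℤ) (-1) (1 : ℤ)
      (neg_add_cancel 1)).inv.naturality a
    dsimp at this
    dsimp [ofShortExact']
    rw [reassoc_of% this, Category.assoc, ← Functor.map_comp, ← Functor.map_comp, h₁]
  · change (Cochain.ofHom (Ψ⟦(1 : ℤ)⟧')).comp (Cochain.mk fun m n h =>
        p'.f (m + 1) ≫ (B'.XIsoOfEq h).hom : Cochain (P'⟦(1 : ℤ)⟧) B' 1) (zero_add 1) =
      (Cochain.mk fun m n h => p.f (m + 1) ≫ (B.XIsoOfEq h).hom :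
        Cochain (P⟦(1 : ℤ)⟧) B 1).comp (Cochain.ofHom b) (add_zero 1)
    ext m n h
    have := HomologicalComplex.congr_hom h₂ (m + 1)
    simp only [HomologicalComplex.comp_f] at this
    subst h
    rw [Cochain.zero_cochain_comp_v, Cochain.comp_zero_cochain_v, Cochain.ofHom_v, Cochain.ofHom_v]
    have hv : ∀ {B P : CochainComplex C ℤ} (p : P ⟶ B),
      p.f (m + 1) ≫ (B.XIsoOfEq (rfl : m + 1 = m + 1)).hom = p.f (m + 1) :=
      fun p => Category.comp_id _
    exact (congrArg _ (hv p')).trans (this.trans (congrArg (· ≫ b.f (m + 1)) (hv p).symm))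

end DimShift

section Syzygy

variable [EnoughProjectives C]

/-- The dimension shift `0 → Ω(X[1]) → P → X[1] → 0`. -/
noncomputable def syzDimShift (X : CochainComplex C ℤ) : DimShift (syz (X⟦(1 : ℤ)⟧)) X :=
  .ofShortExact (kernel.ι _) (projCover (X⟦(1 : ℤ)⟧)) (kernel.condition _)
    { exact := ShortComplex.exact_of_f_is_kernel _ (kernelIsKernel _) } (discsContraction _)

lemma syzDimShift_projective (X : CochainComplex C ℤ) (n : ℤ) :
    Projective ((syzDimShift X).P.X n) :=
  inferInstanceAs (Projective (Projective.over _ ⊞ Projective.over _))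

lemma syzDimShift_compat {X Y : CochainComplex C ℤ} (f : X ⟶ Y) :
    DimShift.Compat (syzDimShift X) (syzDimShift Y) (syzMap (f⟦(1 : ℤ)⟧')) f := by
  exact DimShift.compat_ofShortExact _ (syzMap_ι _).symm (projCoverMap_comp _)

/-- The natural transformation `Ω̃ ⟶ 𝟭` given by the connecting maps. -/
noncomputable def syzShiftCounit : SyzShift (C := C) ⟶ 𝟭 _ :=
  CategoryTheory.Quotient.natTransLift _
    { app := fun X => Syz.map (((quot).commShiftIso (1 : ℤ)).inv.app X) ≫
        (quot).map (syzDimShift X).e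
      naturality := fun {X Y} f => by
        have h1 := ((quot).commShiftIso (1 : ℤ)).inv.naturality f
        have h3 := (syzDimShift_compat f).quotient_map_comm
        have h4 := congrArg (fun k => Syz.map k) h1
        simp only [Functor.map_comp] at h4
        refine (Category.assoc _ _ _).symm.trans ((congrArg (· ≫ _) h4).trans ?_)
        refine (Category.assoc _ _ _).trans ?_
        refine Eq.trans ?_ (Category.assoc _ _ _).symm
        exact congrArg (fun k => Syz.map (((quot).commShiftIso (1 : ℤ)).inv.app X) ≫ k) h3.symm }

end Syzygy

section Cosyzygy

variable [EnoughInjectives C]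

/-- The dimension shift `0 → X → I[1] → ℧(X[-1])[1] → 0`. -/
noncomputable def cosyzDimShift (X : CochainComplex C ℤ) :
    DimShift X (cosyz (X⟦(-1 : ℤ)⟧)) :=
  .ofShortExact' (injHull (X⟦(-1 : ℤ)⟧)) (cokernel.π _) (cokernel.condition _)
    { exact := ShortComplex.exact_of_g_is_cokernel _ (cokernelIsCokernel _) } (discsContraction _)

lemma cosyzDimShift_injective (X : CochainComplex C ℤ) (n : ℤ) :
    Injective ((cosyzDimShift X).P.X n) :=
  inferInstanceAs (Injective (Injective.under _ ⊞ Injective.under _))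

lemma cosyzDimShift_compat {X Y : CochainComplex C ℤ} (f : X ⟶ Y) :
    DimShift.Compat (cosyzDimShift X) (cosyzDimShift Y) f (cosyzMap (f⟦(-1 : ℤ)⟧')) := by
  exact DimShift.compat_ofShortExact' _ (comp_injHullMap _) (π_cosyzMap _).symm

/-- The natural transformation `𝟭 ⟶ ℧̃` given by the connecting maps. -/
noncomputable def cosyzShiftUnit : 𝟭 _ ⟶ CosyzShift (C := C) :=
  CategoryTheory.Quotient.natTransLift _
    { app := fun X => (quot).map (cosyzDimShift X).e ≫
        Cosyz.map (((quot).commShiftIso (-1 : ℤ)).hom.app X)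
      naturality := fun {X Y} f => by
        have h1 := ((quot).commShiftIso (-1 : ℤ)).hom.naturality f
        have h3 := (cosyzDimShift_compat f).quotient_map_comm
        have h4 := congrArg (fun k => Cosyz.map k) h1
        simp only [Functor.map_comp] at h4
        refine (Category.assoc _ _ _).symm.trans ((congrArg (· ≫ _) h3.symm).trans ?_)
        refine (Category.assoc _ _ _).trans ?_
        refine Eq.trans ?_ (Category.assoc _ _ _).symm
        exact congrArg (fun k => (quot).map (cosyzDimShift X).e ≫ k) h4 }

end Cosyzygy

end HomotopyAdj

/-! ### Adjunctions from reflectors and coreflectors -/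

namespace HomotopyAdj

section Abstract

variable {K I J : Type*} [Category* K] [Category* I] [Category* J]

lemma bijective_postcomp_iso {A A' Z Z' Z'' : K} (α : A' ≅ A) (r : Z ⟶ Z') (β : Z' ≅ Z'') :
    (Function.Bijective fun φ : A' ⟶ Z => φ ≫ r ≫ β.hom) ↔
      Function.Bijective fun φ : A ⟶ Z => φ ≫ r := by
  have : (fun φ : A' ⟶ Z => φ ≫ r ≫ β.hom) =
      (Iso.homCongr α.symm β) ∘ (fun φ : A ⟶ Z => φ ≫ r) ∘ (Iso.homCongr α (Iso.refl _)) := by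
    ext φ
    simp [Iso.homCongr]
  rw [this, Equiv.comp_bijective, Equiv.bijective_comp]

lemma bijective_postcomp_congr {A A' Z Z' : K} (α : A' ≅ A) (r : Z ⟶ Z') :
    (Function.Bijective fun φ : A' ⟶ Z => φ ≫ r) ↔
      Function.Bijective fun φ : A ⟶ Z => φ ≫ r := by
  simpa using bijective_postcomp_iso α r (Iso.refl Z')

lemma bijective_precomp_iso {A A' A'' Z Z' : K} (α : A'' ≅ A') (r : A' ⟶ A) (β : Z ≅ Z') :
    (Function.Bijective fun φ : A ⟶ Z => (α.hom ≫ r) ≫ φ) ↔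
      Function.Bijective fun φ : A ⟶ Z' => r ≫ φ := by
  have : (fun φ : A ⟶ Z => (α.hom ≫ r) ≫ φ) =
      (Iso.homCongr α.symm β.symm) ∘ (fun φ : A ⟶ Z' => r ≫ φ) ∘
        (Iso.homCongr (Iso.refl _) β) := by
    ext φ
    simp [Iso.homCongr]
  rw [this, Equiv.comp_bijective, Equiv.bijective_comp]

lemma bijective_precomp_congr {A A' Z Z' : K} (r : A' ⟶ A) (β : Z ≅ Z') :
    (Function.Bijective fun φ : A ⟶ Z => r ≫ φ) ↔
      Function.Bijective fun φ : A ⟶ Z' => r ≫ φ := by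
  simpa using bijective_precomp_iso (Iso.refl A') r β

lemma bijective_postcomp_comp {A Z Z' Z'' : K} {f : Z ⟶ Z'} {g : Z' ⟶ Z''}
    (hg : Function.Bijective fun φ : A ⟶ Z' => φ ≫ g)
    (hf : Function.Bijective fun φ : A ⟶ Z => φ ≫ f) :
    Function.Bijective fun φ : A ⟶ Z => φ ≫ f ≫ g := by
  convert! hg.comp hf using 1
  ext φ
  simp

lemma bijective_precomp_comp {A A' A'' Z : K} {f : A ⟶ A'} {g : A' ⟶ A''}
    (hg : Function.Bijective fun φ : A'' ⟶ Z => g ≫ φ)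
    (hf : Function.Bijective fun φ : A' ⟶ Z => f ≫ φ) :
    Function.Bijective fun φ : A'' ⟶ Z => (f ≫ g) ≫ φ := by
  convert! hf.comp hg using 1
  ext φ
  simp

/-- In the square `Hom(A, Z)`, `Hom(A', Z)`, `Hom(A, Z')`, `Hom(A', Z')` of composition maps, three
bijective sides force the fourth to be bijective. -/
lemma bijective_precomp_of_square {A A' Z Z' : K} {a : A' ⟶ A} {z : Z ⟶ Z'}
    (h₁ : Function.Bijective fun φ : A ⟶ Z => φ ≫ z)
    (h₂ : Function.Bijective fun φ : A' ⟶ Z => φ ≫ z)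
    (h₃ : Function.Bijective fun φ : A ⟶ Z' => a ≫ φ) :
    Function.Bijective fun φ : A ⟶ Z => a ≫ φ := by
  rw [← Function.Bijective.of_comp_iff' h₂]
  convert! h₃.comp h₁ using 1
  ext φ
  simp

lemma bijective_postcomp_of_square {A A' Z Z' : K} {a : A' ⟶ A} {z : Z ⟶ Z'}
    (h₁ : Function.Bijective fun φ : A ⟶ Z => a ≫ φ)
    (h₂ : Function.Bijective fun φ : A ⟶ Z' => a ≫ φ)
    (h₃ : Function.Bijective fun φ : A' ⟶ Z => φ ≫ z) :
    Function.Bijective fun φ : A ⟶ Z => φ ≫ z := by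
  rw [← Function.Bijective.of_comp_iff' h₂]
  convert! h₃.comp h₁ using 1
  ext φ
  simp

/-- The left adjoint of `G ⋙ lam`, where `lam` is a reflector onto the subcategory `I`: it suffices
that composition with `ε : W ⟶ 𝟭` is bijective on morphisms between objects of `I`, and that
morphisms out of `W.obj X`, with `X` in `I`, do not distinguish `G.obj Y` from its reflection:
then `Hom(T W X, Y) ≃ Hom(W X, G Y) ≃ Hom(W X, lam G Y) ≃ Hom(X, lam G Y)`. -/
noncomputable def adjunctionOfReflector {i : I ⥤ K} (hi : i.FullyFaithful) {lam : K ⥤ I}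
    (adjlam : lam ⊣ i) {T : K ⥤ J} {G : J ⥤ K} (adj : T ⊣ G) {W : K ⥤ K} (ε : W ⟶ 𝟭 K)
    (h₁ : ∀ X E : I, Function.Bijective fun θ : i.obj X ⟶ i.obj E => ε.app (i.obj X) ≫ θ)
    (h₂ : ∀ (X : I) (Y : J), Function.Bijective
      fun φ : W.obj (i.obj X) ⟶ G.obj Y => φ ≫ adjlam.unit.app (G.obj Y)) :
    i ⋙ W ⋙ T ⊣ G ⋙ lam :=
  let e (X : I) (Y : J) : (T.obj (W.obj (i.obj X)) ⟶ Y) ≃ (X ⟶ lam.obj (G.obj Y)) :=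
    (adj.homEquiv _ _).trans (((Equiv.ofBijective _ (h₂ X Y)).trans
      (Equiv.ofBijective _ (h₁ X (lam.obj (G.obj Y)))).symm).trans hi.homEquiv.symm)
  have he (X : I) (Y : J) (a : T.obj (W.obj (i.obj X)) ⟶ Y) (b : X ⟶ lam.obj (G.obj Y)) :
      e X Y a = b ↔ ε.app (i.obj X) ≫ i.map b =
        adj.homEquiv _ _ a ≫ adjlam.unit.app (G.obj Y) := by
    have h : ∀ c, ε.app (i.obj X) ≫ (Equiv.ofBijective _ (h₁ X (lam.obj (G.obj Y)))).symm c = c :=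
      fun c => (Equiv.ofBijective _ (h₁ X (lam.obj (G.obj Y)))).apply_symm_apply c
    have h' : i.map (e X Y a) = (Equiv.ofBijective _ (h₁ X (lam.obj (G.obj Y)))).symm
        (adj.homEquiv _ _ a ≫ adjlam.unit.app (G.obj Y)) := hi.map_preimage _
    constructor
    · rintro rfl
      rw [h', h]
    · intro hb
      apply hi.map_injective
      apply (h₁ _ _).1
      dsimp only
      rw [h', h, hb]
  Adjunction.mkOfHomEquiv
    { homEquiv := e
      homEquiv_naturality_left_symm := fun {X' X Y} f g => by
        rw [Equiv.symm_apply_eq]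
        obtain ⟨a, rfl⟩ := (e X Y).surjective g
        rw [Equiv.symm_apply_apply]
        refine ((he _ _ _ _).2 ?_).symm
        have h := (he X Y a _).1 rfl
        have h2 := ε.naturality (i.map f)
        dsimp at h2 ⊢
        rw [i.map_comp, ← reassoc_of% h2, h, adj.homEquiv_naturality_left]
        simp
      homEquiv_naturality_right := fun {X Y Y'} f g => by
        refine (he _ _ _ _).2 ?_
        have h := (he X Y f _).1 rfl
        have h2 := adjlam.unit.naturality (G.map g)
        dsimp at h2 ⊢
        rw [i.map_comp, reassoc_of% h, adj.homEquiv_naturality_right, Category.assoc, h2] }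

/-- The dual of `adjunctionOfReflector`, for a coreflector `rho` onto a subcategory `I`. -/
noncomputable def adjunctionOfCoreflector {i : I ⥤ K} (hi : i.FullyFaithful) {rho : K ⥤ I}
    (adjrho : i ⊣ rho) {L : J ⥤ K} {R : K ⥤ J} (adj : L ⊣ R) {W : K ⥤ K} (η : 𝟭 K ⟶ W)
    (h₁ : ∀ Q X : I, Function.Bijective fun θ : i.obj Q ⟶ i.obj X => θ ≫ η.app (i.obj X))
    (h₂ : ∀ (X : I) (Y : J), Function.Bijective
      fun φ : L.obj Y ⟶ W.obj (i.obj X) => adjrho.counit.app (L.obj Y) ≫ φ) :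
    L ⋙ rho ⊣ i ⋙ W ⋙ R :=
  let e (Y : J) (X : I) : (rho.obj (L.obj Y) ⟶ X) ≃ (Y ⟶ R.obj (W.obj (i.obj X))) :=
    (hi.homEquiv.trans ((Equiv.ofBijective _ (h₁ (rho.obj (L.obj Y)) X)).trans
      (Equiv.ofBijective _ (h₂ X Y)).symm)).trans (adj.homEquiv _ _)
  have he (Y : J) (X : I) (a : rho.obj (L.obj Y) ⟶ X) (b : Y ⟶ R.obj (W.obj (i.obj X))) :
      e Y X a = b ↔ i.map a ≫ η.app (i.obj X) =
        adjrho.counit.app (L.obj Y) ≫ (adj.homEquiv _ _).symm b := by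
    have h : ∀ c, adjrho.counit.app (L.obj Y) ≫ (Equiv.ofBijective _ (h₂ X Y)).symm c = c :=
      fun c => (Equiv.ofBijective _ (h₂ X Y)).apply_symm_apply c
    have h' : (adj.homEquiv _ _).symm (e Y X a) = (Equiv.ofBijective _ (h₂ X Y)).symm
        (i.map a ≫ η.app (i.obj X)) := (adj.homEquiv _ _).symm_apply_apply _
    constructor
    · rintro rfl
      rw [h', h]
    · intro hb
      apply (adj.homEquiv _ _).symm.injective
      apply (h₂ _ _).1
      dsimp only
      rw [h', h, hb]
  Adjunction.mkOfHomEquiv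
    { homEquiv := e
      homEquiv_naturality_left_symm := fun {Y' Y X} f g => by
        rw [Equiv.symm_apply_eq]
        obtain ⟨a, rfl⟩ := (e Y X).surjective g
        rw [Equiv.symm_apply_apply]
        refine ((he _ _ _ _).2 ?_).symm
        have h := (he Y X a _).1 rfl
        have h2 := adjrho.counit.naturality (L.map f)
        dsimp at h2 ⊢
        rw [i.map_comp, Category.assoc, h, reassoc_of% h2, adj.homEquiv_naturality_left_symm]
      homEquiv_naturality_right := fun {Y X X'} f g => by
        refine (he _ _ _ _).2 ?_
        have h := (he Y X f _).1 rfl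
        have h2 := η.naturality (i.map g)
        dsimp at h2 ⊢
        rw [i.map_comp, Category.assoc, h2, reassoc_of% h,
          ← adj.homEquiv_naturality_right_symm] }

/-- The `d`-fold composite of a natural transformation `F ⟶ 𝟭`. -/
def iterCounit {F : K ⥤ K} (ε : F ⟶ 𝟭 K) : ∀ d : ℕ, iter F d ⟶ 𝟭 K
  | 0 => 𝟙 _
  | d + 1 => Functor.whiskerLeft (iter F d) ε ≫ iterCounit ε d

/-- The `d`-fold composite of a natural transformation `𝟭 ⟶ F`. -/
def iterUnit {F : K ⥤ K} (η : 𝟭 K ⟶ F) : ∀ d : ℕ, 𝟭 K ⟶ iter F d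
  | 0 => 𝟙 _
  | d + 1 => iterUnit η d ≫ Functor.whiskerLeft (iter F d) η

lemma bijective_iterCounit_comp {F : K ⥤ K} (ε : F ⟶ 𝟭 K) {E : K}
    (h : ∀ X, Function.Bijective fun θ : X ⟶ E => ε.app X ≫ θ) (d : ℕ) (X : K) :
    Function.Bijective fun θ : X ⟶ E => (iterCounit ε d).app X ≫ θ := by
  induction d with
  | zero =>
    convert! (Function.bijective_id : Function.Bijective (id : (X ⟶ E) → _)) using 1
    ext θ
    exact Category.id_comp θ
  | succ d ih =>
    convert! (h ((iter F d).obj X)).comp ih using 1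
    ext θ
    exact Category.assoc _ _ _

lemma bijective_comp_iterUnit {F : K ⥤ K} (η : 𝟭 K ⟶ F) {Q : K}
    (h : ∀ X, Function.Bijective fun θ : Q ⟶ X => θ ≫ η.app X) (d : ℕ) (X : K) :
    Function.Bijective fun θ : Q ⟶ X => θ ≫ (iterUnit η d).app X := by
  induction d with
  | zero =>
    convert! (Function.bijective_id : Function.Bijective (id : (Q ⟶ X) → _)) using 1
    ext θ
    exact Category.comp_id θ
  | succ d ih =>
    convert! (h ((iter F d).obj X)).comp ih using 1
    ext θ
    exact (Category.assoc _ _ _).symm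

end Abstract

end HomotopyAdj

/-! ### Complexes with terms of bounded dimension -/

namespace HomotopyAdj

open CochainComplex HomComplex

variable {C : Type u} [Category.{v} C] [Abelian C]

local notation "quot" => HomotopyCategory.quotient C (ComplexShape.up ℤ)

namespace DimShift

variable {A B : CochainComplex C ℤ} (D : DimShift A B)

lemma hasInjectiveDimensionLE (hP : ∀ n, Injective (D.P.X n)) (d : ℕ)
    (hA : ∀ n, HasInjectiveDimensionLE (A.X n) (d + 1)) (n : ℤ) :
    HasInjectiveDimensionLE (B.X n) d := by
  have hn : n - 1 + 1 = n := by omega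
  have : Injective (D.P.X (n - 1)) := hP _
  let S := ShortComplex.mk (D.ι.f (n - 1)) (D.π.v (n - 1) n hn) (D.w _ _ _)
  have hS : S.ShortExact :=
    { exact := D.exact _ _ _, mono_f := D.mono _, epi_g := D.epi _ _ _ }
  exact (hS.hasInjectiveDimensionLT_X₃_iff d (hP _)).2 (hA _)

lemma hasProjectiveDimensionLE (hP : ∀ n, Projective (D.P.X n)) (d : ℕ)
    (hB : ∀ n, HasProjectiveDimensionLE (B.X n) (d + 1)) (n : ℤ) :
    HasProjectiveDimensionLE (A.X n) d := by
  let S := ShortComplex.mk (D.ι.f n) (D.π.v n (n + 1) rfl) (D.w _ _ _)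
  have hS : S.ShortExact :=
    { exact := D.exact _ _ _, mono_f := D.mono _, epi_g := D.epi _ _ _ }
  exact (hS.hasProjectiveDimensionLT_X₃_iff d (hP _)).1 (hB _)

end DimShift

section Syzygy

variable [EnoughProjectives C]

/-- Morphisms into a complex with injective terms invert `Ω̃ X ⟶ X`. -/
lemma bijective_syzShiftCounit_comp {E : HomotopyCategory C (ComplexShape.up ℤ)}
    (hE : injTerms C E) (X : HomotopyCategory C (ComplexShape.up ℤ)) :
    Function.Bijective fun θ : X ⟶ E => syzShiftCounit.app X ≫ θ :=
  (bijective_precomp_iso (Syz.mapIso (((quot).commShiftIso (1 : ℤ)).symm.app X.as))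
    ((quot).map (syzDimShift X.as).e) (Iso.refl E)).2
    ((syzDimShift X.as).bijective_precomp hE)

end Syzygy

section Cosyzygy

variable [EnoughInjectives C]

/-- Morphisms out of a complex with projective terms invert `X ⟶ ℧̃ X`. -/
lemma bijective_comp_cosyzShiftUnit {Q : HomotopyCategory C (ComplexShape.up ℤ)}
    (hQ : projTerms C Q) (X : HomotopyCategory C (ComplexShape.up ℤ)) :
    Function.Bijective fun φ : Q ⟶ X => φ ≫ cosyzShiftUnit.app X :=
  (bijective_postcomp_iso (Iso.refl Q) ((quot).map (cosyzDimShift X.as).e)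
    (Cosyz.mapIso (((quot).commShiftIso (-1 : ℤ)).app X.as))).2
    ((cosyzDimShift X.as).bijective_postcomp hQ)

end Cosyzygy

section Dimension

variable [EnoughProjectives C] [EnoughInjectives C]

lemma bijective_comp_cosyzDimShift_iff (V : HomotopyCategory C (ComplexShape.up ℤ))
    (Z : CochainComplex C ℤ) :
    (Function.Bijective fun φ : SyzShift.obj V ⟶ (quot).obj Z =>
      φ ≫ (quot).map (cosyzDimShift Z).e) ↔
    Function.Bijective fun Φ : V ⟶ (quot).obj (cosyz (Z⟦(-1 : ℤ)⟧)) =>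
      syzShiftCounit.app V ≫ Φ := by
  have h := (syzDimShift V.as).bijective_postcomp_iff (cosyzDimShift Z)
    (syzDimShift_projective _) (cosyzDimShift_injective _)
  refine Iff.trans ?_ (h.trans ?_)
  · exact bijective_postcomp_congr (Syz.mapIso (((quot).commShiftIso (1 : ℤ)).symm.app V.as))
      ((quot).map (cosyzDimShift Z).e)
  · exact (bijective_precomp_iso (Syz.mapIso (((quot).commShiftIso (1 : ℤ)).symm.app V.as))
      ((quot).map (syzDimShift V.as).e) (Iso.refl _)).symm

lemma bijective_syzDimShift_comp_iff (V : HomotopyCategory C (ComplexShape.up ℤ))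
    (X : CochainComplex C ℤ) :
    (Function.Bijective fun φ : (quot).obj X ⟶ CosyzShift.obj V =>
      (quot).map (syzDimShift X).e ≫ φ) ↔
    Function.Bijective fun Φ : (quot).obj (syz (X⟦(1 : ℤ)⟧)) ⟶ V =>
      Φ ≫ cosyzShiftUnit.app V := by
  have h := (syzDimShift X).bijective_postcomp_iff (cosyzDimShift V.as)
    (syzDimShift_projective _) (cosyzDimShift_injective _)
  refine Iff.trans ?_ (h.symm.trans ?_)
  · exact bijective_precomp_congr ((quot).map (syzDimShift X).e)
      (Cosyz.mapIso (((quot).commShiftIso (-1 : ℤ)).app V.as)).symm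
  · exact (bijective_postcomp_iso (Iso.refl _) ((quot).map (cosyzDimShift V.as).e)
      (Cosyz.mapIso (((quot).commShiftIso (-1 : ℤ)).app V.as))).symm

/-- A complex `Z` with terms of injective dimension at most `d` has a reflection `Z ⟶ E` in the
complexes with injective terms, a composite of `d` connecting maps of cosyzygies, that is
inverted by `Hom(Ω̃ᵐ W, -)` for all `m ≥ d`. -/
lemma exists_reflection_of_hasInjectiveDimensionLE (d : ℕ) : ∀ (Z : CochainComplex C ℤ)
    (_ : ∀ n, HasInjectiveDimensionLE (Z.X n) d),
    ∃ (E : HomotopyCategory C (ComplexShape.up ℤ)) (r : (quot).obj Z ⟶ E), injTerms C E ∧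
      (∀ E', injTerms C E' → Function.Bijective fun θ : E ⟶ E' => r ≫ θ) ∧
      ∀ m, d ≤ m → ∀ W, Function.Bijective
        fun φ : (iter SyzShift m).obj W ⟶ (quot).obj Z => φ ≫ r := by
  induction d with
  | zero =>
    intro Z hZ
    refine ⟨(quot).obj Z, 𝟙 _, fun n => ?_, fun E' _ => ?_, fun m _ W => ?_⟩
    · exact injective_iff_hasInjectiveDimensionLT_one.2 (hZ n)
    · simpa using! Function.bijective_id
    · simpa using! Function.bijective_id
  | succ d ih =>
    intro Z hZ
    obtain ⟨E, r, hE, hr, hrW⟩ := ih (cosyz (Z⟦(-1 : ℤ)⟧))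
      ((cosyzDimShift Z).hasInjectiveDimensionLE (cosyzDimShift_injective Z) d hZ)
    refine ⟨E, (quot).map (cosyzDimShift Z).e ≫ r, hE, fun E' hE' => ?_, fun m hm W => ?_⟩
    · exact bijective_precomp_comp (hr E' hE') ((cosyzDimShift Z).bijective_precomp hE')
    · obtain ⟨m, rfl⟩ : ∃ k, m = k + 1 := ⟨m - 1, by omega⟩
      -- `Hom(Ω̃ V, Z) ⟶ Hom(Ω̃ V, ℧̃ Z)` is bijective iff `Hom(V, ℧̃ Z) ⟶ Hom(Ω̃ V, ℧̃ Z)` is, and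
      -- the latter may be tested after composition with the reflection `℧̃ Z ⟶ E`
      refine bijective_postcomp_comp (hrW (m + 1) (by omega) W)
        ((bijective_comp_cosyzDimShift_iff ((iter SyzShift m).obj W) Z).2 ?_)
      exact bijective_precomp_of_square (hrW m (by omega) W) (hrW (m + 1) (by omega) W)
        (bijective_syzShiftCounit_comp hE _)

/-- A complex `X` with terms of projective dimension at most `d` has a coreflection `Q ⟶ X` in the
complexes with projective terms, a composite of `d` connecting maps of syzygies, that is
inverted by `Hom(-, ℧̃ᵐ W)` for all `m ≥ d`. -/
lemma exists_coreflection_of_hasProjectiveDimensionLE (d : ℕ) : ∀ (X : CochainComplex C ℤ)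
    (_ : ∀ n, HasProjectiveDimensionLE (X.X n) d),
    ∃ (Q : HomotopyCategory C (ComplexShape.up ℤ)) (c : Q ⟶ (quot).obj X), projTerms C Q ∧
      (∀ Q', projTerms C Q' → Function.Bijective fun θ : Q' ⟶ Q => θ ≫ c) ∧
      ∀ m, d ≤ m → ∀ W, Function.Bijective
        fun φ : (quot).obj X ⟶ (iter CosyzShift m).obj W => c ≫ φ := by
  induction d with
  | zero =>
    intro X hX
    refine ⟨(quot).obj X, 𝟙 _, fun n => ?_, fun E' _ => ?_, fun m _ W => ?_⟩
    · exact projective_iff_hasProjectiveDimensionLT_one.2 (hX n)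
    · simpa using! Function.bijective_id
    · simpa using! Function.bijective_id
  | succ d ih =>
    intro X hX
    obtain ⟨Q, c, hQ, hc, hcW⟩ := ih (syz (X⟦(1 : ℤ)⟧))
      ((syzDimShift X).hasProjectiveDimensionLE (syzDimShift_projective X) d hX)
    refine ⟨Q, c ≫ (quot).map (syzDimShift X).e, hQ, fun Q' hQ' => ?_, fun m hm W => ?_⟩
    · exact bijective_postcomp_comp ((syzDimShift X).bijective_postcomp hQ') (hc Q' hQ')
    · obtain ⟨m, rfl⟩ : ∃ k, m = k + 1 := ⟨m - 1, by omega⟩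
      refine bijective_precomp_comp
        ((bijective_syzDimShift_comp_iff ((iter CosyzShift m).obj W) X).2 ?_)
        (hcW (m + 1) (by omega) W)
      exact bijective_postcomp_of_square (hcW m (by omega) W) (hcW (m + 1) (by omega) W)
        (bijective_comp_cosyzShiftUnit hQ _)

end Dimension

end HomotopyAdj

/-! ### Reflections in the complexes of injectives -/

namespace HomotopyAdj

section Pointwise

variable {K : Type u} [Category.{v} K] (P : ObjectProperty K)

lemma isRightAdjoint_ι_of_exists_reflection
    (h : ∀ X : K, ∃ (E : K) (r : X ⟶ E), P E ∧
      ∀ E', P E' → Function.Bijective fun θ : E ⟶ E' => r ≫ θ) : P.ι.IsRightAdjoint := by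
  choose E r hE hr using h
  exact (Adjunction.adjunctionOfEquivLeft (G := P.ι) (F_obj := fun X => ⟨E X, hE X⟩)
    (fun X Y => P.fullyFaithfulι.homEquiv.trans (Equiv.ofBijective _ (hr X Y.obj Y.property)))
    fun X Y Y' g h => (Category.assoc (r X) h.hom g.hom).symm).isRightAdjoint

lemma isLeftAdjoint_ι_of_exists_coreflection
    (h : ∀ X : K, ∃ (Q : K) (r : Q ⟶ X), P Q ∧
      ∀ Q', P Q' → Function.Bijective fun θ : Q' ⟶ Q => θ ≫ r) : P.ι.IsLeftAdjoint := by
  choose Q r hQ hr using h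
  exact (Adjunction.adjunctionOfEquivRight (F := P.ι) (G_obj := fun X => ⟨Q X, hQ X⟩)
    (fun Y X => (P.fullyFaithfulι.homEquiv.trans
      (Equiv.ofBijective _ (hr X Y.obj Y.property))).symm)
    fun X' X Y f g => by
      rw [Equiv.symm_apply_eq]
      change f.hom ≫ g = (f.hom ≫ _) ≫ r Y
      rw [Category.assoc]
      have e := (Equiv.ofBijective _ (hr Y X.obj X.property)).apply_symm_apply g
      exact congrArg (f.hom ≫ ·) e.symm).isLeftAdjoint

end Pointwise

section SmallObject

open MorphismProperty IsGrothendieckAbelian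

universe w

variable {C : Type u} [Category.{v} C] [Abelian C] [IsGrothendieckAbelian.{w} C]

/-- The small object argument applies to every set of monomorphisms in a Grothendieck abelian
category, because every object is small relative to monomorphisms. -/
lemma hasSmallObjectArgument_ofHoms_of_mono {ι : Type w} {A B : ι → C} (f : ∀ i, A i ⟶ B i)
    [∀ i, Mono (f i)] : HasSmallObjectArgument.{w} (ofHoms f) := by
  obtain ⟨κ, hκ', hκ⟩ := HasCardinalLT.exists_regular_cardinal_forall.{w}
    (fun i => Subobject (A i))
  have : Fact κ.IsRegular := ⟨hκ'⟩
  have : Nonempty κ.ord.ToType := by simpa using hκ'.ne_zero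
  have := WellFoundedLT.toOrderBot κ.ord.ToType
  exact ⟨κ, inferInstance, inferInstance,
    { preservesColimit {A B X Y} i hi f' hf := by
        let hf' : (monomorphisms C).TransfiniteCompositionOfShape κ.ord.ToType f' :=
          { toTransfiniteCompositionOfShape := hf.toTransfiniteCompositionOfShape
            map_mem j hj := by
              have := (hf.attachCells j hj).pushouts_coproducts
              simp only [ofHoms_homFamily] at this
              refine (?_ : _ ≤ monomorphisms C) _ this
              simp only [pushouts_le_iff, coproducts_le_iff, ofHoms_le_iff]
              exact fun i => inferInstanceAs (Mono (f i)) }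
        have (j j' : κ.ord.ToType) (φ : j ⟶ j') : Mono (hf'.F.map φ) := hf'.mem_map φ
        apply preservesColimit_coyoneda_obj_of_mono (Y := hf'.F) (κ := κ)
        obtain ⟨S⟩ := hi
        exact hκ S }⟩

/-- The factorization of a morphism given by the small object argument for a set of
monomorphisms. -/
lemma exists_factorization_of_mono {ι : Type w} {A B : ι → C} (f : ∀ i, A i ⟶ B i)
    [∀ i, Mono (f i)] {X Y : C} (g : X ⟶ Y) :
    ∃ (Z : C) (i : X ⟶ Z) (p : Z ⟶ Y), i ≫ p = g ∧ (ofHoms f).rlp.llp i ∧ (ofHoms f).rlp p := by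
  have := hasSmallObjectArgument_ofHoms_of_mono f
  let F := (functorialFactorizationData (ofHoms f).rlp.llp (ofHoms f).rlp).factorizationData g
  exact ⟨F.Z, F.i, F.p, F.fac, F.hi, F.hp⟩

end SmallObject

section Disc

open HomologicalComplex

variable {C : Type u} [Category.{v} C] [Abelian C]

lemma up_rel (n : ℤ) : (ComplexShape.up ℤ).Rel n (n + 1) := rfl

lemma ne_add_one (n : ℤ) : n ≠ n + 1 := by omega

/-- The complex `A = A` in degrees `n` and `n + 1`. -/
noncomputable abbrev disc (n : ℤ) (A : C) : CochainComplex C ℤ := double (𝟙 A) (up_rel n)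

/-- Morphisms out of the disc on `A` in degree `n` are morphisms out of `A` into the `n`-th
term. -/
noncomputable def discHomEquiv (n : ℤ) (A : C) (X : CochainComplex C ℤ) :
    (disc n A ⟶ X) ≃ (A ⟶ X.X n) :=
  (evalCompCoyonedaCorepresentableByDoubleId (up_rel n) (ne_add_one n) A).homEquiv

lemma discHomEquiv_comp (n : ℤ) (A : C) {X Y : CochainComplex C ℤ} (φ : disc n A ⟶ X)
    (g : X ⟶ Y) : discHomEquiv n A Y (φ ≫ g) = discHomEquiv n A X φ ≫ g.f n :=
  (evalCompCoyonedaCorepresentableByDoubleId (up_rel n) (ne_add_one n) A).homEquiv_comp g φ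

lemma discHomEquiv_apply (n : ℤ) (A : C) (X : CochainComplex C ℤ) (φ : disc n A ⟶ X) :
    discHomEquiv n A X φ = (doubleXIso₀ _ (up_rel n)).inv ≫ φ.f n := rfl

/-- The morphism of discs induced by a morphism. -/
noncomputable def discMap (n : ℤ) {A B : C} (i : A ⟶ B) : disc n A ⟶ disc n B :=
  (discHomEquiv n A _).symm (i ≫ (doubleXIso₀ _ (up_rel n)).inv)

lemma discHomEquiv_discMap_comp (n : ℤ) {A B : C} (i : A ⟶ B) {X : CochainComplex C ℤ}
    (φ : disc n B ⟶ X) :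
    discHomEquiv n A X (discMap n i ≫ φ) = i ≫ discHomEquiv n B X φ := by
  rw [discHomEquiv_comp, discMap, Equiv.apply_symm_apply, Category.assoc, discHomEquiv_apply]

instance (n : ℤ) {A B : C} (i : A ⟶ B) [Mono i] : Mono (discMap n i) := by
  have h₀ : (discMap n i).f n = (doubleXIso₀ _ (up_rel n)).hom ≫ i ≫
      (doubleXIso₀ _ (up_rel n)).inv := by
    rw [← Iso.inv_comp_eq, ← discHomEquiv_apply, discMap, Equiv.apply_symm_apply]
  have h₁ : (discMap n i).f (n + 1) = (doubleXIso₁ _ (up_rel n) (ne_add_one n)).hom ≫ i ≫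
      (doubleXIso₁ _ (up_rel n) (ne_add_one n)).inv := by
    have := (discMap n i).comm n (n + 1)
    rw [h₀, double_d _ _ (ne_add_one n), double_d _ _ (ne_add_one n)] at this
    simp only [Category.assoc, Iso.inv_hom_id_assoc, Category.id_comp, cancel_epi] at this
    rw [← Iso.inv_comp_eq, this]
  have m₀ : Mono ((discMap n i).f n) := by rw [h₀]; infer_instance
  have m₁ : Mono ((discMap n i).f (n + 1)) := by rw [h₁]; infer_instance
  refine ⟨fun g h e => to_double_hom_ext ?_ ?_⟩
  · rw [← cancel_mono ((discMap n i).f n), ← comp_f, ← comp_f, e]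
  · rw [← cancel_mono ((discMap n i).f (n + 1)), ← comp_f, ← comp_f, e]

lemma hasLiftingProperty_discMap_iff (n : ℤ) {A B : C} (i : A ⟶ B) {X Y : CochainComplex C ℤ}
    (p : X ⟶ Y) : HasLiftingProperty (discMap n i) p ↔ HasLiftingProperty i (p.f n) := by
  constructor
  · refine fun _ => ⟨fun {a b} sq => ?_⟩
    have sq' : CommSq ((discHomEquiv n A X).symm a) (discMap n i) p
        ((discHomEquiv n B Y).symm b) := ⟨by
      apply (discHomEquiv n A Y).injective
      rw [discHomEquiv_comp, discHomEquiv_discMap_comp, Equiv.apply_symm_apply,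
        Equiv.apply_symm_apply, sq.w]⟩
    refine ⟨⟨⟨discHomEquiv n B X sq'.lift, ?_, ?_⟩⟩⟩
    · rw [← discHomEquiv_discMap_comp, sq'.fac_left, Equiv.apply_symm_apply]
    · rw [← discHomEquiv_comp, sq'.fac_right, Equiv.apply_symm_apply]
  · refine fun _ => ⟨fun {a b} sq => ?_⟩
    have sq' : CommSq (discHomEquiv n A X a) i (p.f n) (discHomEquiv n B Y b) := ⟨by
      rw [← discHomEquiv_comp, ← discHomEquiv_discMap_comp, sq.w]⟩
    refine ⟨⟨⟨(discHomEquiv n B X).symm sq'.lift, ?_, ?_⟩⟩⟩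
    · apply (discHomEquiv n A X).injective
      rw [discHomEquiv_discMap_comp, Equiv.apply_symm_apply, sq'.fac_left]
    · apply (discHomEquiv n B Y).injective
      rw [discHomEquiv_comp, Equiv.apply_symm_apply, sq'.fac_right]

end Disc

section Injective

open MorphismProperty HomologicalComplex ZeroObject

universe w

variable {C : Type u} [Category.{v} C] [Abelian C]

/-- The path object `discs E.X ⟶ E` of a complex `E` with injective terms lifts against
monomorphisms in each degree. -/
lemma rlp_monomorphisms_discsDesc_id (E : CochainComplex C ℤ) (hE : ∀ n, Injective (E.X n))
    (n : ℤ) : (monomorphisms C).rlp ((discsDesc (fun n => E.X n) E fun _ => 𝟙 _).f n) := by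
  intro A B i (_ : Mono i)
  refine ⟨fun {a b} sq => ?_⟩
  have hsq : a ≫ biprod.desc (𝟙 _) (𝟙 _ ≫ E.d (n - 1) n) = i ≫ b := sq.w
  have := hE (n - 1)
  let w : B ⟶ E.X (n - 1) := Injective.factorThru (a ≫ biprod.snd) i
  have hw : i ≫ w = a ≫ biprod.snd := Injective.comp_factorThru _ _
  refine ⟨⟨⟨biprod.lift (b - w ≫ E.d (n - 1) n) w, ?_, ?_⟩⟩⟩
  · apply biprod.hom_ext
    · rw [biprod.desc_eq] at hsq
      simp only [Category.assoc, biprod.lift_fst, Preadditive.comp_sub, reassoc_of% hw, ← hsq]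
      simp
    · simp [hw]
  · simp [biprod.lift_desc]

/-- A null-homotopic morphism to `E` factors through the path object of `E`. -/
lemma exists_comp_discsDesc_id_of_homotopy {X E : CochainComplex C ℤ} {φ : X ⟶ E}
    (h : Homotopy φ 0) : ∃ k : X ⟶ discs (fun n => E.X n),
      k ≫ discsDesc (fun n => E.X n) E (fun _ => 𝟙 _) = φ := by
  refine ⟨discsLift _ X fun n => h.hom (n + 1) n, ?_⟩
  ext n
  have hn := h.comm n
  rw [dNext_eq _ (up_rel n), prevD_eq _ (show (ComplexShape.up ℤ).Rel (n - 1) n by simp)] at hn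
  have aux (m : ℤ) (hm : n = m + 1) : (X.XIsoOfEq hm).hom ≫ h.hom (m + 1) m = h.hom n m := by
    subst hm
    simp
  rw [hn, comp_f, biprod.lift_desc]
  simp [aux]

variable [IsGrothendieckAbelian.{w} C]

variable (C) in
/-- The discs on the subobjects of a generator form a set of monomorphisms of complexes which
detects the morphisms `p` such that every `p.f n` has the right lifting property with respect to
all monomorphisms, that is, is a split epimorphism with injective kernel. -/
lemma exists_family_discs : ∃ (ι : Type w) (A B : ι → CochainComplex C ℤ) (f : ∀ i, A i ⟶ B i),
    (∀ i, Mono (f i)) ∧ ∀ {X Y : CochainComplex C ℤ} (p : X ⟶ Y),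
      (ofHoms f).rlp p ↔ ∀ n, (monomorphisms C).rlp (p.f n) := by
  let G : C := separator C
  have hG := isSeparator_separator C
  let e := equivShrink.{w} (ℤ × Subobject G)
  refine ⟨Shrink.{w} (ℤ × Subobject G), _, _,
    fun i => discMap (e.symm i).1 (e.symm i).2.arrow, fun i => inferInstance, fun {X Y} p => ?_⟩
  have h (n : ℤ) : (monomorphisms C).rlp (p.f n) ↔
      ∀ S : Subobject G, HasLiftingProperty (discMap n S.arrow) p := by
    rw [← IsGrothendieckAbelian.generatingMonomorphisms_rlp hG]
    simp only [hasLiftingProperty_discMap_iff]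
    constructor
    · exact fun H S => H _ ⟨S⟩
    · rintro H _ _ _ ⟨S⟩
      exact H S
  simp only [h]
  constructor
  · intro H n S
    have := H _ (ofHoms.mk (e (n, S)))
    rwa [Equiv.symm_apply_apply] at this
  · rintro H _ _ _ ⟨i⟩
    exact H _ _

/-- Every complex `X` has a morphism to a complex `E` with injective terms which induces
bijections on homotopy classes of morphisms to complexes with injective terms. It is obtained
by factoring `X ⟶ 0`: the second factor makes the terms of `E` injective, and the first factor
lifts against `E' ⟶ 0` and against the path object of `E'`, which extends morphisms and
homotopies from `X` to `E`. -/
lemma exists_injective_reflection (X : CochainComplex C ℤ) :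
    ∃ (E : CochainComplex C ℤ) (r : X ⟶ E), (∀ n, Injective (E.X n)) ∧
      ∀ E' : CochainComplex C ℤ, (∀ n, Injective (E'.X n)) → Function.Bijective
        fun θ : (HomotopyCategory.quotient C (ComplexShape.up ℤ)).obj E ⟶
            (HomotopyCategory.quotient C (ComplexShape.up ℤ)).obj E' =>
          (HomotopyCategory.quotient C (ComplexShape.up ℤ)).map r ≫ θ := by
  obtain ⟨ι, A, B, f, _, hf⟩ := exists_family_discs.{v, u, w} C
  obtain ⟨E, r, p, -, hr, hp⟩ := exists_factorization_of_mono f (0 : X ⟶ 0)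
  rw [hf] at hp
  refine ⟨E, r, fun n => (injective_iff_rlp_monomorphisms_of_isZero (p.f n)
    ((eval C _ n).map_isZero (isZero_zero _))).2 (hp n), fun E' hE' => ⟨?_, ?_⟩⟩
  · intro θ θ' hθ
    obtain ⟨g, rfl⟩ := (HomotopyCategory.quotient _ _).map_surjective θ
    obtain ⟨g', rfl⟩ := (HomotopyCategory.quotient _ _).map_surjective θ'
    dsimp only at hθ
    rw [← Functor.map_comp, ← Functor.map_comp] at hθ
    obtain ⟨k, hk⟩ := exists_comp_discsDesc_id_of_homotopy
      (Homotopy.equivSubZero (HomotopyCategory.homotopyOfEq _ _ hθ))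
    have := hr _ ((hf _).2 (rlp_monomorphisms_discsDesc_id E' hE'))
    have sq : CommSq k r (discsDesc (fun n => E'.X n) E' fun _ => 𝟙 _) (g - g') :=
      ⟨by rw [hk, Preadditive.comp_sub]⟩
    refine HomotopyCategory.eq_of_homotopy _ _ (Homotopy.equivSubZero.symm ?_)
    exact (Homotopy.ofEq (by rw [Category.id_comp, sq.fac_right])).trans
      ((((discsContraction _).compRight _).compLeft sq.lift).trans (Homotopy.ofEq (by simp)))
  · intro θ
    obtain ⟨g, rfl⟩ := (HomotopyCategory.quotient _ _).map_surjective θ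
    have : (ofHoms f).rlp (0 : E' ⟶ 0) := (hf _).2 fun n =>
      (injective_iff_rlp_monomorphisms_of_isZero _ ((eval C _ n).map_isZero (isZero_zero _))).1
        (hE' n)
    have := hr _ this
    have sq : CommSq g r (0 : E' ⟶ 0) 0 := ⟨by simp⟩
    exact ⟨(HomotopyCategory.quotient C (ComplexShape.up ℤ)).map sq.lift, by
      dsimp only
      rw [← Functor.map_comp, sq.fac_left]⟩

variable (C) in
/-- The inclusion of the complexes with injective terms into the homotopy category of a
Grothendieck abelian category has a left adjoint. -/
lemma isRightAdjoint_ι_injTerms : (injTerms C).ι.IsRightAdjoint := by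
  refine isRightAdjoint_ι_of_exists_reflection _ fun X => ?_
  obtain ⟨E, r, hE, h⟩ := exists_injective_reflection.{v, u, w} X.as
  exact ⟨(HomotopyCategory.quotient _ _).obj E, (HomotopyCategory.quotient _ _).map r, hE,
    fun E' hE' => h E'.as hE'⟩

end Injective

end HomotopyAdj

/-! ### Null-homotopies on complexes of finitely generated free modules -/

namespace HomotopyAdj

section Null

variable {C : Type u} [Category.{v} C] [Abelian C]

/-- Null-homotopies in terms of families of morphisms between all terms; only those of degree `-1`
matter. -/
lemma nonempty_homotopy_zero_iff {X Y : CochainComplex C ℤ} (g : X ⟶ Y) :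
    Nonempty (Homotopy g 0) ↔ ∃ h : ∀ i j, X.X i ⟶ Y.X j, ∀ i n j, i + 1 = n → n + 1 = j →
      h n i ≫ Y.d i n + X.d n j ≫ h j n = g.f n := by
  constructor
  · rintro ⟨H⟩
    refine ⟨H.hom, fun i n j hi hj => ?_⟩
    have := H.comm n
    rw [dNext_eq _ (show (ComplexShape.up ℤ).Rel n j from hj),
      prevD_eq _ (show (ComplexShape.up ℤ).Rel i n from hi)] at this
    rw [this, HomologicalComplex.zero_f, add_zero, add_comm]
  · rintro ⟨h, hh⟩
    have : g = Homotopy.nullHomotopicMap h := by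
      ext n
      rw [Homotopy.nullHomotopicMap_f (show (ComplexShape.up ℤ).Rel (n - 1) n by simp)
        (show (ComplexShape.up ℤ).Rel n (n + 1) from rfl), ← hh (n - 1) n (n + 1) (by omega) rfl,
        add_comm]
    rw [this]
    exact nullHomotopicMap_null h

end Null

section Free

variable {S : Type u} [Ring S]

/-- A complex of finitely generated free modules, given by the ranks of its terms and by its
differentials. Such data form a type in the universe of the ring, so they can index the
generating set of a small object argument. -/
structure FreeComplexData (S : Type u) [Ring S] where
  /-- The ranks of the terms. -/
  rank : ℤ → ℕ
  /-- The differentials. -/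
  d : ∀ i j, ModuleCat.of S (Fin (rank i) →₀ S) ⟶ ModuleCat.of S (Fin (rank j) →₀ S)
  shape : ∀ i j, ¬ i + 1 = j → d i j = 0
  d_comp_d : ∀ i j k, d i j ≫ d j k = 0

/-- The complex of finitely generated free modules defined by the given data. -/
noncomputable abbrev FreeComplexData.complex (D : FreeComplexData S) :
    CochainComplex (ModuleCat.{u} S) ℤ where
  X n := ModuleCat.of S (Fin (D.rank n) →₀ S)
  d := D.d
  shape := D.shape
  d_comp_d' i j k _ _ := D.d_comp_d i j k

section Extension

variable {F K : CochainComplex (ModuleCat.{u} S) ℤ} {B : ℤ → Type u}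
  (b : ∀ n, Module.Basis (B n) S (F.X n))

/-- The basis elements occurring in the differential of a basis element. -/
def Occurs (x y : Σ n, B n) : Prop :=
  x.1 + 1 = y.1 ∧ y.2 ∈ ((b y.1).repr ((F.d x.1 y.1).hom (b x.1 x.2))).support

/-- The span of the basis elements of degree `n` which belong to `T`. -/
def spanOf (T : Set (Σ n, B n)) (n : ℤ) : Submodule S (F.X n) :=
  Submodule.span S (b n '' {x | ⟨n, x⟩ ∈ T})

/-- A set of basis elements is closed if it spans a subcomplex. -/
def IsClosedSet (T : Set (Σ n, B n)) : Prop := ∀ x ∈ T, ∀ y, Occurs b x y → y ∈ T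

variable {b}

lemma finite_occurs (x : Σ n, B n) : {y | Occurs b x y}.Finite := by
  refine Set.Finite.subset (((b (x.1 + 1)).repr ((F.d x.1 (x.1 + 1)).hom
    (b x.1 x.2))).support.finite_toSet.image (Sigma.mk (x.1 + 1))) ?_
  rintro ⟨m, y⟩ ⟨h, hy⟩
  obtain rfl : x.1 + 1 = m := h
  exact ⟨y, hy, rfl⟩

lemma IsClosedSet.d_mem_spanOf {T : Set (Σ n, B n)} (hT : IsClosedSet b T) {n m : ℤ}
    {z : F.X n} (hz : z ∈ spanOf b T n) : (F.d n m).hom z ∈ spanOf b T m := by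
  by_cases h : n + 1 = m
  · suffices spanOf b T n ≤ (spanOf b T m).comap (F.d n m).hom from this hz
    refine Submodule.span_le.2 ?_
    rintro _ ⟨x, hx, rfl⟩
    refine (Module.Basis.mem_span_image (b m)).2 fun y hy => ?_
    exact hT ⟨n, x⟩ hx ⟨m, y⟩ ⟨h, hy⟩
  · rw [F.shape n m h]
    exact Submodule.zero_mem _

/-- The smallest closed set containing a basis element is finite in each degree. -/
lemma exists_isClosedSet_finite (b : ∀ n, Module.Basis (B n) S (F.X n)) (x₀ : Σ n, B n) :
    ∃ T : Set (Σ n, B n), x₀ ∈ T ∧ IsClosedSet b T ∧ ∀ n, {x : B n | ⟨n, x⟩ ∈ T}.Finite := by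
  -- `D k` consists of the basis elements reached from `x₀` in `k` steps; these have degree
  -- `x₀.1 + k`, so each degree meets only one of these finite sets
  let D : ℕ → Set (Σ n, B n) := fun k => Nat.rec {x₀} (fun _ s => ⋃ x ∈ s, {y | Occurs b x y}) k
  have hD (k : ℕ) : (D k).Finite := by
    induction k with
    | zero => exact Set.finite_singleton _
    | succ k ih => exact ih.biUnion fun x _ => finite_occurs x
  have hdeg (k : ℕ) : ∀ x ∈ D k, x.1 = x₀.1 + k := by
    induction k with
    | zero =>
      intro x hx
      obtain rfl : x = x₀ := hx
      simp
    | succ k ih =>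
      intro y hy
      obtain ⟨x, hx, hxy⟩ := Set.mem_iUnion₂.1 hy
      have h1 := ih x hx
      have h2 := hxy.1
      push_cast
      omega
  refine ⟨⋃ k, D k, Set.mem_iUnion.2 ⟨0, rfl⟩, fun x hx y hxy => ?_, fun n => ?_⟩
  · obtain ⟨k, hk⟩ := Set.mem_iUnion.1 hx
    exact Set.mem_iUnion.2 ⟨k + 1, Set.mem_iUnion₂.2 ⟨x, hk, hxy⟩⟩
  · refine Set.Finite.of_finite_image (f := Sigma.mk n) ((hD (n - x₀.1).toNat).subset ?_)
      sigma_mk_injective.injOn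
    rintro _ ⟨x, hx, rfl⟩
    obtain ⟨k, hk⟩ := Set.mem_iUnion.1 hx
    have h1 := hdeg k _ hk
    obtain rfl : (n - x₀.1).toNat = k := by
      dsimp only at h1
      omega
    exact hk

/-- If `T` and `C` are closed and `C` is finite in each degree, then the basis elements in `C`
which are not in `T` span a complex of finitely generated free modules, namely the quotient of the
span of `C ∪ T` by the span of `T`. -/
lemma exists_freeComplexData_diff {T C : Set (Σ n, B n)} (hT : IsClosedSet b T)
    (hC : IsClosedSet b C) (hfin : ∀ n, {x : B n | ⟨n, x⟩ ∈ C}.Finite) :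
    ∃ (D : FreeComplexData S) (σ : ∀ n, D.complex.X n ⟶ F.X n) (τ : ∀ n, F.X n ⟶ D.complex.X n),
      (∀ n, σ n ≫ τ n = 𝟙 _) ∧ (∀ n m, D.complex.d n m = σ n ≫ F.d n m ≫ τ m) ∧
      (∀ n, ∀ z ∈ spanOf b T n, (τ n).hom z = 0) ∧
      (∀ n, ∀ z ∈ spanOf b C n, (τ n ≫ σ n).hom z - z ∈ spanOf b T n) ∧
      (∀ n s, (σ n).hom s ∈ spanOf b C n) ∧
      ∀ n x, ⟨n, x⟩ ∈ C → ⟨n, x⟩ ∉ T → (τ n ≫ σ n).hom (b n x) = b n x := by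
  classical
  let N : ∀ n, Set (B n) := fun n => {x | ⟨n, x⟩ ∈ C ∧ ⟨n, x⟩ ∉ T}
  have hN (n : ℤ) : Finite (N n) := ((hfin n).subset fun x hx => hx.1).to_subtype
  let e (n : ℤ) : N n ≃ Fin (Nat.card (N n)) := Finite.equivFin _
  let σ (n : ℤ) : ModuleCat.of S (Fin (Nat.card (N n)) →₀ S) ⟶ F.X n :=
    ModuleCat.ofHom (Finsupp.linearCombination S fun i => b n ((e n).symm i))
  let τ (n : ℤ) : F.X n ⟶ ModuleCat.of S (Fin (Nat.card (N n)) →₀ S) :=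
    ModuleCat.ofHom ((b n).constr ℕ fun x =>
      if hx : x ∈ N n then Finsupp.single (e n ⟨x, hx⟩) 1 else 0)
  have hσ (n i) : (σ n).hom (Finsupp.single i 1) = b n ((e n).symm i) :=
    (Finsupp.linearCombination_single S _ _).trans (one_smul _ _)
  have hτ (n : ℤ) (x : B n) (hx : x ∈ N n) :
      (τ n).hom (b n x) = Finsupp.single (e n ⟨x, hx⟩) 1 :=
    ((b n).constr_basis ℕ _ x).trans (dif_pos hx)
  have hτ' (n : ℤ) (x : B n) (hx : x ∉ N n) : (τ n).hom (b n x) = 0 :=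
    ((b n).constr_basis ℕ _ x).trans (dif_neg hx)
  have hστ (n) : σ n ≫ τ n = 𝟙 _ := by
    refine ModuleCat.hom_ext (Finsupp.lhom_ext' fun i => LinearMap.ext_ring ?_)
    change (τ n).hom ((σ n).hom (Finsupp.single i 1)) = Finsupp.single i 1
    rw [hσ, hτ n _ ((e n).symm i).2, Subtype.coe_eta, Equiv.apply_symm_apply]
  have hτσ (n) (x : B n) (hx : x ∈ N n) : (σ n).hom ((τ n).hom (b n x)) = b n x := by
    rw [hτ n x hx, hσ, Equiv.symm_apply_apply]
  have hτT (n) (z) (hz : z ∈ spanOf b T n) : (τ n).hom z = 0 := by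
    suffices spanOf b T n ≤ LinearMap.ker (τ n).hom from this hz
    refine Submodule.span_le.2 ?_
    rintro _ ⟨x, hx, rfl⟩
    exact hτ' n x fun h => h.2 hx
  have hτC (n) (z) (hz : z ∈ spanOf b C n) : (σ n).hom ((τ n).hom z) - z ∈ spanOf b T n := by
    suffices spanOf b C n ≤ (spanOf b T n).comap ((τ n ≫ σ n).hom - LinearMap.id) from this hz
    refine Submodule.span_le.2 ?_
    rintro _ ⟨x, hx, rfl⟩
    change (σ n).hom ((τ n).hom (b n x)) - b n x ∈ spanOf b T n
    by_cases hxT : ⟨n, x⟩ ∈ T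
    · have hxT' : b n x ∈ spanOf b T n := Submodule.subset_span ⟨x, hxT, rfl⟩
      rw [hτT n _ hxT', map_zero, zero_sub]
      exact Submodule.neg_mem _ hxT'
    · rw [hτσ n x ⟨hx, hxT⟩, sub_self]
      exact Submodule.zero_mem _
  have hσC (n s) : (σ n).hom s ∈ spanOf b C n := by
    suffices LinearMap.range (σ n).hom ≤ spanOf b C n from this ⟨s, rfl⟩
    refine (Finsupp.range_linearCombination S).trans_le (Submodule.span_le.2 ?_)
    rintro _ ⟨i, rfl⟩
    exact Submodule.subset_span ⟨_, ((e n).symm i).2.1, rfl⟩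
  refine ⟨⟨fun n => Nat.card (N n), fun n m => σ n ≫ F.d n m ≫ τ m, fun i j hij => ?_,
    fun i j k => ?_⟩, σ, τ, hστ, fun n m => rfl, hτT, hτC, hσC,
    fun n x h1 h2 => hτσ n x ⟨h1, h2⟩⟩
  · rw [F.shape i j hij, zero_comp, comp_zero]
  · ext1
    refine LinearMap.ext fun s => ?_
    change (τ k).hom ((F.d j k).hom ((σ j).hom ((τ j).hom ((F.d i j).hom ((σ i).hom s))))) = 0
    have h1 := hτT k _ (hT.d_mem_spanOf (m := k) (hτC j _ (hC.d_mem_spanOf (m := j) (hσC i s))))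
    rw [map_sub, map_sub, sub_eq_zero] at h1
    rw [h1]
    have h2 := ConcreteCategory.congr_hom (F.d_comp_d i j k) ((σ i).hom s)
    exact (congrArg _ h2).trans (map_zero _)

/-- A closed set `T` of basis elements can be enlarged by any basis element, together with a
partial null-homotopy of `g` on it. The difference of `g` and the given null-homotopic morphism
vanishes on the span of `T`, so near the new element it factors through the quotient by that span.
The quotient is a complex of finitely generated free modules, and a null-homotopy on it is the
required correction. -/
lemma exists_extension_null_homotopy
    (hK : ∀ (D : FreeComplexData S) (g : D.complex ⟶ K), Nonempty (Homotopy g 0))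
    (g : F ⟶ K) {T : Set (Σ n, B n)} (hT : IsClosedSet b T) (h : ∀ i j, F.X i ⟶ K.X j)
    (hh : ∀ i n j, i + 1 = n → n + 1 = j → ∀ x : B n, ⟨n, x⟩ ∈ T →
      (h n i ≫ K.d i n + F.d n j ≫ h j n).hom (b n x) = (g.f n).hom (b n x)) (x₀ : Σ n, B n) :
    ∃ (T' : Set (Σ n, B n)) (h' : ∀ i j, F.X i ⟶ K.X j), T ⊆ T' ∧ x₀ ∈ T' ∧ IsClosedSet b T' ∧
      (∀ i j, ∀ x : B i, ⟨i, x⟩ ∈ T → (h' i j).hom (b i x) = (h i j).hom (b i x)) ∧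
      ∀ i n j, i + 1 = n → n + 1 = j → ∀ x : B n, ⟨n, x⟩ ∈ T' →
        (h' n i ≫ K.d i n + F.d n j ≫ h' j n).hom (b n x) = (g.f n).hom (b n x) := by
  obtain ⟨C, hx₀, hC, hfin⟩ := exists_isClosedSet_finite b x₀
  obtain ⟨D, σ, τ, hστ, hd, hτT, hτC, hσC, hτσ⟩ := exists_freeComplexData_diff hT hC hfin
  -- `G` is what remains of `g` after subtracting the part contracted by `h`; it vanishes on `T`
  let G : F ⟶ K := g - Homotopy.nullHomotopicMap h
  have hG (i n j : ℤ) (hi : i + 1 = n) (hj : n + 1 = j) :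
      h n i ≫ K.d i n + F.d n j ≫ h j n = g.f n - G.f n := by
    rw [HomologicalComplex.sub_f_apply, Homotopy.nullHomotopicMap_f
      (show (ComplexShape.up ℤ).Rel i n from hi) (show (ComplexShape.up ℤ).Rel n j from hj)]
    abel
  have hGT (n) (z) (hz : z ∈ spanOf b T n) : (G.f n).hom z = 0 := by
    suffices spanOf b T n ≤ LinearMap.ker (G.f n).hom from this hz
    refine Submodule.span_le.2 ?_
    rintro _ ⟨x, hx, rfl⟩
    have := hh (n - 1) n (n + 1) (by omega) rfl x hx
    rw [hG _ _ _ (by omega) rfl] at this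
    exact sub_eq_self.1 this
  let ψ : D.complex ⟶ K :=
    { f := fun n => σ n ≫ G.f n
      comm' := fun n m _ => by
        rw [hd, Category.assoc, G.comm]
        simp only [Category.assoc]
        ext1
        refine LinearMap.ext fun s => ?_
        change (G.f m).hom ((F.d n m).hom ((σ n).hom s)) = (G.f m).hom
          ((σ m).hom ((τ m).hom ((F.d n m).hom ((σ n).hom s))))
        have := hGT m _ (hτC m _ (hC.d_mem_spanOf (m := m) (hσC n s)))
        rw [map_sub, sub_eq_zero] at this
        exact this.symm }
  obtain ⟨k, hk⟩ := (nonempty_homotopy_zero_iff ψ).1 (hK D ψ)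
  have hT' (n) (z) (hz : z ∈ spanOf b T n) (m) : ((τ n ≫ k n m).hom z) = 0 := by
    change (k n m).hom ((τ n).hom z) = 0
    rw [hτT n z hz, map_zero]
  refine ⟨T ∪ C, fun i j => h i j + τ i ≫ k i j, Set.subset_union_left, Or.inr hx₀, ?_, ?_, ?_⟩
  · rintro x (hx | hx) y hxy
    · exact Or.inl (hT x hx y hxy)
    · exact Or.inr (hC x hx y hxy)
  · intro i j x hx
    change (h i j).hom (b i x) + (τ i ≫ k i j).hom (b i x) = _
    rw [hT' i _ (Submodule.subset_span ⟨x, hx, rfl⟩), add_zero]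
  · intro i n j hi hj x hx
    have key : (h n i + τ n ≫ k n i) ≫ K.d i n + F.d n j ≫ (h j n + τ j ≫ k j n) =
        (h n i ≫ K.d i n + F.d n j ≫ h j n) +
          (τ n ≫ k n i ≫ K.d i n + F.d n j ≫ τ j ≫ k j n) := by
      simp only [Preadditive.add_comp, Preadditive.comp_add, Category.assoc]
      abel
    rw [key]
    by_cases hxT : ⟨n, x⟩ ∈ T
    · have hx' : b n x ∈ spanOf b T n := Submodule.subset_span ⟨x, hxT, rfl⟩
      change (h n i ≫ K.d i n + F.d n j ≫ h j n).hom (b n x) + ((K.d i n).hom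
        ((τ n ≫ k n i).hom (b n x)) + (τ j ≫ k j n).hom ((F.d n j).hom (b n x))) = _
      rw [hh i n j hi hj x hxT, hT' _ _ hx', hT' _ _ (hT.d_mem_spanOf hx'), map_zero, add_zero,
        add_zero]
    · have hxC : ⟨n, x⟩ ∈ C := hx.resolve_left hxT
      have h1 : (σ n).hom ((τ n).hom (b n x)) = b n x := hτσ n x hxC hxT
      have h2 := ConcreteCategory.congr_hom (hk i n j hi hj) ((τ n).hom (b n x))
      rw [hG i n j hi hj]
      have h3 : (ψ.f n).hom ((τ n).hom (b n x)) = (G.f n).hom (b n x) :=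
        congrArg (G.f n).hom h1
      have h4 : (D.complex.d n j).hom ((τ n).hom (b n x)) =
          (τ j).hom ((F.d n j).hom (b n x)) := by
        rw [hd]
        exact congrArg (fun z => (τ j).hom ((F.d n j).hom z)) h1
      have h5 : (K.d i n).hom ((k n i).hom ((τ n).hom (b n x))) + (k j n).hom
          ((D.complex.d n j).hom ((τ n).hom (b n x))) = (ψ.f n).hom ((τ n).hom (b n x)) := h2
      rw [h3, h4] at h5
      change (g.f n).hom (b n x) - (G.f n).hom (b n x) + ((K.d i n).hom ((k n i).hom
        ((τ n).hom (b n x))) + (k j n).hom ((τ j).hom ((F.d n j).hom (b n x)))) = _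
      rw [h5, sub_add_cancel]

end Extension

end Free

end HomotopyAdj

/-! ### Null-homotopies on complexes of projectives -/

namespace HomotopyAdj

variable {S : Type u} [Ring S]

/-- If every morphism to `K` from a complex of finitely generated free modules is null-homotopic,
then so is every morphism from a complex of free modules. -/
lemma nonempty_homotopy_zero_of_basis {F K : CochainComplex (ModuleCat.{u} S) ℤ} {B : ℤ → Type u}
    (b : ∀ n, Module.Basis (B n) S (F.X n))
    (hK : ∀ (D : FreeComplexData S) (g : D.complex ⟶ K), Nonempty (Homotopy g 0)) (g : F ⟶ K) :
    Nonempty (Homotopy g 0) := by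
  classical
  -- Zorn's lemma is applied to the null-homotopies of `g` on closed sets of basis elements
  let α := {p : Set (Σ n, B n) × ∀ i j, F.X i ⟶ K.X j // IsClosedSet b p.1 ∧
    ∀ i n j, i + 1 = n → n + 1 = j → ∀ x : B n, ⟨n, x⟩ ∈ p.1 →
      (p.2 n i ≫ K.d i n + F.d n j ≫ p.2 j n).hom (b n x) = (g.f n).hom (b n x)}
  let r : α → α → Prop := fun p q => p.1.1 ⊆ q.1.1 ∧ ∀ i j, ∀ x : B i, ⟨i, x⟩ ∈ p.1.1 →
    (q.1.2 i j).hom (b i x) = (p.1.2 i j).hom (b i x)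
  have hr {p q s : α} (h₁ : r p q) (h₂ : r q s) : r p s :=
    ⟨h₁.1.trans h₂.1, fun i j x hx => (h₂.2 i j x (h₁.1 hx)).trans (h₁.2 i j x hx)⟩
  obtain ⟨m, hm⟩ : ∃ m : α, ∀ a, r m a → r a m := by
    refine exists_maximal_of_chains_bounded (fun c hc => ?_) hr
    let T : Set (Σ n, B n) := {x | ∃ p ∈ c, x ∈ p.1.1}
    let h : ∀ i j, F.X i ⟶ K.X j := fun i j => ModuleCat.ofHom ((b i).constr ℕ fun x =>
      if hx : ∃ p ∈ c, ⟨i, x⟩ ∈ p.1.1 then (hx.choose.1.2 i j).hom (b i x) else 0)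
    have hp (p) (hp : p ∈ c) (i j) (x : B i) (hx : ⟨i, x⟩ ∈ p.1.1) :
        (h i j).hom (b i x) = (p.1.2 i j).hom (b i x) := by
      have hx' : ∃ p ∈ c, ⟨i, x⟩ ∈ p.1.1 := ⟨p, hp, hx⟩
      refine ((b i).constr_basis ℕ _ x).trans ((dif_pos hx').trans ?_)
      obtain ⟨hq, hxq⟩ := hx'.choose_spec
      by_cases e : p = hx'.choose
      · rw [← e]
      · obtain h | h := hc hp hq e
        · exact h.2 i j x hx
        · exact (h.2 i j x hxq).symm
    have hspan (p) (hpc : p ∈ c) (i j) (z) (hz : z ∈ spanOf b p.1.1 i) :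
        (h i j).hom z = (p.1.2 i j).hom z := by
      suffices spanOf b p.1.1 i ≤ LinearMap.eqLocus (h i j).hom (p.1.2 i j).hom from this hz
      refine Submodule.span_le.2 ?_
      rintro _ ⟨x, hx, rfl⟩
      exact hp p hpc i j x hx
    refine ⟨⟨⟨T, h⟩, ?_, ?_⟩, fun p hpc => ⟨fun x hx => ⟨p, hpc, hx⟩, hp p hpc⟩⟩
    · rintro x ⟨p, hpc, hx⟩ y hxy
      exact ⟨p, hpc, p.2.1 x hx y hxy⟩
    · rintro i n j hi hj x ⟨p, hpc, hx⟩
      have hx' : b n x ∈ spanOf b p.1.1 n := Submodule.subset_span ⟨x, hx, rfl⟩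
      refine Eq.trans ?_ (p.2.2 i n j hi hj x hx)
      change (K.d i n).hom ((h n i).hom (b n x)) + (h j n).hom ((F.d n j).hom (b n x)) =
        (K.d i n).hom ((p.1.2 n i).hom (b n x)) + (p.1.2 j n).hom ((F.d n j).hom (b n x))
      rw [hspan p hpc _ _ _ hx', hspan p hpc _ _ _ (p.2.1.d_mem_spanOf hx')]
  refine (nonempty_homotopy_zero_iff g).2 ⟨m.1.2, fun i n j hi hj => ?_⟩
  refine ModuleCat.hom_ext ((b n).ext fun x => m.2.2 i n j hi hj x ?_)
  obtain ⟨T', h', hT, hx, hT', hh', hg⟩ :=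
    exists_extension_null_homotopy hK g m.2.1 m.1.2 m.2.2 ⟨n, x⟩
  exact (hm ⟨⟨T', h'⟩, hT', hg⟩ ⟨hT, hh'⟩).1 hx

/-- A complex of projectives is a retract of a complex of free modules. -/
lemma exists_retract_of_projective (Q : CochainComplex (ModuleCat.{u} S) ℤ)
    (hQ : ∀ n, Projective (Q.X n)) :
    ∃ (F : CochainComplex (ModuleCat.{u} S) ℤ) (B : ℤ → Type u)
      (_ : ∀ n, Module.Basis (B n) S (F.X n)) (s : Q ⟶ F) (p : F ⟶ Q), s ≫ p = 𝟙 Q := by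
  let p (n : ℤ) : ModuleCat.of S (Q.X n →₀ S) ⟶ Q.X n :=
    ModuleCat.ofHom (Finsupp.linearCombination S id)
  have hp (n) : Epi (p n) := by
    rw [ModuleCat.epi_iff_surjective]
    exact fun x => ⟨Finsupp.single x 1, (Finsupp.linearCombination_single S _ _).trans
      (one_smul _ _)⟩
  let s (n : ℤ) : Q.X n ⟶ ModuleCat.of S (Q.X n →₀ S) := Projective.factorThru (𝟙 _) (p n)
  have hs (n) : s n ≫ p n = 𝟙 _ := Projective.factorThru_comp _ _
  have hs' (n) {Z} (z : _ ⟶ Z) : s n ≫ p n ≫ z = z := by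
    rw [← Category.assoc, hs, Category.id_comp]
  let F : CochainComplex (ModuleCat.{u} S) ℤ :=
    { X := fun n => ModuleCat.of S (Q.X n →₀ S)
      d := fun n m => p n ≫ Q.d n m ≫ s m
      shape := fun n m h => by rw [Q.shape n m h, zero_comp, comp_zero]
      d_comp_d' := fun n m k _ _ => by simp [hs'] }
  refine ⟨F, fun n => Q.X n, fun n => Module.Basis.ofRepr (LinearEquiv.refl S _),
    { f := s, comm' := fun n m _ => ?_ }, { f := p, comm' := fun n m _ => ?_ }, ?_⟩
  · exact hs' n (Q.d n m ≫ s m)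
  · change p n ≫ Q.d n m = (p n ≫ Q.d n m ≫ s m) ≫ p m
    simp [hs]
  · ext1 n
    exact hs n

lemma nonempty_homotopy_zero_of_projective {Q K : CochainComplex (ModuleCat.{u} S) ℤ}
    (hQ : ∀ n, Projective (Q.X n))
    (hK : ∀ (D : FreeComplexData S) (g : D.complex ⟶ K), Nonempty (Homotopy g 0)) (g : Q ⟶ K) :
    Nonempty (Homotopy g 0) := by
  obtain ⟨F, B, b, s, p, h⟩ := exists_retract_of_projective Q hQ
  obtain ⟨H⟩ := nonempty_homotopy_zero_of_basis b hK (p ≫ g)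
  exact ⟨(Homotopy.ofEq (by rw [reassoc_of% h])).trans ((H.compLeft s).trans
    (Homotopy.ofEq comp_zero))⟩

end HomotopyAdj

/-! ### Coreflections in the complexes of projectives -/

namespace HomotopyAdj

section Coreflection

open CochainComplex HomComplex

variable {C : Type u} [Category.{v} C] [Abelian C]

local notation "quot" => HomotopyCategory.quotient C (ComplexShape.up ℤ)

lemma exists_cochain_comp_ofHom_eq {Q P X : CochainComplex C ℤ} (hQ : ∀ n, Projective (Q.X n))
    (p : P ⟶ X) (hp : ∀ n, Epi (p.f n)) {n : ℤ} (z : Cochain Q X n) :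
    ∃ z' : Cochain Q P n, z'.comp (Cochain.ofHom p) (add_zero n) = z := by
  refine ⟨Cochain.mk fun i j hij => Projective.factorThru (z.v i j hij) (p.f j), ?_⟩
  ext i j hij
  rw [Cochain.comp_zero_cochain_v, Cochain.ofHom_v, Cochain.mk_v, Projective.factorThru_comp]

lemma exists_cochain_comp_ofHom_eq_of_exact {Q : CochainComplex C ℤ}
    {E : ShortComplex (CochainComplex C ℤ)} (hE : E.ShortExact) {n : ℤ} (z : Cochain Q E.X₂ n)
    (hz : z.comp (Cochain.ofHom E.g) (add_zero n) = 0) :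
    ∃ w : Cochain Q E.X₁ n, w.comp (Cochain.ofHom E.f) (add_zero n) = z := by
  have h (i j : ℤ) (hij : i + n = j) : z.v i j hij ≫ E.g.f j = 0 := by
    have := Cochain.congr_v hz i j hij
    rwa [Cochain.comp_zero_cochain_v, Cochain.ofHom_v, Cochain.zero_v] at this
  have hmono (j : ℤ) : Mono (E.map (HomologicalComplex.eval C _ j)).f := (hE.map_eval j).mono_f
  have hl (i j : ℤ) (hij : i + n = j) : ∃ l : Q.X i ⟶ E.X₁.X j, l ≫ E.f.f j = z.v i j hij :=
    ⟨(hE.map_eval j).exact.lift (z.v i j hij) (h i j hij), (hE.map_eval j).exact.lift_f _ _⟩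
  choose l hl using hl
  refine ⟨Cochain.mk l, ?_⟩
  ext i j hij
  rw [Cochain.comp_zero_cochain_v, Cochain.ofHom_v, Cochain.mk_v, hl]

lemma cochain_eq_of_comp_ofHom_eq {Q K P : CochainComplex C ℤ} (f : K ⟶ P)
    (hf : ∀ n, Mono (f.f n)) {n : ℤ} {z z' : Cochain Q K n}
    (h : z.comp (Cochain.ofHom f) (add_zero n) = z'.comp (Cochain.ofHom f) (add_zero n)) :
    z = z' := by
  ext i j hij
  have := Cochain.congr_v h i j hij
  rwa [Cochain.comp_zero_cochain_v, Cochain.ofHom_v, Cochain.comp_zero_cochain_v,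
    Cochain.ofHom_v, cancel_mono] at this

/-- If every morphism to `K` from a complex of projectives is null-homotopic, then every cocycle
of degree one with values in `K` on a complex of projectives is a coboundary. -/
lemma exists_δ_eq_of_homotopy_zero {Q K : CochainComplex C ℤ} (hQ : ∀ n, Projective (Q.X n))
    (hK : ∀ Q' : CochainComplex C ℤ, (∀ n, Projective (Q'.X n)) →
      ∀ g : Q' ⟶ K, Nonempty (Homotopy g 0))
    (w : Cochain Q K 1) (hw : δ 1 2 w = 0) : ∃ y : Cochain Q K 0, δ 0 1 y = w := by
  obtain ⟨g, hg⟩ := exists_ofHom_eq (w.leftShift (-1) 0 (by norm_num))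
    (by rw [Cochain.δ_leftShift _ (-1) 0 1 (by norm_num) 2 (by norm_num), hw,
      Cochain.leftShift_zero, smul_zero])
  obtain ⟨H⟩ := hK (Q⟦(-1 : ℤ)⟧) (fun n => hQ (n + -1)) g
  obtain ⟨h, hh⟩ := (quotient_map_eq_zero_iff_cochain g).1
    ((HomotopyCategory.eq_of_homotopy _ _ H).trans (Functor.map_zero _ _ _))
  let y : Cochain Q K 0 := h.leftUnshift 0 (by norm_num)
  have hy : y.leftShift (-1) (-1) (by norm_num) = h := Cochain.leftShift_leftUnshift _ _ _
  have hy' : (δ 0 1 y).leftShift (-1) 0 (by norm_num) =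
      -(w.leftShift (-1) 0 (by norm_num)) := by
    have := Cochain.δ_leftShift y (-1) (-1) 0 (by norm_num) 1 (by norm_num)
    rw [hy, ← hh, hg] at this
    rw [this]
    simp
  refine ⟨-y, ?_⟩
  apply (Cochain.leftShiftAddEquiv Q K 1 (-1) 0 (by norm_num)).injective
  have h0 : (1 : ℤ) + -1 = 0 := by norm_num
  change (δ 0 1 (-y)).leftShift (-1) 0 h0 = w.leftShift (-1) 0 h0
  rw [δ_neg, Cochain.leftShift_neg, hy', neg_neg]

/-- A degreewise surjection whose kernel receives only null-homotopic morphisms from complexes with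
projective terms is inverted by `Hom(Q, -)` for all such complexes `Q`. -/
lemma bijective_comp_quotient_map {E : ShortComplex (CochainComplex C ℤ)} (hE : E.ShortExact)
    (hK : ∀ Q : CochainComplex C ℤ, (∀ n, Projective (Q.X n)) →
      ∀ g : Q ⟶ E.X₁, Nonempty (Homotopy g 0))
    {Q : CochainComplex C ℤ} (hQ : ∀ n, Projective (Q.X n)) :
    Function.Bijective fun θ : (quot).obj Q ⟶ (quot).obj E.X₂ => θ ≫ (quot).map E.g := by
  have hf (n : ℤ) : Mono (E.f.f n) := (hE.map_eval n).mono_f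
  have hg (n : ℤ) : Epi (E.g.f n) := (hE.map_eval n).epi_g
  constructor
  · refine (injective_iff_map_eq_zero (Preadditive.rightComp _ ((quot).map E.g))).2 fun θ hθ => ?_
    obtain ⟨a, rfl⟩ := (quot).map_surjective θ
    change (quot).map a ≫ (quot).map E.g = 0 at hθ
    rw [← Functor.map_comp, quotient_map_eq_zero_iff_cochain] at hθ
    obtain ⟨h, hh⟩ := hθ
    obtain ⟨h', rfl⟩ := exists_cochain_comp_ofHom_eq hQ E.g hg h
    rw [δ_comp_ofHom, Cochain.ofHom_comp] at hh
    obtain ⟨w, hw⟩ := exists_cochain_comp_ofHom_eq_of_exact hE (Cochain.ofHom a - δ (-1) 0 h')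
      (by rw [Cochain.sub_comp, hh, sub_self])
    obtain ⟨b, rfl⟩ := exists_ofHom_eq w (by
      apply cochain_eq_of_comp_ofHom_eq E.f hf
      rw [← δ_comp_ofHom, hw, δ_sub, δ_ofHom, δ_δ, sub_zero, Cochain.zero_comp])
    obtain ⟨H⟩ := hK Q hQ b
    obtain ⟨k, hk⟩ := (quotient_map_eq_zero_iff_cochain b).1
      ((HomotopyCategory.eq_of_homotopy _ _ H).trans (Functor.map_zero _ _ _))
    rw [quotient_map_eq_zero_iff_cochain]
    refine ⟨h' + k.comp (Cochain.ofHom E.f) (add_zero _), ?_⟩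
    rw [δ_add, δ_comp_ofHom, ← hk, hw, add_sub_cancel]
  · intro θ
    obtain ⟨a, rfl⟩ := (quot).map_surjective θ
    obtain ⟨z, hz⟩ := exists_cochain_comp_ofHom_eq hQ E.g hg (Cochain.ofHom a)
    obtain ⟨w, hw⟩ := exists_cochain_comp_ofHom_eq_of_exact hE (δ 0 1 z)
      (by rw [← δ_comp_ofHom, hz, δ_ofHom])
    obtain ⟨y, rfl⟩ := exists_δ_eq_of_homotopy_zero hQ hK w (by
      apply cochain_eq_of_comp_ofHom_eq E.f hf
      rw [← δ_comp_ofHom, hw]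
      simp [δ_δ])
    obtain ⟨c, hc⟩ := exists_ofHom_eq (z - y.comp (Cochain.ofHom E.f) (add_zero _))
      (by rw [δ_sub, δ_comp_ofHom, hw, sub_self])
    refine ⟨(quot).map c, ?_⟩
    dsimp only
    rw [← Functor.map_comp]
    congr 1
    apply (Cochain.ofHom_injective)
    rw [Cochain.ofHom_comp, hc, Cochain.sub_comp, hz, Cochain.comp_assoc_of_third_is_zero_cochain,
      ← Cochain.ofHom_comp, E.zero]
    simp

end Coreflection

section Cover

open MorphismProperty HomologicalComplex ZeroObject

section

variable {C : Type u} [Category.{v} C] [Abelian C]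

/-- The embedding `X ⟶ C(X)` of a complex into a contractible complex. -/
noncomputable abbrev toDiscs (X : CochainComplex C ℤ) : X ⟶ discs (fun n => X.X (n + 1)) :=
  discsLift _ X fun n => 𝟙 (X.X (n + 1))

lemma toDiscs_f_snd (X : CochainComplex C ℤ) (n : ℤ) :
    (toDiscs X).f n ≫ (biprod.snd : X.X (n + 1) ⊞ X.X (n - 1 + 1) ⟶ _) =
      (X.XIsoOfEq (show n = n - 1 + 1 by omega)).hom := by
  simp

instance (X : CochainComplex C ℤ) : Mono (toDiscs X) := by
  have (n : ℤ) : Mono ((toDiscs X).f n) := by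
    have := mono_of_mono_fac (toDiscs_f_snd X n)
    exact this
  exact mono_of_mono_f _ inferInstance

/-- In each degree, `X ⟶ C(X)` is a split monomorphism with cokernel a term of `X`. -/
lemma toDiscs_f_llp (X : CochainComplex C ℤ) (hX : ∀ n, Projective (X.X n)) (n : ℤ) :
    (epimorphisms C).llp ((toDiscs X).f n) := by
  intro M N e (_ : Epi e)
  refine ⟨fun {a b} sq => ?_⟩
  have hsq : a ≫ e = biprod.lift (X.d n (n + 1) ≫ 𝟙 _)
      ((X.XIsoOfEq (show n = n - 1 + 1 by omega)).hom ≫ 𝟙 _) ≫ b := sq.w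
  have := hX (n + 1)
  let u : X.X (n + 1) ⟶ M := Projective.factorThru (biprod.inl ≫ b) e
  have hu : u ≫ e = biprod.inl ≫ b := Projective.factorThru_comp _ _
  refine ⟨⟨⟨biprod.desc u ((X.XIsoOfEq (show n = n - 1 + 1 by omega)).inv ≫
    (a - X.d n (n + 1) ≫ u)), ?_, ?_⟩⟩⟩
  · refine biprod.lift_desc.trans ?_
    simp
  · apply biprod.hom_ext'
    · rw [biprod.inl_desc_assoc, hu]
    · rw [biprod.inr_desc_assoc, Category.assoc, Iso.inv_comp_eq, Preadditive.sub_comp,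
        Category.assoc, hu, hsq, biprod.lift_eq]
      simp

/-- The morphism of contractible complexes induced by a family of morphisms. -/
noncomputable abbrev discsMap {M N : ℤ → C} (e : ∀ n, M n ⟶ N n) : discs M ⟶ discs N :=
  discsDesc M (discs N) fun n => e n ≫ biprod.inl

lemma discsMap_f {M N : ℤ → C} (e : ∀ n, M n ⟶ N n) (n : ℤ) :
    (discsMap e).f n = biprod.map (e n) (e (n - 1)) := by
  change biprod.desc (e n ≫ biprod.inl) ((e (n - 1) ≫ biprod.inl) ≫ (discs N).d (n - 1) n) = _
  rw [discs_d N _ _ (show n - 1 + 1 = n by omega)]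
  apply biprod.hom_ext' <;> simp

/-- Morphisms into `discs N` are families of morphisms into the `N n`, so lifting against
`discsMap e` reduces to lifting against each `e n`. -/
lemma hasLiftingProperty_discsMap {A B : CochainComplex C ℤ} (i : A ⟶ B)
    (hi : ∀ n, (epimorphisms C).llp (i.f n)) {M N : ℤ → C} (e : ∀ n, M n ⟶ N n)
    (he : ∀ n, Epi (e n)) : HasLiftingProperty i (discsMap e) := by
  have hsnd (n : ℤ) : (discsMap e).f n ≫ (biprod.snd : N n ⊞ N (n - 1) ⟶ _) =
      (biprod.snd : M n ⊞ M (n - 1) ⟶ _) ≫ e (n - 1) := by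
    rw [discsMap_f, biprod.map_snd]
  refine ⟨fun {a b} sq => ?_⟩
  have hsq (n : ℤ) : CommSq (a.f n ≫ (biprod.snd : M n ⊞ M (n - 1) ⟶ _)) (i.f n) (e (n - 1))
      (b.f n ≫ (biprod.snd : N n ⊞ N (n - 1) ⟶ _)) := ⟨by
    rw [Category.assoc, ← hsnd, ← Category.assoc, ← Category.assoc, ← comp_f, sq.w, comp_f]⟩
  have (n : ℤ) : HasLiftingProperty (i.f n) (e (n - 1)) := hi n _ (he _)
  let l (n : ℤ) : B.X n ⟶ M (n - 1) := (hsq n).lift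
  let L : B ⟶ discs M := discsLift M B fun n => l (n + 1) ≫ eqToHom (by rw [add_sub_cancel_right])
  have hL (n : ℤ) : L.f n ≫ (biprod.snd : M n ⊞ M (n - 1) ⟶ _) = l n := by
    have aux (m : ℤ) (hm : n = m + 1) : (B.XIsoOfEq hm).hom ≫ l (m + 1) ≫
        eqToHom (congrArg M (show m + 1 - 1 = m by omega)) =
          l n ≫ eqToHom (congrArg M (show n - 1 = m by omega)) := by
      subst hm
      simp
    refine (biprod.lift_snd _ _).trans ((aux (n - 1) (by omega)).trans ?_)
    simp
  refine ⟨⟨⟨L, ?_, ?_⟩⟩⟩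
  · apply discs_hom_ext_to
    intro n
    rw [comp_f, Category.assoc, hL, (hsq n).fac_left]
  · apply discs_hom_ext_to
    intro n
    rw [comp_f, Category.assoc, hsnd, ← Category.assoc, hL, (hsq n).fac_right]

/-- Lifting against `0 ⟶ D^n(A)` means lifting morphisms from `A` in degree `n`. -/
lemma hasLiftingProperty_zero_disc (n : ℤ) (A : C) {X Y Z : CochainComplex C ℤ} (hZ : IsZero Z)
    (i : Z ⟶ disc n A) (q : X ⟶ Y) :
    HasLiftingProperty i q ↔ ∀ y : A ⟶ Y.X n, ∃ x, x ≫ q.f n = y := by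
  constructor
  · intro h y
    have sq : CommSq (0 : Z ⟶ X) i q ((discHomEquiv n A Y).symm y) := ⟨hZ.eq_of_src _ _⟩
    exact ⟨discHomEquiv n A X sq.lift, by
      rw [← discHomEquiv_comp, sq.fac_right, Equiv.apply_symm_apply]⟩
  · refine fun h => ⟨fun {a b} sq => ?_⟩
    obtain ⟨x, hx⟩ := h (discHomEquiv n A Y b)
    refine ⟨⟨⟨(discHomEquiv n A X).symm x, hZ.eq_of_src _ _, ?_⟩⟩⟩
    apply (discHomEquiv n A Y).injective
    rw [discHomEquiv_comp, Equiv.apply_symm_apply, hx]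

end

section

variable (S : Type u) [Ring S]

/-- The morphisms `0 ⟶ D^n(S)` and `X ⟶ C(X)` for the complexes `X` of finitely generated free
modules. -/
noncomputable def generatingFamily : ∀ i : ℤ ⊕ FreeComplexData S,
    (Sum.elim (fun _ => 0) (fun D => D.complex) i : CochainComplex (ModuleCat.{u} S) ℤ) ⟶
      Sum.elim (fun n => disc n (ModuleCat.of S S))
        (fun D => discs fun n => D.complex.X (n + 1)) i
  | Sum.inl _ => 0
  | Sum.inr D => toDiscs D.complex

instance (i) : Mono (generatingFamily S i) := by
  rcases i with n | D
  · exact (isZero_zero _).mono _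
  · exact inferInstanceAs (Mono (toDiscs D.complex))

variable {S}

/-- Every complex `X` receives a surjection `p` from a complex of projectives such that all
morphisms from complexes of finitely generated free modules to the kernel of `p` are
null-homotopic. It is obtained by factoring `0 ⟶ X`: lifting against `0 ⟶ D^n(S)` makes `p`
surjective, and lifting against `Y ⟶ C(Y)` extends each morphism from `Y` to the kernel of `p` to
the contractible complex `C(Y)`. -/
lemma exists_projective_cover (X : CochainComplex (ModuleCat.{u} S) ℤ) :
    ∃ (P : CochainComplex (ModuleCat.{u} S) ℤ) (p : P ⟶ X), (∀ n, Projective (P.X n)) ∧ Epi p ∧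
      ∀ (D : FreeComplexData S) (g : D.complex ⟶ kernel p), Nonempty (Homotopy g 0) := by
  obtain ⟨P, i, p, -, hi, hp⟩ := exists_factorization_of_mono (generatingFamily S) (0 : 0 ⟶ X)
  have hp' (j) : HasLiftingProperty (generatingFamily S j) p := hp _ (ofHoms.mk j)
  refine ⟨P, p, fun n => ?_, ?_, fun D g => ?_⟩
  · -- `P ⟶ C(P)` lifts along a degreewise surjection onto `C(P)` from a contractible complex of
    -- projectives, which makes each term of `P` a retract of a projective
    let π (n : ℤ) := Projective.π (P.X (n + 1))
    have : (ofHoms (generatingFamily S)).rlp (discsMap π) := by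
      rintro _ _ _ ⟨n | D⟩
      · refine (hasLiftingProperty_zero_disc n (ModuleCat.of S S) (isZero_zero _) _ _).2
          fun y => ?_
        have : Epi ((discsMap π).f n) := by
          rw [discsMap_f]
          infer_instance
        have : Projective (ModuleCat.of S S) :=
          (IsProjective.iff_projective S).1 inferInstance
        exact ⟨_, Projective.factorThru_comp y ((discsMap π).f n)⟩
      · exact hasLiftingProperty_discsMap _ (toDiscs_f_llp _ fun n =>
          (IsProjective.iff_projective (Fin (D.rank n) →₀ S)).1 inferInstance) _ inferInstance
    have := hi _ this
    have sq : CommSq 0 i (discsMap π) (toDiscs P) := ⟨(isZero_zero _).eq_of_src _ _⟩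
    have h := congrArg (fun k => k.f n ≫ (biprod.snd : P.X (n + 1) ⊞ P.X (n - 1 + 1) ⟶ _))
      sq.fac_right
    dsimp only at h
    rw [toDiscs_f_snd, comp_f, discsMap_f, Category.assoc, biprod.map_snd] at h
    have r : Retract (P.X n) (Projective.over (P.X (n - 1 + 1))) :=
      { i := sq.lift.f n ≫ biprod.snd
        r := π (n - 1) ≫ (P.XIsoOfEq (show n = n - 1 + 1 by omega)).inv
        retract := by rw [← Category.assoc, Iso.comp_inv_eq, Category.assoc, h, Category.id_comp] }
    exact r.projective
  · have (n : ℤ) : Epi (p.f n) := by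
      rw [ModuleCat.epi_iff_surjective]
      intro x
      obtain ⟨y, hy⟩ := (hasLiftingProperty_zero_disc n (ModuleCat.of S S) (isZero_zero _) _ p).1
        (hp' (Sum.inl n)) (ModuleCat.ofHom (LinearMap.toSpanSingleton S _ x))
      refine ⟨y.hom 1, (ConcreteCategory.congr_hom hy (1 : S)).trans (one_smul _ _)⟩
    exact epi_of_epi_f _ inferInstance
  · have sq : CommSq (g ≫ kernel.ι p) (toDiscs D.complex) p 0 := ⟨by simp⟩
    have := hp' (Sum.inr D)
    have : HasLiftingProperty (toDiscs D.complex) p := this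
    have hl : toDiscs D.complex ≫ kernel.lift p sq.lift sq.fac_right = g := by
      rw [← cancel_mono (kernel.ι p), Category.assoc, kernel.lift_ι, sq.fac_left]
    exact ⟨(Homotopy.ofEq (by rw [Category.id_comp, hl])).trans
      ((((discsContraction _).compRight _).compLeft (toDiscs D.complex)).trans
        (Homotopy.ofEq (by simp)))⟩

variable (S) in
/-- The inclusion of the complexes of projectives into the homotopy category of modules has a
right adjoint. -/
lemma isLeftAdjoint_ι_projTerms : (projTerms (ModuleCat.{u} S)).ι.IsLeftAdjoint := by
  refine isLeftAdjoint_ι_of_exists_coreflection _ fun X => ?_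
  obtain ⟨P, p, hP, _, hp⟩ := exists_projective_cover X.as
  let E : ShortComplex (CochainComplex (ModuleCat.{u} S) ℤ) :=
    ShortComplex.mk (kernel.ι p) p (kernel.condition p)
  have hE : E.ShortExact :=
    { exact := ShortComplex.exact_of_f_is_kernel _ (kernelIsKernel p)
      mono_f := inferInstanceAs (Mono (kernel.ι p))
      epi_g := inferInstanceAs (Epi p) }
  exact ⟨(HomotopyCategory.quotient _ _).obj P, (HomotopyCategory.quotient _ _).map p, hP,
    fun Q hQ => bijective_comp_quotient_map hE
      (fun Q' hQ' g => nonempty_homotopy_zero_of_projective hQ' hp g) hQ⟩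

end

end Cover

end HomotopyAdj

/-! ### Homological dimensions of restricted modules -/

namespace HomotopyAdj

section Finsupp

variable {S : Type u} [Ring S] (I : Type u)

/-- The short exact sequence of finitely supported families in a short exact sequence. -/
lemma exists_shortExact_finsupp {E : ShortComplex (ModuleCat.{u} S)} (hE : E.ShortExact) :
    ∃ (f : ModuleCat.of S (I →₀ E.X₁) ⟶ ModuleCat.of S (I →₀ E.X₂))
      (g : ModuleCat.of S (I →₀ E.X₂) ⟶ ModuleCat.of S (I →₀ E.X₃)) (w : f ≫ g = 0),
      (ShortComplex.mk f g w).ShortExact := by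
  have hf : Function.Injective E.f.hom := (ModuleCat.mono_iff_injective _).1 hE.mono_f
  have hg : Function.Surjective E.g.hom := (ModuleCat.epi_iff_surjective _).1 hE.epi_g
  have hfg := E.moduleCat_exact_iff.1 hE.exact
  have hw (x) : E.g.hom (E.f.hom x) = 0 := ConcreteCategory.congr_hom E.zero x
  refine ⟨ModuleCat.ofHom (Finsupp.mapRange.linearMap E.f.hom),
    ModuleCat.ofHom (Finsupp.mapRange.linearMap E.g.hom), ?_, ?_⟩
  · refine ModuleCat.hom_ext (LinearMap.ext fun x => Finsupp.ext fun i => ?_)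
    exact hw (x i)
  · refine { exact := ?_, mono_f := ?_, epi_g := ?_ }
    · rw [ShortComplex.moduleCat_exact_iff]
      intro (x : I →₀ E.X₂) hx
      have hx' (i : I) : E.g.hom (x i) = 0 := DFunLike.congr_fun hx i
      choose k hk using fun i => hfg (x i) (hx' i)
      refine ⟨Finsupp.onFinset x.support k fun i hi => ?_, ?_⟩
      · rw [Finsupp.mem_support_iff]
        intro h
        apply hi
        apply hf
        rw [map_zero]
        exact (hk i).trans h
      · exact Finsupp.ext fun i => hk i
    · rw [ModuleCat.mono_iff_injective]
      exact Finsupp.mapRange_injective _ (map_zero _) hf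
    · rw [ModuleCat.epi_iff_surjective]
      exact Finsupp.mapRange_surjective _ (map_zero _) hg

lemma projective_finsupp (M : ModuleCat.{u} S) [Projective M] :
    Projective (ModuleCat.of S (I →₀ M)) := by
  classical
  have : Module.Projective S M := (IsProjective.iff_projective M).2 inferInstance
  exact (IsProjective.iff_projective (I →₀ M)).1
    (Module.Projective.of_equiv (finsuppLequivDFinsupp (ι := I) (M := M) S).symm)

/-- Direct sums of copies of a module do not increase the projective dimension. -/
lemma hasProjectiveDimensionLE_finsupp (d : ℕ) (M : ModuleCat.{u} S)
    (hM : HasProjectiveDimensionLE M d) :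
    HasProjectiveDimensionLE (ModuleCat.of S (I →₀ M)) d := by
  induction d generalizing M with
  | zero =>
    have : Projective M := (projective_iff_hasProjectiveDimensionLE_zero _).2 hM
    rw [← projective_iff_hasProjectiveDimensionLE_zero]
    exact projective_finsupp I M
  | succ d ih =>
    let E : ShortComplex (ModuleCat.{u} S) :=
      ShortComplex.mk (kernel.ι (Projective.π M)) (Projective.π M) (kernel.condition _)
    have hE : E.ShortExact :=
      { exact := ShortComplex.exact_of_f_is_kernel _ (kernelIsKernel _)
        mono_f := inferInstanceAs (Mono (kernel.ι _))
        epi_g := inferInstanceAs (Epi (Projective.π M)) }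
    have h₂ : Projective E.X₂ := inferInstanceAs (Projective (Projective.over M))
    obtain ⟨f, g, w, h⟩ := exists_shortExact_finsupp I hE
    have : Projective (ModuleCat.of S (I →₀ E.X₂)) :=
      projective_finsupp I _
    exact (h.hasProjectiveDimensionLT_X₃_iff d this).2
      (ih _ ((hE.hasProjectiveDimensionLT_X₃_iff d h₂).1 hM))

end Finsupp

section CharacterModule

/-- The character module of a left `R`-module, as a right `R`-module. -/
def RightCharacterModule (R : Type u) [Ring R] (A : Type u) [AddCommGroup A] [Module R A] :
    Type u := A →+ AddCircle (1 : ℚ)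

namespace RightCharacterModule

variable {R : Type u} [Ring R] {A : Type u} [AddCommGroup A] [Module R A]

noncomputable instance : AddCommGroup (RightCharacterModule R A) :=
  inferInstanceAs (AddCommGroup (A →+ AddCircle (1 : ℚ)))

instance : FunLike (RightCharacterModule R A) A (AddCircle (1 : ℚ)) :=
  inferInstanceAs (FunLike (A →+ AddCircle (1 : ℚ)) A (AddCircle (1 : ℚ)))

instance : AddMonoidHomClass (RightCharacterModule R A) A (AddCircle (1 : ℚ)) :=
  inferInstanceAs (AddMonoidHomClass (A →+ AddCircle (1 : ℚ)) A (AddCircle (1 : ℚ)))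

@[ext]
lemma ext {c c' : RightCharacterModule R A} (h : ∀ x, c x = c' x) : c = c' := DFunLike.ext _ _ h

lemma add_apply (c c' : RightCharacterModule R A) (x : A) : (c + c') x = c x + c' x := rfl

lemma zero_apply (x : A) : (0 : RightCharacterModule R A) x = 0 := rfl

noncomputable instance : Module Rᵐᵒᵖ (RightCharacterModule R A) where
  smul r c := AddMonoidHom.comp (show A →+ AddCircle (1 : ℚ) from c)
    (DistribSMul.toAddMonoidHom A r.unop)
  one_smul c := ext fun x => congrArg c (one_smul R x)
  mul_smul r s c := ext fun x => congrArg c (mul_smul s.unop r.unop x)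
  smul_zero _ := rfl
  smul_add _ _ _ := rfl
  add_smul r s c := ext fun x => (congrArg c (add_smul r.unop s.unop x)).trans (map_add c _ _)
  zero_smul c := ext fun x => (congrArg c (zero_smul R x)).trans (map_zero c)

lemma smul_apply (r : Rᵐᵒᵖ) (c : RightCharacterModule R A) (x : A) :
    (r • c) x = c (r.unop • x) := rfl

variable {B : Type u} [AddCommGroup B] [Module R B]

/-- The linear map of character modules given by precomposition. -/
noncomputable def dual (g : A →ₗ[R] B) :
    RightCharacterModule R B →ₗ[Rᵐᵒᵖ] RightCharacterModule R A where
  toFun c := AddMonoidHom.comp (show B →+ AddCircle (1 : ℚ) from c) g.toAddMonoidHom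
  map_add' _ _ := rfl
  map_smul' r c := ext fun x => congrArg c (g.map_smul r.unop x).symm

lemma dual_surjective (g : A →ₗ[R] B) (hg : Function.Injective g) :
    Function.Surjective (dual g) :=
  CharacterModule.dual_surjective_of_injective (R := ℤ) (g.restrictScalars ℤ) hg

variable {I : Type u}

lemma ext_single {c c' : RightCharacterModule R (I →₀ R)}
    (h : ∀ i l, c (Finsupp.single i l) = c' (Finsupp.single i l)) : c = c' :=
  Finsupp.addHom_ext h

section

variable {Y : Type u} [AddCommGroup Y] [Module Rᵐᵒᵖ Y] (c : I → Y →+ AddCircle (1 : ℚ))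

/-- The character of a free left module which maps `l` times the `i`-th basis vector to
`c i (y l)`. -/
noncomputable def ofFamilyApply (y : Y) : RightCharacterModule R (I →₀ R) :=
  Finsupp.liftAddHom fun i => (c i).comp
    { toFun := fun l : R => MulOpposite.op l • y
      map_zero' := by simp
      map_add' := by simp [add_smul] }

lemma ofFamilyApply_single (y : Y) (i : I) (l : R) :
    ofFamilyApply c y (Finsupp.single i l) = c i (MulOpposite.op l • y) :=
  Finsupp.liftAddHom_apply_single _ _ _

/-- The linear map from a right module `Y` to the character module of a free left module given by
a family of characters of `Y`. -/
noncomputable def ofFamily : Y →ₗ[Rᵐᵒᵖ] RightCharacterModule R (I →₀ R) where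
  toFun := ofFamilyApply c
  map_add' y z := ext_single fun i l => by
    rw [add_apply, ofFamilyApply_single, ofFamilyApply_single, ofFamilyApply_single, smul_add,
      map_add]
  map_smul' r y := ext_single fun i l => by
    rw [RingHom.id_apply, smul_apply, Finsupp.smul_single, ofFamilyApply_single,
      ofFamilyApply_single, smul_smul]
    rfl

lemma ofFamily_single (y : Y) (i : I) (l : R) :
    ofFamily c y (Finsupp.single i l) = c i (MulOpposite.op l • y) :=
  ofFamilyApply_single c y i l

end

/-- Every right module embeds into the character module of a free left module. -/
lemma ofFamily_injective (Y : Type u) [AddCommGroup Y] [Module Rᵐᵒᵖ Y] :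
    Function.Injective (ofFamily (R := R) fun c : Y →+ AddCircle (1 : ℚ) => c) := by
  refine (injective_iff_map_eq_zero _).2 fun y hy => ?_
  refine CharacterModule.eq_zero_of_character_apply fun c => ?_
  have := ofFamily_single (R := R) (fun c : Y →+ AddCircle (1 : ℚ) => c) y c 1
  rw [hy, zero_apply, MulOpposite.op_one, one_smul] at this
  exact this.symm

/-- The character module of a free left module is injective. -/
lemma injective_finsupp (I : Type u) :
    Injective (ModuleCat.of Rᵐᵒᵖ (RightCharacterModule R (I →₀ R))) where
  factors {X Y} φ g _ := by
    have hg : Function.Injective g.hom := (ModuleCat.mono_iff_injective g).1 inferInstance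
    -- a linear map to the character module of a free module is a family of characters of `X`,
    -- and these extend to `Y`
    have h (i : I) : ∃ c : Y →+ AddCircle (1 : ℚ), ∀ x : X,
        c (g.hom x) = (φ.hom x : RightCharacterModule R (I →₀ R)) (Finsupp.single i 1) := by
      obtain ⟨c, hc⟩ := CharacterModule.dual_surjective_of_injective (R := ℤ)
        (g.hom.toAddMonoidHom.toIntLinearMap) hg
        { toFun := fun x => (φ.hom x : RightCharacterModule R (I →₀ R)) (Finsupp.single i 1)
          map_zero' := by rw [map_zero]; rfl
          map_add' := fun x y => by rw [map_add]; rfl }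
      exact ⟨c, fun x => DFunLike.congr_fun hc x⟩
    choose c hc using h
    refine ⟨ModuleCat.ofHom (ofFamily c), ?_⟩
    refine ModuleCat.hom_ext (LinearMap.ext fun x => ext_single fun i l => ?_)
    refine (ofFamily_single c _ i l).trans ?_
    refine (congrArg (c i) (map_smul g.hom _ x).symm).trans ((hc i _).trans ?_)
    rw [map_smul]
    refine (smul_apply (MulOpposite.op l) (φ.hom x : RightCharacterModule R (I →₀ R)) _).trans ?_
    rw [Finsupp.smul_single, MulOpposite.unop_op, smul_eq_mul, mul_one]

variable (R) in
/-- The character module of a projective left module is injective. -/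
lemma injective_of_projective (P : ModuleCat.{u} R) [Projective P] :
    Injective (ModuleCat.of Rᵐᵒᵖ (RightCharacterModule R P)) := by
  have : Module.Projective R P := (IsProjective.iff_projective P).2 inferInstance
  obtain ⟨s, hs⟩ := Module.projective_def'.1 this
  have := injective_finsupp (R := R) P
  have r : Retract (ModuleCat.of Rᵐᵒᵖ (RightCharacterModule R P))
      (ModuleCat.of Rᵐᵒᵖ (RightCharacterModule R (P →₀ R))) :=
    { i := ModuleCat.ofHom (dual (Finsupp.linearCombination R id))
      r := ModuleCat.ofHom (dual s)
      retract := ModuleCat.hom_ext (LinearMap.ext fun c => ext fun x =>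
        congrArg c (LinearMap.congr_fun hs x)) }
  exact r.injective

/-- Character modules turn projective resolutions of a left module into injective resolutions. -/
lemma hasInjectiveDimensionLE (d : ℕ) (L : ModuleCat.{u} R) (hL : HasProjectiveDimensionLE L d) :
    HasInjectiveDimensionLE (ModuleCat.of Rᵐᵒᵖ (RightCharacterModule R L)) d := by
  induction d generalizing L with
  | zero =>
    have : Projective L := (projective_iff_hasProjectiveDimensionLE_zero _).2 hL
    exact injective_iff_hasInjectiveDimensionLT_one.1 (injective_of_projective R L)
  | succ d ih =>
    let E : ShortComplex (ModuleCat.{u} R) :=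
      ShortComplex.mk (kernel.ι (Projective.π L)) (Projective.π L) (kernel.condition _)
    have hE : E.ShortExact :=
      { exact := ShortComplex.exact_of_f_is_kernel _ (kernelIsKernel _)
        mono_f := inferInstanceAs (Mono (kernel.ι _))
        epi_g := inferInstanceAs (Epi (Projective.π L)) }
    have h₂ : Projective E.X₂ := inferInstanceAs (Projective (Projective.over L))
    have hf : Function.Injective E.f.hom := (ModuleCat.mono_iff_injective _).1 hE.mono_f
    have hg : Function.Surjective E.g.hom := (ModuleCat.epi_iff_surjective _).1 hE.epi_g
    have hw (x) : E.g.hom (E.f.hom x) = 0 := ConcreteCategory.congr_hom E.zero x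
    have hfg := E.moduleCat_exact_iff.1 hE.exact
    let E' : ShortComplex (ModuleCat.{u} Rᵐᵒᵖ) :=
      ShortComplex.mk (ModuleCat.ofHom (dual E.g.hom)) (ModuleCat.ofHom (dual E.f.hom))
        (ModuleCat.hom_ext (LinearMap.ext fun (c : RightCharacterModule R E.X₃) =>
          ext (R := R) fun x => (congrArg c (hw x)).trans (map_zero c)))
    have hE' : E'.ShortExact :=
      { exact := by
          rw [ShortComplex.moduleCat_exact_iff]
          intro (c : RightCharacterModule R E.X₂) hc
          have hle : E.g.hom.toAddMonoidHom.ker ≤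
              AddMonoidHom.ker (show E.X₂ →+ AddCircle (1 : ℚ) from c) := by
            intro x hx
            obtain ⟨y, rfl⟩ := hfg x hx
            exact DFunLike.congr_fun (F := RightCharacterModule R E.X₁) hc y
          refine ⟨(E.g.hom.toAddMonoidHom.liftOfSurjective hg ⟨_, hle⟩ :
            E.X₃ →+ AddCircle (1 : ℚ)), ext fun x => ?_⟩
          exact E.g.hom.toAddMonoidHom.liftOfRightInverse_comp_apply _
            (Function.rightInverse_surjInv hg) ⟨_, hle⟩ x
        mono_f := by
          rw [ModuleCat.mono_iff_injective]
          intro c c' hcc'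
          refine ext (R := R) fun x => ?_
          obtain ⟨y, rfl⟩ := hg x
          exact DFunLike.congr_fun (F := RightCharacterModule R E.X₂) hcc' y
        epi_g := by
          rw [ModuleCat.epi_iff_surjective]
          exact dual_surjective _ hf }
    have : Injective E'.X₂ := injective_of_projective R E.X₂
    exact (hE'.hasInjectiveDimensionLT_X₃_iff d this).1
      (ih _ ((hE.hasProjectiveDimensionLT_X₃_iff d h₂).1 hL))

end RightCharacterModule

end CharacterModule

section Restriction

variable {Λ Γ : Type u} [Ring Λ] [Ring Γ] (f : Λ →+* Γ)

/-- The projective dimension of the restriction of a projective module is bounded by the projective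
dimension of the restriction of the ring, since a projective module is a direct summand of a direct sum
of copies of the ring. -/
lemma hasProjectiveDimensionLE_res (d : ℕ) (h : HasProjectiveDimensionLE (rightMod f) d)
    (X : ModR Γ) [Projective X] : HasProjectiveDimensionLE ((res f).obj X) d := by
  let p : ModuleCat.of Γᵐᵒᵖ (X →₀ Γ) ⟶ X := ModuleCat.ofHom (Finsupp.lsum ℕ fun x : X =>
    ({ toFun := fun g : Γ => MulOpposite.op g • x
       map_add' := fun g g' => by rw [MulOpposite.op_add, add_smul]
       map_smul' := fun r g => by
        rw [RingHom.id_apply, smul_smul]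
        rfl } : Γ →ₗ[Γᵐᵒᵖ] X))
  have hp (x : X) (g : Γ) : p.hom (Finsupp.single x g) = MulOpposite.op g • x :=
    Finsupp.lsum_single _ _ _ _
  have : Epi p := by
    rw [ModuleCat.epi_iff_surjective]
    exact fun x => ⟨Finsupp.single x 1, (hp x 1).trans (one_smul _ x)⟩
  have r : Retract X (ModuleCat.of Γᵐᵒᵖ (X →₀ Γ)) :=
    { i := Projective.factorThru (𝟙 X) p
      r := p
      retract := Projective.factorThru_comp _ _ }
  have e : (res f).obj (ModuleCat.of Γᵐᵒᵖ (X →₀ Γ)) ≅ ModuleCat.of Λᵐᵒᵖ (X →₀ rightMod f) :=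
    LinearEquiv.toModuleIso (X₁ := (res f).obj (ModuleCat.of Γᵐᵒᵖ (X →₀ Γ)))
      ({ AddEquiv.refl (X →₀ Γ) with map_smul' := fun _ _ => rfl } :
        (res f).obj (ModuleCat.of Γᵐᵒᵖ (X →₀ Γ)) ≃ₗ[Λᵐᵒᵖ] (X →₀ rightMod f))
  have := hasProjectiveDimensionLE_finsupp X d _ h
  exact ((r.map (res f)).trans e.retract).hasProjectiveDimensionLT (d + 1)

/-- The injective dimension of the restriction of an injective module is bounded by the projective
dimension of `Γ` as a left `Λ`-module: every injective right `Γ`-module is a direct summand of the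
character module of a free left `Γ`-module. -/
lemma hasInjectiveDimensionLE_res (d : ℕ) (h : HasProjectiveDimensionLE (leftMod f) d)
    (Y : ModR Γ) [Injective Y] : HasInjectiveDimensionLE ((res f).obj Y) d := by
  let I := Y →+ AddCircle (1 : ℚ)
  let j : Y ⟶ ModuleCat.of Γᵐᵒᵖ (RightCharacterModule Γ (I →₀ Γ)) :=
    ModuleCat.ofHom (RightCharacterModule.ofFamily (R := Γ) fun c : I => c)
  have : Mono j := (ModuleCat.mono_iff_injective j).2
    (RightCharacterModule.ofFamily_injective (R := Γ) Y)
  have r : Retract Y (ModuleCat.of Γᵐᵒᵖ (RightCharacterModule Γ (I →₀ Γ))) :=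
    { i := j
      r := Injective.factorThru (𝟙 Y) j
      retract := Injective.comp_factorThru _ _ }
  have e : (res f).obj (ModuleCat.of Γᵐᵒᵖ (RightCharacterModule Γ (I →₀ Γ))) ≅
      ModuleCat.of Λᵐᵒᵖ (RightCharacterModule Λ (I →₀ leftMod f)) :=
    LinearEquiv.toModuleIso
      (X₁ := (res f).obj (ModuleCat.of Γᵐᵒᵖ (RightCharacterModule Γ (I →₀ Γ))))
      ({ AddEquiv.refl ((I →₀ Γ) →+ AddCircle (1 : ℚ)) with map_smul' := fun _ _ => rfl } :
        (res f).obj (ModuleCat.of Γᵐᵒᵖ (RightCharacterModule Γ (I →₀ Γ))) ≃ₗ[Λᵐᵒᵖ]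
          RightCharacterModule Λ (I →₀ leftMod f))
  have := RightCharacterModule.hasInjectiveDimensionLE d _
    (hasProjectiveDimensionLE_finsupp I d _ h)
  exact ((r.map (res f)).trans e.retract).hasInjectiveDimensionLT (d + 1)

end Restriction

end HomotopyAdj

/-! ### The adjoint triples -/

namespace HomotopyAdj

section MapHomotopyCategory

variable {C D : Type*} [Category* C] [Category* D] [Preadditive C] [Preadditive D]
  {F : C ⥤ D} {G : D ⥤ C} [F.Additive] [G.Additive]

/-- An adjunction between additive functors induces an adjunction between homotopy categories. -/
noncomputable def _root_.CategoryTheory.Adjunction.mapHomotopyCategory (adj : F ⊣ G) {ι : Type*}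
    (c : ComplexShape ι) : F.mapHomotopyCategory c ⊣ G.mapHomotopyCategory c where
  unit :=
    { app := fun X => (HomotopyCategory.quotient C c).map
        { f := fun i => adj.unit.app (X.as.X i)
          comm' := fun i j _ => (adj.unit.naturality (X.as.d i j)).symm }
      naturality := fun X Y φ => by
        obtain ⟨φ, rfl⟩ := (HomotopyCategory.quotient C c).map_surjective φ
        refine ((HomotopyCategory.quotient C c).map_comp _ _).symm.trans
          (Eq.trans ?_ ((HomotopyCategory.quotient C c).map_comp _
            ((G.mapHomologicalComplex c).map ((F.mapHomologicalComplex c).map φ))))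
        congr 1
        ext i
        exact adj.unit.naturality (φ.f i) }
  counit :=
    { app := fun X => (HomotopyCategory.quotient D c).map
        { f := fun i => adj.counit.app (X.as.X i)
          comm' := fun i j _ => (adj.counit.naturality (X.as.d i j)).symm }
      naturality := fun X Y φ => by
        obtain ⟨φ, rfl⟩ := (HomotopyCategory.quotient D c).map_surjective φ
        refine ((HomotopyCategory.quotient D c).map_comp
          ((F.mapHomologicalComplex c).map ((G.mapHomologicalComplex c).map φ)) _).symm.trans
          (Eq.trans ?_ ((HomotopyCategory.quotient D c).map_comp _ _))
        congr 1
        ext i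
        exact adj.counit.naturality (φ.f i) }
  left_triangle_components X := by
    refine ((HomotopyCategory.quotient D c).map_comp _ _).symm.trans
      (Eq.trans ?_ ((HomotopyCategory.quotient D c).map_id _))
    congr 1
    ext i
    exact adj.left_triangle_components (X.as.X i)
  right_triangle_components X := by
    refine ((HomotopyCategory.quotient C c).map_comp _ _).symm.trans
      (Eq.trans ?_ ((HomotopyCategory.quotient C c).map_id _))
    congr 1
    ext i
    exact adj.right_triangle_components (X.as.X i)

end MapHomotopyCategory

section Reflection

variable {K : Type u} [Category.{v} K] {P : ObjectProperty K}

/-- Up to isomorphism, a reflection of `Z` is the unit of a reflector. -/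
lemma bijective_comp_unit_of_reflection {lam : K ⥤ P.FullSubcategory} (adj : lam ⊣ P.ι) {Z E : K}
    (r : Z ⟶ E) (hE : P E) (hr : ∀ E', P E' → Function.Bijective fun θ : E ⟶ E' => r ≫ θ) {V : K}
    (h : Function.Bijective fun φ : V ⟶ Z => φ ≫ r) :
    Function.Bijective fun φ : V ⟶ Z => φ ≫ adj.unit.app Z := by
  obtain ⟨a, ha⟩ := (hr _ (lam.obj Z).property).2 (adj.unit.app Z)
  let b : lam.obj Z ⟶ ⟨E, hE⟩ := (adj.homEquiv Z ⟨E, hE⟩).symm r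
  have hb : adj.unit.app Z ≫ b.hom = r :=
    (adj.homEquiv_unit _ _ _).symm.trans ((adj.homEquiv Z ⟨E, hE⟩).apply_symm_apply r)
  have hab : a ≫ b.hom = 𝟙 E := (hr E hE).1 (by
    dsimp only at ha ⊢
    rw [reassoc_of% ha, hb, Category.comp_id])
  have hba : b.hom ≫ a = 𝟙 (lam.obj Z).obj := by
    have : b ≫ (P.fullyFaithfulι.preimage a : (⟨E, hE⟩ : P.FullSubcategory) ⟶ lam.obj Z) =
        𝟙 (lam.obj Z) := by
      apply (adj.homEquiv Z _).injective
      rw [adj.homEquiv_unit, adj.homEquiv_unit]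
      change adj.unit.app Z ≫ b.hom ≫ a = adj.unit.app Z ≫ 𝟙 _
      rw [reassoc_of% hb]
      exact ha.trans (Category.comp_id _).symm
    exact congrArg (P.ι.map ·) this
  have e : Function.Bijective fun φ : V ⟶ E => φ ≫ a :=
    ⟨fun φ ψ h => by simpa [hab] using congrArg (· ≫ b.hom) h,
      fun ψ => ⟨ψ ≫ b.hom, by simp [hba]⟩⟩
  convert! e.comp h using 1
  ext φ
  exact ((Category.assoc _ _ _).trans (congrArg (φ ≫ ·) ha)).symm

/-- Up to isomorphism, a coreflection of `X` is the counit of a coreflector. -/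
lemma bijective_counit_comp_of_coreflection {rho : K ⥤ P.FullSubcategory} (adj : P.ι ⊣ rho)
    {X Q : K} (r : Q ⟶ X) (hQ : P Q)
    (hr : ∀ Q', P Q' → Function.Bijective fun θ : Q' ⟶ Q => θ ≫ r) {V : K}
    (h : Function.Bijective fun φ : X ⟶ V => r ≫ φ) :
    Function.Bijective fun φ : X ⟶ V => adj.counit.app X ≫ φ := by
  obtain ⟨a, ha⟩ := (hr _ (rho.obj X).property).2 (adj.counit.app X)
  let b : ⟨Q, hQ⟩ ⟶ rho.obj X := adj.homEquiv ⟨Q, hQ⟩ X r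
  have hb : b.hom ≫ adj.counit.app X = r :=
    (adj.homEquiv_counit _ _ _).symm.trans ((adj.homEquiv ⟨Q, hQ⟩ X).symm_apply_apply r)
  have hba : b.hom ≫ a = 𝟙 Q := (hr Q hQ).1 (by
    dsimp only at ha ⊢
    rw [Category.assoc, ha, hb, Category.id_comp])
  have hab : a ≫ b.hom = 𝟙 (rho.obj X).obj := by
    have : (P.fullyFaithfulι.preimage a : rho.obj X ⟶ (⟨Q, hQ⟩ : P.FullSubcategory)) ≫ b =
        𝟙 (rho.obj X) := by
      apply (adj.homEquiv _ X).symm.injective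
      rw [adj.homEquiv_counit, adj.homEquiv_counit]
      change (a ≫ b.hom) ≫ adj.counit.app X = 𝟙 _ ≫ adj.counit.app X
      rw [Category.assoc, hb]
      exact ha.trans (Category.id_comp _).symm
    exact congrArg (P.ι.map ·) this
  have e : Function.Bijective fun φ : Q ⟶ V => a ≫ φ :=
    ⟨fun φ ψ h => by simpa [reassoc_of% hba] using congrArg (b.hom ≫ ·) h,
      fun ψ => ⟨b.hom ≫ ψ, by simp [reassoc_of% hab]⟩⟩
  convert! e.comp h using 1
  ext φ
  exact ((Category.assoc _ _ _).symm.trans (congrArg (· ≫ φ) ha)).symm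

end Reflection

section Main

variable {Λ Γ : Type u} [Ring Λ] [Ring Γ] (f : Λ →+* Γ)

/-- Restriction is left adjoint to `Hom_Λ(Γ, -)` on homotopy categories. -/
noncomputable def resHomAdj : resK f ⊣ homK f :=
  (ModuleCat.restrictCoextendScalarsAdj f.op).mapHomotopyCategory _

/-- Restriction is right adjoint to `- ⊗_Λ Γ` on homotopy categories. -/
noncomputable def tensorResAdj : tensorK f ⊣ resK f :=
  (tensorAdj f).mapHomotopyCategory _

/-- The adjoint triple on complexes of injectives. The second adjunction restricts the one between
restriction and `Hom_Λ(Γ, -)`; the first holds because the reflection of a restricted complex of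
injectives is inverted by `Hom(Ω̃ᵈ X, -)`. -/
lemma nonempty_adjunctionTriple_injective (d : ℕ) (h : HasProjectiveDimensionLE (leftMod f) d)
    {lamΛ : KMod Λ ⥤ KInj Λ} {lamΓ : KMod Γ ⥤ KInj Γ} (adjΛ : lamΛ ⊣ inclInj Λ)
    (adjΓ : lamΓ ⊣ inclInj Γ) :
    Nonempty (Adjunction.Triple (inclInj Λ ⋙ iter SyzShift d ⋙ tensorK f ⋙ lamΓ)
      (inclInj Γ ⋙ resK f ⋙ lamΛ) (homInj f)) := by
  have adj₁ : inclInj Λ ⋙ iter SyzShift d ⋙ tensorK f ⋙ lamΓ ⊣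
      (inclInj Γ ⋙ resK f) ⋙ lamΛ := by
    refine adjunctionOfReflector (injTerms (ModR Λ)).fullyFaithfulι adjΛ
      ((tensorResAdj f).comp adjΓ) (iterCounit syzShiftCounit d) (fun X E => ?_) (fun X Y => ?_)
    · exact bijective_iterCounit_comp _ (bijective_syzShiftCounit_comp E.property) d _
    · obtain ⟨E, r, hE, hr, hW⟩ := exists_reflection_of_hasInjectiveDimensionLE d
        ((resK f).obj Y.obj).as fun n =>
          have := Y.property n
          hasInjectiveDimensionLE_res f d h (Y.obj.as.X n)
      exact bijective_comp_unit_of_reflection adjΛ r hE hr (hW d le_rfl _)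
  have adj₂ : inclInj Γ ⋙ resK f ⋙ lamΛ ⊣ homInj f :=
    ((resHomAdj f).comp adjΛ).restrictFullyFaithful (injTerms (ModR Γ)).fullyFaithfulι
      (Functor.FullyFaithful.id _) (Iso.refl _) (Iso.refl _)
  exact ⟨⟨adj₁, adj₂⟩⟩

/-- The adjoint triple on complexes of projectives. The first adjunction restricts the one between
`- ⊗_Λ Γ` and restriction; the second holds because the coreflection of a restricted complex of
projectives is inverted by `Hom(-, ℧̃ᵈ X)`. -/
lemma nonempty_adjunctionTriple_projective (d : ℕ) (h : HasProjectiveDimensionLE (rightMod f) d)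
    {rhoΛ : KMod Λ ⥤ KProj Λ} {rhoΓ : KMod Γ ⥤ KProj Γ} (adjΛ : inclProj Λ ⊣ rhoΛ)
    (adjΓ : inclProj Γ ⊣ rhoΓ) :
    Nonempty (Adjunction.Triple (tensorProj f) (inclProj Γ ⋙ resK f ⋙ rhoΛ)
      (inclProj Λ ⋙ iter CosyzShift d ⋙ homK f ⋙ rhoΓ)) := by
  have adj₁ : tensorProj f ⊣ inclProj Γ ⋙ resK f ⋙ rhoΛ :=
    (adjΛ.comp (tensorResAdj f)).restrictFullyFaithful (Functor.FullyFaithful.id _)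
      (projTerms (ModR Γ)).fullyFaithfulι (Iso.refl _) (Iso.refl _)
  have adj₂ : (inclProj Γ ⋙ resK f) ⋙ rhoΛ ⊣
      inclProj Λ ⋙ iter CosyzShift d ⋙ homK f ⋙ rhoΓ := by
    refine adjunctionOfCoreflector (projTerms (ModR Λ)).fullyFaithfulι adjΛ
      (adjΓ.comp (resHomAdj f)) (iterUnit cosyzShiftUnit d) (fun Q X => ?_) (fun X Y => ?_)
    · exact bijective_comp_iterUnit _ (bijective_comp_cosyzShiftUnit Q.property) d _
    · obtain ⟨Q, c, hQ, hc, hW⟩ := exists_coreflection_of_hasProjectiveDimensionLE d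
        ((resK f).obj Y.obj).as fun n =>
          have := Y.property n
          hasProjectiveDimensionLE_res f d h (Y.obj.as.X n)
      exact bijective_counit_comp_of_coreflection adjΛ c hQ hc (hW d le_rfl _)
  exact ⟨⟨adj₁, adj₂⟩⟩

end Main

end HomotopyAdj

open HomotopyAdj
theorem mainTheorem7 {Λ Γ : Type u} [Ring Λ] [Ring Γ] (f : Λ →+* Γ) :
    (∀ d : ℕ, HasProjectiveDimensionLE (leftMod f) d →
      ∃ (lamΛ : KMod Λ ⥤ KInj Λ) (lamΓ : KMod Γ ⥤ KInj Γ),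
        Nonempty (lamΛ ⊣ inclInj Λ) ∧ Nonempty (lamΓ ⊣ inclInj Γ) ∧
        Nonempty (Adjunction.Triple
          (inclInj Λ ⋙ iter SyzShift d ⋙ tensorK f ⋙ lamΓ)
          (inclInj Γ ⋙ resK f ⋙ lamΛ)
          (homInj f))) ∧
    (∀ d' : ℕ, HasProjectiveDimensionLE (rightMod f) d' →
      ∃ (rhoΛ : KMod Λ ⥤ KProj Λ) (rhoΓ : KMod Γ ⥤ KProj Γ),
        Nonempty (inclProj Λ ⊣ rhoΛ) ∧ Nonempty (inclProj Γ ⊣ rhoΓ) ∧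
        Nonempty (Adjunction.Triple
          (tensorProj f)
          (inclProj Γ ⋙ resK f ⋙ rhoΛ)
          (inclProj Λ ⋙ iter CosyzShift d' ⋙ homK f ⋙ rhoΓ))) := by
  constructor
  · intro d h
    have : (inclInj Λ).IsRightAdjoint := isRightAdjoint_ι_injTerms.{u, u + 1, u} _
    have : (inclInj Γ).IsRightAdjoint := isRightAdjoint_ι_injTerms.{u, u + 1, u} _
    have adjΛ := Adjunction.ofIsRightAdjoint (inclInj Λ)
    have adjΓ := Adjunction.ofIsRightAdjoint (inclInj Γ)
    exact ⟨_, _, ⟨adjΛ⟩, ⟨adjΓ⟩, nonempty_adjunctionTriple_injective f d h adjΛ adjΓ⟩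
  · intro d' h
    have : (inclProj Λ).IsLeftAdjoint := isLeftAdjoint_ι_projTerms _
    have : (inclProj Γ).IsLeftAdjoint := isLeftAdjoint_ι_projTerms _
    have adjΛ := Adjunction.ofIsLeftAdjoint (inclProj Λ)
    have adjΓ := Adjunction.ofIsLeftAdjoint (inclProj Γ)
    exact ⟨_, _, ⟨adjΛ⟩, ⟨adjΓ⟩, nonempty_adjunctionTriple_projective f d' h adjΛ adjΓ⟩
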